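/- Let $n \ge 1$ and let $L$ be a full-rank Euclidean lattice in $\mathbb{R}^n$. Let $\operatorname{Aut}(L)$ be the group of all $g \in O(n)$ with $gL = L$, and let $t(L) \in \mathbb{N} \cup \{\infty\}$ be the largest $t$ such that, for every $k \le t$, the $\operatorname{Aut}(L)$-invariant homogeneous polynomials of degree $k$ on $\mathbb{R}^n$ coincide with the $O(n)$-invariant ones. The set of lattices carries the quotient topology of $GL_n(\mathbb{R})/GL_n(\mathbb{Z})$, the coset of $P$ being identified with the lattice $P\mathbb{Z}^n$. Strict local minima of isometry-invariant functions of lattices (or of flat tori) are understood up to isometry: $f$ has a strict local minimum at $L_0$ on a set of lattices if every lattice $M$ of that set close enough to $L_0$ is either isometric to $L_0$ or satisfies $f(M) > f(L_0)$. Put $\zeta(M,s) = \sum_{x \in M \setminus \{0\}} \|x\|^{-2s}$ for real $s > n/2$. For a lattice $M$, let $X = \mathbb{R}^n/M$ be the associated flat torus, and let $\zeta_X$ be the meromorphic continuation to $\mathbb{C}$ of $\sum_{\lambda_j \neq 0} \lambda_j^{-s}$ ($\Re s > n/2$), where the $\lambda_j$ are the eigenvalues, with multiplicity, of the Laplacian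 of $X$; the height of $X$ is $h(X) = \zeta_X'(0)$. If $t(L) \ge 4$, then: 1. the lattice $L$ rescaled to covolume $1$ is $\zeta$-extreme at every real $s > n/2$, that is, it achieves a strict local minimum of $M \mapsto \zeta(M,s)$ on the set of lattices of covolume $1$; 2. the height is well defined, that is, for every lattice $M$ in $\mathbb{R}^n$ the function $\zeta_{\mathbb{R}^n/M}$ has such a continuation, holomorphic outside $s = n/2$; and the torus $\mathbb{R}^n/L^*$ associated with the dual lattice $L^*$ achieves a strict local minimum of the height on the set of $n$-dimensional flat tori of the same covolume. -/

import Mathlib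

open Filter Topology MeasureTheory
open scoped ContDiff

noncomputable section

/-- A full rank Euclidean lattice in `ℝⁿ`. -/
structure EuclideanLattice (n : ℕ) where
  carrier : Submodule ℤ (EuclideanSpace ℝ (Fin n))
  discrete : DiscreteTopology carrier
  isZLattice : IsZLattice ℝ carrier

namespace EuclideanLattice

variable {n : ℕ}

attribute [instance] EuclideanLattice.discrete EuclideanLattice.isZLattice

/-- The columns of an invertible matrix `P`, as a basis of `ℝⁿ`. -/
def columnBasis (P : GL (Fin n) ℝ) : Module.Basis (Fin n) ℝ (EuclideanSpace ℝ (Fin n)) :=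
  ((Pi.basisFun ℝ (Fin n)).map
    (LinearMap.GeneralLinearGroup.generalLinearEquiv ℝ (Fin n → ℝ)
      (Matrix.GeneralLinearGroup.toLin P))).map
    (WithLp.linearEquiv 2 ℝ (Fin n → ℝ)).symm

theorem columnBasis_apply (P : GL (Fin n) ℝ) (i j : Fin n) :
    columnBasis P j i = P.1 i j := by
  simp [columnBasis, Matrix.GeneralLinearGroup.toLin, Matrix.col]

/-- The lattice `P ℤⁿ` spanned by the columns of an invertible matrix `P`. -/
def ofGL (P : GL (Fin n) ℝ) : EuclideanLattice n where
  carrier := Submodule.span ℤ (Set.range (columnBasis P))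
  discrete := inferInstance
  isZLattice := inferInstance

/-- The quotient topology of `GLₙ(ℝ) / GLₙ(ℤ)`, under the identification of the coset of `P` with
the lattice `P ℤⁿ`. -/
instance : TopologicalSpace (EuclideanLattice n) :=
  TopologicalSpace.coinduced ofGL inferInstance

/-- The covolume (determinant) of a lattice. -/
def covol (L : EuclideanLattice n) : ℝ := ZLattice.covolume L.carrier

theorem covol_pos (L : EuclideanLattice n) : 0 < L.covol := ZLattice.covolume_pos L.carrier _

/-- The lattice `c L`. -/
def scale (c : ℝ) (hc : c ≠ 0) (L : EuclideanLattice n) : EuclideanLattice n where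
  carrier := ZLattice.comap ℝ L.carrier
    (ContinuousLinearEquiv.smulLeft (R₁ := ℝ) (M₁ := EuclideanSpace ℝ (Fin n))
      (Units.mk0 c hc)⁻¹).toLinearMap
  discrete := inferInstance
  isZLattice := inferInstance

theorem mem_scale {c : ℝ} (hc : c ≠ 0) (L : EuclideanLattice n) (x : EuclideanSpace ℝ (Fin n)) :
    x ∈ (L.scale c hc).carrier ↔ ∃ y ∈ L.carrier, x = c • y := by
  have h : x ∈ (L.scale c hc).carrier ↔ c⁻¹ • x ∈ L.carrier := Iff.rfl
  rw [h]
  constructor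
  · intro hx
    exact ⟨_, hx, by rw [smul_smul, mul_inv_cancel₀ hc, one_smul]⟩
  · rintro ⟨y, hy, rfl⟩
    rwa [smul_smul, inv_mul_cancel₀ hc, one_smul]

/-- The lattice `L` rescaled to covolume `1`. -/
def normalize (L : EuclideanLattice n) : EuclideanLattice n :=
  L.scale (L.covol ^ (-(1 : ℝ) / n)) (Real.rpow_pos_of_pos L.covol_pos _).ne'

/-- The set `{y | ∀ x ∈ L, x ⬝ y ∈ ℤ}`, as a `ℤ`-submodule of `ℝⁿ`. -/
def dualCarrier (L : EuclideanLattice n) : Submodule ℤ (EuclideanSpace ℝ (Fin n)) :=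
  LinearMap.BilinForm.dualSubmodule (R := ℤ) (innerₗ (EuclideanSpace ℝ (Fin n))) L.carrier

theorem mem_dualCarrier (L : EuclideanLattice n) (y : EuclideanSpace ℝ (Fin n)) :
    y ∈ L.dualCarrier ↔ ∀ x ∈ L.carrier, ∃ k : ℤ, (k : ℝ) = inner ℝ y x := by
  simp [dualCarrier, LinearMap.BilinForm.mem_dualSubmodule, Submodule.mem_one]

theorem exists_basis_dualCarrier (L : EuclideanLattice n) :
    ∃ b : Module.Basis (Module.Free.ChooseBasisIndex ℤ L.carrier) ℝ (EuclideanSpace ℝ (Fin n)),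
      L.dualCarrier = Submodule.span ℤ (Set.range b) := by
  classical
  have hB : LinearMap.BilinForm.Nondegenerate (innerₗ (EuclideanSpace ℝ (Fin n))) := by
    constructor
    · intro x hx
      exact inner_self_eq_zero.mp (hx x)
    · intro x hx
      exact inner_self_eq_zero.mp (hx x)
  refine ⟨LinearMap.BilinForm.dualBasis _ hB
    ((Module.Free.chooseBasis ℤ L.carrier).ofZLatticeBasis ℝ L.carrier), ?_⟩
  rw [← LinearMap.BilinForm.dualSubmodule_span_of_basis, Module.Basis.ofZLatticeBasis_span]
  rfl

instance (L : EuclideanLattice n) : DiscreteTopology L.dualCarrier := by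
  obtain ⟨b, hb⟩ := L.exists_basis_dualCarrier
  rw [hb]
  infer_instance

theorem span_dualCarrier (L : EuclideanLattice n) :
    Submodule.span ℝ (L.dualCarrier : Set (EuclideanSpace ℝ (Fin n))) = ⊤ := by
  obtain ⟨b, hb⟩ := L.exists_basis_dualCarrier
  rw [hb]
  exact ZSpan.span_top b

/-- The dual lattice `L*`. -/
def dual (L : EuclideanLattice n) : EuclideanLattice n where
  carrier := L.dualCarrier
  discrete := inferInstance
  isZLattice := ⟨L.span_dualCarrier⟩

/-- Two lattices are isometric if an element of `O(n)` maps one onto the other. -/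
def Isometric (L M : EuclideanLattice n) : Prop :=
  ∃ φ : EuclideanSpace ℝ (Fin n) ≃ₗᵢ[ℝ] EuclideanSpace ℝ (Fin n),
    ∀ x, φ x ∈ M.carrier ↔ x ∈ L.carrier

/-- `L` achieves a strict local minimum of the function `f` on the set of lattices which have the
same covolume as `L`; lattices are considered up to isometry, so that "strict" refers to the
lattices that are not isometric to `L`. -/
def IsStrictLocalMin (f : EuclideanLattice n → ℝ) (L : EuclideanLattice n) : Prop :=
  ∀ᶠ M in 𝓝[{M | M.covol = L.covol}] L, L.Isometric M ∨ f L < f M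

/-! ### Automorphisms and invariant forms -/

/-- The automorphism group of `L`: the elements of `O(n)` that stabilize `L`. -/
def aut (L : EuclideanLattice n) :
    Subgroup (EuclideanSpace ℝ (Fin n) ≃ₗᵢ[ℝ] EuclideanSpace ℝ (Fin n)) where
  carrier := {g | ∀ x, g x ∈ L.carrier ↔ x ∈ L.carrier}
  mul_mem' {g h} hg hh x := (hg (h x)).trans (hh x)
  one_mem' _ := Iff.rfl
  inv_mem' {g} hg x := by
    have h := hg (g⁻¹ x)
    rw [show g (g⁻¹ x) = x from g.apply_symm_apply x] at h
    exact h.symm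

/-- The space of `G`-invariant homogeneous polynomials of degree `k` on `ℝⁿ`. -/
def invariantForms (G : Subgroup (EuclideanSpace ℝ (Fin n) ≃ₗᵢ[ℝ] EuclideanSpace ℝ (Fin n)))
    (k : ℕ) : Submodule ℝ (MvPolynomial (Fin n) ℝ) where
  carrier := {p | p.IsHomogeneous k ∧
    ∀ g ∈ G, ∀ x, MvPolynomial.eval (g x).ofLp p = MvPolynomial.eval x.ofLp p}
  add_mem' {p q} hp hq := ⟨hp.1.add hq.1, fun g hg x => by
    simp only [map_add, hp.2 g hg x, hq.2 g hg x]⟩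
  zero_mem' := ⟨MvPolynomial.isHomogeneous_zero _ _ _, fun g _ x => by simp⟩
  smul_mem' c p hp := ⟨(MvPolynomial.homogeneousSubmodule (Fin n) ℝ k).smul_mem c hp.1,
    fun g hg x => by simp only [MvPolynomial.smul_eval, hp.2 g hg x]⟩

/-- `t(L)`: the largest `t` (possibly infinite) such that the `Aut(L)`-invariant polynomials of
degree at most `t` are the `O(n)`-invariant ones. -/
def invariantStrength (L : EuclideanLattice n) : ℕ∞ :=
  sSup {t : ℕ∞ | ∀ k : ℕ, (k : ℕ∞) ≤ t → invariantForms (n := n) ⊤ k = invariantForms L.aut k}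

/-! ### The Epstein zeta function -/

/-- The Epstein zeta function `ζ(L, s) = ∑ ‖x‖ ^ (-2 s)` (`x ∈ L`, `x ≠ 0`), at real numbers
`s > n / 2`, where the series converges (see `summable_epsteinZeta`). -/
def epsteinZeta (L : EuclideanLattice n) (s : ℝ) : ℝ :=
  ∑' x : {x : EuclideanSpace ℝ (Fin n) // x ∈ L.carrier ∧ x ≠ 0}, ‖x.1‖ ^ (-2 * s)

theorem summable_epsteinZeta (L : EuclideanLattice n) {s : ℝ} (hs : (n : ℝ) / 2 < s) :
    Summable fun x : {x : EuclideanSpace ℝ (Fin n) // x ∈ L.carrier ∧ x ≠ 0} =>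
      ‖x.1‖ ^ (-2 * s) := by
  have h := ZLattice.summable_norm_rpow L.carrier (-2 * s) (by
    rw [ZLattice.rank ℝ L.carrier, finrank_euclideanSpace_fin]
    linarith)
  exact h.comp_injective
    (i := fun x : {x : EuclideanSpace ℝ (Fin n) // x ∈ L.carrier ∧ x ≠ 0} =>
      (⟨x.1, x.2.1⟩ : L.carrier))
    (fun x y hxy => Subtype.ext (congrArg (fun z : L.carrier => z.1) hxy))

/-- `L`, of covolume `1`, is `ζ`-extreme at `s > n / 2`: it achieves a strict local minimum of
`M ↦ ζ(M, s)` on the set of lattices of covolume `1`. -/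
def IsZetaExtreme (L : EuclideanLattice n) (s : ℝ) : Prop :=
  L.covol = 1 ∧ L.IsStrictLocalMin fun M => M.epsteinZeta s

/-! ### The height of the flat torus `ℝⁿ / L` -/

theorem two_le_infty : (2 : WithTop ℕ∞) ≤ ∞ := WithTop.coe_le_coe.mpr le_top

/-- The eigenspace of the (positive) Laplacian `-Δ` of the flat torus `ℝⁿ / L` for the eigenvalue
`μ`. Smooth functions on the torus are smooth `L`-periodic functions on `ℝⁿ`. -/
def torusEigenspace (L : EuclideanLattice n) (μ : ℝ) :
    Submodule ℂ (EuclideanSpace ℝ (Fin n) → ℂ) where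
  carrier := {f | ContDiff ℝ ∞ f ∧ (∀ x, ∀ l ∈ L.carrier, f (x + l) = f x) ∧
    ∀ x, -(Laplacian.laplacian f : EuclideanSpace ℝ (Fin n) → ℂ) x = (μ : ℂ) * f x}
  add_mem' {f g} hf hg := by
    refine ⟨hf.1.add hg.1, fun x l hl => ?_, fun x => ?_⟩
    · simp [hf.2.1 x l hl, hg.2.1 x l hl]
    · rw [ContDiffAt.laplacian_add (hf.1.of_le two_le_infty).contDiffAt (hg.1.of_le two_le_infty).contDiffAt,
        neg_add, hf.2.2 x, hg.2.2 x, Pi.add_apply, mul_add]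
  zero_mem' := by
    refine ⟨contDiff_const, fun x l _ => rfl, fun x => ?_⟩
    have h := congrFun (InnerProductSpace.laplacian_const (E := EuclideanSpace ℝ (Fin n))
      (c := (0 : ℂ))) x
    rw [show (0 : EuclideanSpace ℝ (Fin n) → ℂ) = fun _ => 0 from rfl, h]
    simp
  smul_mem' c f hf := by
    refine ⟨contDiff_const.mul hf.1, fun x l hl => ?_, fun x => ?_⟩
    · simp [hf.2.1 x l hl]
    · rw [InnerProductSpace.laplacian_smul c (hf.1.of_le two_le_infty).contDiffAt, smul_eq_mul,
        neg_mul_eq_mul_neg, hf.2.2 x, Pi.smul_apply, smul_eq_mul]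
      ring

/-- `F` is the zeta function of the flat torus `ℝⁿ / L`: the meromorphic continuation to `ℂ`, with
`n / 2` as its only possible pole, of the sum of `λ ^ (-s)` over the nonzero eigenvalues `λ` of the
Laplacian, counted with their multiplicities. -/
def IsTorusZeta (L : EuclideanLattice n) (F : ℂ → ℂ) : Prop :=
  (∀ s : ℂ, (n : ℝ) / 2 < s.re →
    HasSum (fun μ : {μ : ℝ // μ ≠ 0} =>
      (Module.finrank ℂ (L.torusEigenspace μ.1) : ℂ) * ((μ.1 : ℂ) ^ (-s))) (F s)) ∧
  DifferentiableOn ℂ F {(n : ℂ) / 2}ᶜ ∧ MeromorphicAt F ((n : ℂ) / 2)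

open Classical in
/-- The zeta function of the flat torus `ℝⁿ / L`. It is unique outside `n / 2` by the identity
theorem. -/
def torusZeta (L : EuclideanLattice n) : ℂ → ℂ :=
  if h : ∃ F, L.IsTorusZeta F then h.choose else 0

/-- The height `ζ_X'(0)` of the flat torus `X = ℝⁿ / L`. The zeta function is real on the real
axis, hence so is its derivative at `0`. -/
def torusHeight (L : EuclideanLattice n) : ℝ := (deriv L.torusZeta 0).re

end EuclideanLattice

end

/-!
The hypothesis `4 ≤ t(L)` says that an `Aut(L)`-invariant form of degree `4` is a multiple of
`‖v‖ ^ 4`. Applied to `v ↦ ∑ w(‖x‖²) ⟨x, v⟩ ^ 4`, summed over `L`, it gives by polarization the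
fourth moments of a spherical design (`moment_identity`): each weighted sum over `L` of a product of
two diagonal quadratic forms `∑ uᵢ xᵢ²` and `∑ vᵢ xᵢ²` is
`((∑ uᵢ) (∑ vᵢ) + 2 ∑ uᵢ vᵢ) / (n (n + 2))` times the weighted sum of `‖x‖ ^ 4`. As `Aut(L)` also
preserves `L*` and the multiples of `L`, the same holds for these lattices.

A lattice close to `L` is `A L` with `A` close to the identity, because `GLₙ(ℝ) → GLₙ(ℝ) / GLₙ(ℤ)`
is open. By the singular value decomposition of `A` (`exists_diagonalization`), `‖A x‖²` is
`∑ exp (λᵢ) xᵢ²` in a suitable orthonormal basis, the dual lattice being deformed by `-λ`. The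
covolume is preserved if and only if `∑ λᵢ = 0`, and `A` is an isometry if and only if `λ = 0`. So
the Taylor expansion of `∑ f(‖A x‖²)` at `λ = 0` has a vanishing first order term, and by the moment
identity its second order term is
`(∑ λᵢ²) / (2 n (n + 2)) * ∑ ((n + 2) r f'(r) + 2 r² f''(r))` with `r = ‖x‖²`
(`PowerDecay.exists_second_variation`); the third order error is uniform in the direction of
deformation. A positive coefficient gives a strict local minimum
(`isStrictLocalMin_of_second_variation`).

For the Epstein zeta function `f(r) = r ^ (-s)`, and the coefficient is a positive multiple of
`s (2 s - n) ζ(L, s)`.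

For the height, the plane waves `exp (2 π i ⟨y, x⟩)`, `y ∈ L*`, span the eigenspaces of the Laplacian
of `ℝⁿ / L` (`finrank_torusEigenspace`), so that its zeta function is `(4 π²) ^ (-s)` times the
Epstein zeta function of `L*`. Poisson summation gives the functional equation of the theta
function (`theta_functional_equation`), and Mathlib's theory of Mellin transforms of pairs of
functions related by such an equation (`WeakFEPair`) then provides the continuation, and a formula
for its derivative at `0` (`exists_torusHeight_eq_tsum`): at fixed covolume `V` the height is, up to
a constant, the sum over `L*` of `Γ(0, ‖x‖²)` plus `V` times the sum over `L` of `Γ(n / 2, ‖y‖²)`,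
where `Γ(a, r)` is the integral of `t ^ (a - 1) exp (-π r t)` over `t > 1` (`incGamma`). Integration
by parts turns the coefficients of the second variation into sums of elementary functions, and
their total is the value `n` given by the derivative at `t = 1` of the functional equation of the
theta function (`second_variation_height`).
-/

namespace EuclideanLattice

variable {n : ℕ}

/-! ### Lattices near a given lattice -/

theorem ext_carrier {L M : EuclideanLattice n} (h : L.carrier = M.carrier) : L = M := by
  cases L; cases M; cases h; rfl

theorem ofGL_surjective : Function.Surjective (ofGL (n := n)) := by
  intro L
  classical
  have hr : Module.finrank ℤ L.carrier = n := by
    rw [ZLattice.rank ℝ L.carrier, finrank_euclideanSpace_fin]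
  let b₀ : Module.Basis (Fin n) ℤ L.carrier :=
    (Module.finBasis ℤ L.carrier).reindex (finCongr hr)
  let b : Module.Basis (Fin n) ℝ (EuclideanSpace ℝ (Fin n)) := b₀.ofZLatticeBasis ℝ L.carrier
  let B : Matrix (Fin n) (Fin n) ℝ := (EuclideanSpace.basisFun (Fin n) ℝ).toBasis.toMatrix b
  have hB : IsUnit B := by
    have := Module.Basis.invertibleToMatrix (EuclideanSpace.basisFun (Fin n) ℝ).toBasis b
    exact isUnit_of_invertible B
  obtain ⟨P, hP⟩ := hB
  refine ⟨P, ext_carrier ?_⟩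
  have h : (columnBasis P : Fin n → EuclideanSpace ℝ (Fin n)) = b := by
    funext j
    ext i
    rw [columnBasis_apply, hP]
    simp [B, Module.Basis.toMatrix_apply]
  change Submodule.span ℤ (Set.range (columnBasis P)) = _
  rw [h]
  exact b₀.ofZLatticeBasis_span ℝ L.carrier

theorem mem_ofGL {P : GL (Fin n) ℝ} {x : EuclideanSpace ℝ (Fin n)} :
    x ∈ (ofGL P).carrier ↔ ∃ m : Fin n → ℤ, x.ofLp = P.1.mulVec (fun i => (m i : ℝ)) := by
  change x ∈ Submodule.span ℤ (Set.range (columnBasis P)) ↔ _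
  rw [Submodule.mem_span_range_iff_exists_fun]
  refine exists_congr fun m => ?_
  rw [PiLp.ext_iff, funext_iff]
  refine forall_congr' fun i => ?_
  simp only [← Int.cast_smul_eq_zsmul ℝ, WithLp.ofLp_sum, Finset.sum_apply, WithLp.ofLp_smul,
    Pi.smul_apply, columnBasis_apply, Matrix.mulVec, dotProduct, smul_eq_mul]
  rw [eq_comm]
  simp_rw [mul_comm]

/-- Right multiplication of `X` by `P⁻¹ Q` does not move the lattice `X ℤⁿ` if `P ℤⁿ = Q ℤⁿ`. -/
theorem ofGL_mul_eq {P Q : GL (Fin n) ℝ} (h : ofGL P = ofGL Q) (X : GL (Fin n) ℝ) :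
    ofGL (X * (P⁻¹ * Q)) = ofGL X := by
  apply ext_carrier
  ext x
  have key (v : Fin n → ℝ) :
      (X * (P⁻¹ * Q)).1.mulVec v = X.1.mulVec (P⁻¹.1.mulVec (Q.1.mulVec v)) := by
    simp [Matrix.mulVec_mulVec]
  have hinv (v : Fin n → ℝ) : P⁻¹.1.mulVec (P.1.mulVec v) = v := by
    rw [Matrix.mulVec_mulVec, ← Units.val_mul, inv_mul_cancel, Units.val_one, Matrix.one_mulVec]
  have hx (y : EuclideanSpace ℝ (Fin n)) : y ∈ (ofGL P).carrier ↔ y ∈ (ofGL Q).carrier := by rw [h]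
  rw [mem_ofGL, mem_ofGL]
  constructor
  · rintro ⟨m, hm⟩
    obtain ⟨k, hk⟩ := mem_ofGL.1 ((hx (WithLp.toLp 2 (Q.1.mulVec fun i => (m i : ℝ)))).2
      (mem_ofGL.2 ⟨m, rfl⟩))
    refine ⟨k, ?_⟩
    rw [hm, key, show Q.1.mulVec (fun i => (m i : ℝ)) = _ from hk, hinv]
  · rintro ⟨k, hk⟩
    obtain ⟨m, hm⟩ := mem_ofGL.1 ((hx (WithLp.toLp 2 (P.1.mulVec fun i => (k i : ℝ)))).1
      (mem_ofGL.2 ⟨k, rfl⟩))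
    refine ⟨m, ?_⟩
    rw [hk, key, ← show P.1.mulVec (fun i => (k i : ℝ)) = _ from hm, hinv]

/-- The saturation of an open set of `GLₙ(ℝ)` is a union of right translates of it. -/
theorem isOpenMap_ofGL : IsOpenMap (ofGL (n := n)) := by
  intro U hU
  rw [isOpen_coinduced]
  have : ofGL (n := n) ⁻¹' (ofGL '' U) =
      ⋃ g ∈ {g : GL (Fin n) ℝ | ∀ X, ofGL (X * g) = ofGL X}, (fun X => X * g) ⁻¹' U := by
    ext X
    simp only [Set.mem_preimage, Set.mem_image, Set.mem_iUnion, exists_prop, Set.mem_ofPred_eq]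
    constructor
    · rintro ⟨P, hP, h⟩
      exact ⟨X⁻¹ * P, ofGL_mul_eq h.symm, by simpa using hP⟩
    · rintro ⟨g, hg, h⟩
      exact ⟨X * g, h, hg X⟩
  rw [this]
  exact isOpen_biUnion fun g _ => hU.preimage (continuous_mul_const g)

/-- A property holds for all lattices near `L` if it holds for the images of `L` under the linear
maps near the identity. -/
theorem eventually_nhds_of_linear (L : EuclideanLattice n) {p : EuclideanLattice n → Prop}
    (h : ∀ᶠ A : EuclideanSpace ℝ (Fin n) →L[ℝ] EuclideanSpace ℝ (Fin n) in 𝓝 1,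
      ∀ M : EuclideanLattice n, (M.carrier : Set (EuclideanSpace ℝ (Fin n))) = A '' L.carrier → p M) :
    ∀ᶠ M in 𝓝 L, p M := by
  obtain ⟨P₀, rfl⟩ := ofGL_surjective L
  have hmap : map ofGL (𝓝 P₀) = 𝓝 (ofGL P₀) :=
    isOpenMap_ofGL.map_nhds_eq continuous_coinduced_rng.continuousAt
  rw [← hmap, eventually_map]
  let T : GL (Fin n) ℝ → (EuclideanSpace ℝ (Fin n) →L[ℝ] EuclideanSpace ℝ (Fin n)) :=
    fun P => Matrix.toEuclideanCLM (𝕜 := ℝ) (P * P₀⁻¹).1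
  have hT : Continuous T := by
    have h1 : Continuous (Matrix.toEuclideanCLM (n := Fin n) (𝕜 := ℝ)) :=
      LinearMap.continuous_of_finiteDimensional
        (Matrix.toEuclideanCLM (n := Fin n) (𝕜 := ℝ)).toAlgEquiv.toLinearMap
    exact h1.comp (Units.continuous_val.comp (continuous_mul_const _))
  have hT1 : T P₀ = 1 := by simp only [T, mul_inv_cancel, Units.val_one, map_one]
  have := hT.tendsto P₀
  rw [hT1] at this
  filter_upwards [this.eventually h] with P hP
  apply hP
  have key (m : Fin n → ℝ) : (T P (WithLp.toLp 2 (P₀.1.mulVec m))).ofLp = P.1.mulVec m := by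
    simp [T, Matrix.mulVec_mulVec]
  ext x
  simp only [SetLike.mem_coe, Set.mem_image, mem_ofGL]
  constructor
  · rintro ⟨m, hm⟩
    exact ⟨WithLp.toLp 2 (P₀.1.mulVec fun i => (m i : ℝ)), ⟨m, rfl⟩, by
      apply (WithLp.ofLp_injective 2); rw [key, hm]⟩
  · rintro ⟨y, ⟨m, hm⟩, rfl⟩
    refine ⟨m, ?_⟩
    rw [← key, ← hm]

theorem covol_eq_det {L : EuclideanLattice n} (b : Module.Basis (Fin n) ℝ (EuclideanSpace ℝ (Fin n)))
    (hb : L.carrier = Submodule.span ℤ (Set.range b)) :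
    L.covol = |(EuclideanSpace.basisFun (Fin n) ℝ).toBasis.det b| := by
  classical
  have h1 : L.covol = volume.real (ZSpan.fundamentalDomain b) := by
    apply ZLattice.covolume_eq_measure_fundamentalDomain
    rw [hb]
    exact ZSpan.isAddFundamentalDomain b volume
  rw [h1, ZSpan.measureReal_fundamentalDomain b volume
    (EuclideanSpace.basisFun (Fin n) ℝ).toBasis]
  have h2 : volume.real (ZSpan.fundamentalDomain (EuclideanSpace.basisFun (Fin n) ℝ).toBasis) = 1 := by
    rw [measureReal_congr (ZSpan.fundamentalDomain_ae_parallelepiped _ volume), measureReal_def]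
    have := (EuclideanSpace.basisFun (Fin n) ℝ).volume_parallelepiped
    rw [OrthonormalBasis.coe_toBasis, this]
    simp
  rw [h2, mul_one]

theorem exists_basis (L : EuclideanLattice n) :
    ∃ b : Module.Basis (Fin n) ℝ (EuclideanSpace ℝ (Fin n)),
      L.carrier = Submodule.span ℤ (Set.range b) := by
  obtain ⟨P, rfl⟩ := ofGL_surjective L
  exact ⟨columnBasis P, rfl⟩

theorem covol_image {L M : EuclideanLattice n}
    (A : EuclideanSpace ℝ (Fin n) ≃ₗ[ℝ] EuclideanSpace ℝ (Fin n))
    (h : (M.carrier : Set (EuclideanSpace ℝ (Fin n))) = A '' L.carrier) :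
    M.covol = |LinearMap.det (A : EuclideanSpace ℝ (Fin n) →ₗ[ℝ] EuclideanSpace ℝ (Fin n))| *
      L.covol := by
  obtain ⟨b, hb⟩ := L.exists_basis
  have hM : M.carrier = Submodule.span ℤ (Set.range (b.map A)) := by
    apply SetLike.coe_injective
    rw [h, hb]
    have : Set.range (b.map A) = (A.toLinearMap.restrictScalars ℤ) '' Set.range b := by
      rw [← Set.range_comp]; rfl
    rw [this, ← Submodule.map_span]
    rfl
  rw [covol_eq_det b hb, covol_eq_det _ hM, ← abs_mul]
  congr 1
  exact Module.Basis.det_comp _ _ _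

/-! ### The dual lattice and automorphism groups -/

theorem mem_dual {L : EuclideanLattice n} {y : EuclideanSpace ℝ (Fin n)} :
    y ∈ L.dual.carrier ↔ ∀ x ∈ L.carrier, ∃ k : ℤ, (k : ℝ) = inner ℝ y x :=
  L.mem_dualCarrier y

/-- If `A' ᵀ A = 1` and `M = A L` then `M* = A' L*`. -/
theorem dual_image {L M : EuclideanLattice n}
    (A A' : EuclideanSpace ℝ (Fin n) ≃ₗ[ℝ] EuclideanSpace ℝ (Fin n))
    (hA : ∀ x y, inner ℝ (A' y) (A x) = inner ℝ y x)
    (h : (M.carrier : Set (EuclideanSpace ℝ (Fin n))) = A '' L.carrier) :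
    (M.dual.carrier : Set (EuclideanSpace ℝ (Fin n))) = A' '' L.dual.carrier := by
  have hmem (x) : x ∈ M.carrier ↔ ∃ z ∈ L.carrier, A z = x := by
    rw [← SetLike.mem_coe, h]; rfl
  ext y
  obtain ⟨z, rfl⟩ := A'.surjective y
  rw [A'.injective.mem_set_image, SetLike.mem_coe, SetLike.mem_coe, mem_dual, mem_dual]
  constructor
  · intro H x hx
    obtain ⟨k, hk⟩ := H (A x) ((hmem _).2 ⟨x, hx, rfl⟩)
    exact ⟨k, by rw [hk, hA]⟩
  · intro H x hx
    obtain ⟨w, hw, rfl⟩ := (hmem x).1 hx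
    rw [hA]
    exact H w hw

theorem aut_le_aut_dual (L : EuclideanLattice n) : L.aut ≤ L.dual.aut := by
  intro g hg y
  have key : ∀ y, y ∈ L.dual.carrier → g y ∈ L.dual.carrier := by
    intro y hy
    rw [mem_dual] at hy ⊢
    intro x hx
    have hx' : g.symm x ∈ L.carrier := by
      rw [← hg (g.symm x)]; simpa using hx
    obtain ⟨k, hk⟩ := hy _ hx'
    refine ⟨k, ?_⟩
    rw [hk, ← g.inner_map_map, g.apply_symm_apply]
  refine ⟨fun hy => ?_, key y⟩
  rw [mem_dual] at hy ⊢
  intro x hx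
  obtain ⟨k, hk⟩ := hy (g x) ((hg x).2 hx)
  exact ⟨k, by rw [hk, g.inner_map_map]⟩

theorem aut_le_aut_normalize (L : EuclideanLattice n) : L.aut ≤ L.normalize.aut := by
  intro g hg x
  change g x ∈ (L.scale _ _).carrier ↔ x ∈ (L.scale _ _).carrier
  rw [mem_scale, mem_scale]
  constructor
  · rintro ⟨y, hy, h⟩
    refine ⟨g.symm y, ?_, ?_⟩
    · rw [← hg]; simpa using hy
    · rw [← map_smul, ← h, g.symm_apply_apply]
  · rintro ⟨y, hy, rfl⟩
    exact ⟨g y, (hg y).2 hy, by rw [map_smul]⟩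

theorem covol_normalize (hn : 1 ≤ n) (L : EuclideanLattice n) : L.normalize.covol = 1 := by
  have hc := Real.rpow_pos_of_pos L.covol_pos (-(1 : ℝ) / n)
  set c := L.covol ^ (-(1 : ℝ) / n) with hcdef
  have h := covol_image (L := L) (M := L.normalize) (LinearEquiv.smulOfNeZero ℝ _ c hc.ne') (by
    ext x
    change x ∈ (L.scale c hc.ne').carrier ↔ _
    rw [mem_scale]
    simp only [Set.mem_image, LinearEquiv.smulOfNeZero_apply, SetLike.mem_coe]
    exact exists_congr fun y => and_congr_right fun _ => eq_comm)
  rw [h]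
  have : ((LinearEquiv.smulOfNeZero ℝ (EuclideanSpace ℝ (Fin n)) c hc.ne' :
      EuclideanSpace ℝ (Fin n) ≃ₗ[ℝ] EuclideanSpace ℝ (Fin n)) :
      EuclideanSpace ℝ (Fin n) →ₗ[ℝ] EuclideanSpace ℝ (Fin n)) = c • LinearMap.id := by
    ext; simp
  rw [this, LinearMap.det_smul, LinearMap.det_id, mul_one, finrank_euclideanSpace_fin,
    abs_of_pos (pow_pos hc n), hcdef, ← Real.rpow_natCast, ← Real.rpow_mul L.covol_pos.le,
    div_mul_cancel₀ _ (by positivity), Real.rpow_neg_one, inv_mul_cancel₀ L.covol_pos.ne']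

theorem invariantForms_anti {G G' : Subgroup (EuclideanSpace ℝ (Fin n) ≃ₗᵢ[ℝ] EuclideanSpace ℝ (Fin n))}
    (h : G ≤ G') (k : ℕ) : invariantForms G' k ≤ invariantForms G k :=
  fun _ hp => ⟨hp.1, fun g hg => hp.2 g (h hg)⟩

theorem invariantForms_aut_le {L : EuclideanLattice n} (hL : 4 ≤ L.invariantStrength) :
    invariantForms L.aut 4 ≤ invariantForms ⊤ 4 := by
  by_contra hne
  have : L.invariantStrength ≤ 3 := by
    apply sSup_le
    intro t ht
    by_contra hlt
    have h4 : (4 : ℕ∞) ≤ t := by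
      have := Order.add_one_le_of_lt (not_le.1 hlt)
      exact this
    exact hne (ht 4 h4).ge
  have h := hL.trans this
  exact absurd h (by decide)

end EuclideanLattice

/-! ### Fourier series of functions with period lattice `ℤⁿ` -/

namespace PeriodicFourier

variable {n : ℕ}

/-- The half-open unit box with lower corner `a`, a fundamental domain of `ℤⁿ`. -/
def box (a : Fin n → ℝ) : Set (Fin n → ℝ) := {x | ∀ i, x i ∈ Set.Ioc (a i) (a i + 1)}

/-- The integer vector `m` as a point of `ℝⁿ`. -/
noncomputable def toReal (m : Fin n → ℤ) : Fin n → ℝ := fun i => (m i : ℝ)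

/-- The character `exp (2 π i t)` of `ℝ`. -/
noncomputable def char (t : ℝ) : ℂ := Complex.exp (2 * Real.pi * Complex.I * t)

theorem char_add (s t : ℝ) : char (s + t) = char s * char t := by
  simp only [char, ← Complex.exp_add]
  push_cast
  ring_nf

theorem char_int (k : ℤ) : char k = 1 := by
  rw [char, Complex.exp_eq_one_iff]
  exact ⟨k, by push_cast; ring⟩

theorem norm_char (t : ℝ) : ‖char t‖ = 1 := by
  rw [char, show (2 * Real.pi * Complex.I * t : ℂ) = ((2 * Real.pi * t : ℝ) : ℂ) * Complex.I by
    push_cast; ring]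
  exact Complex.norm_exp_ofReal_mul_I _

theorem char_zero : char 0 = 1 := by simpa using char_int 0

@[fun_prop]
theorem continuous_char : Continuous char := by
  unfold char; fun_prop

/-- The function `f` is `ℤⁿ`-periodic. -/
def IsPeriodic (f : (Fin n → ℝ) → ℂ) : Prop := ∀ x m, f (x + toReal m) = f x

/-- The `k`-th Fourier coefficient of a `ℤⁿ`-periodic function. -/
noncomputable def coeff (f : (Fin n → ℝ) → ℂ) (k : Fin n → ℤ) : ℂ :=
  ∫ x in box 0, char (-(toReal k ⬝ᵥ x)) * f x

/-- The projection of `ℝⁿ` onto the torus. -/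
noncomputable def proj (x : Fin n → ℝ) : UnitAddTorus (Fin n) := fun i => (x i : UnitAddCircle)

theorem mFourier_proj (k : Fin n → ℤ) (x : Fin n → ℝ) :
    UnitAddTorus.mFourier k (proj x) = char (toReal k ⬝ᵥ x) := by
  simp only [UnitAddTorus.mFourier, ContinuousMap.coe_mk, proj, fourier_coe_apply, char,
    ← Complex.exp_sum, dotProduct, toReal]
  congr 1
  push_cast
  rw [Finset.mul_sum]
  refine Finset.sum_congr rfl fun i _ => ?_
  ring

theorem exists_lift {f : (Fin n → ℝ) → ℂ} (hc : Continuous f) (hf : IsPeriodic f) :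
    ∃ F : C(UnitAddTorus (Fin n), ℂ), ∀ x, F (proj x) = f x := by
  have hq : Topology.IsQuotientMap (proj (n := n)) := by
    have h : IsOpenQuotientMap (fun x : ℝ => (x : UnitAddCircle)) :=
      QuotientAddGroup.isOpenQuotientMap_mk
    exact (IsOpenQuotientMap.piMap (fun _ : Fin n => h)).isQuotientMap
  have hfac : ∀ x y, proj x = proj y → f x = f y := by
    intro x y hxy
    have : ∀ i, ∃ m : ℤ, x i = y i + m := by
      intro i
      have h := congrFun hxy i
      obtain ⟨m, hm⟩ := (QuotientAddGroup.eq_iff_sub_mem.1 h)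
      exact ⟨m, by simp at hm; linarith⟩
    choose m hm using this
    rw [← hf y m]
    congr 1
    funext i
    exact hm i
  let G : C(Fin n → ℝ, ℂ) := ⟨f, hc⟩
  refine ⟨hq.lift (f := ⟨proj, hq.continuous⟩) G hfac, fun x => ?_⟩
  exact congrArg (fun H : C(Fin n → ℝ, ℂ) => H x) (hq.lift_comp (f := ⟨proj, hq.continuous⟩) G hfac)

theorem mFourierCoeff_eq {f : (Fin n → ℝ) → ℂ} {F : C(UnitAddTorus (Fin n), ℂ)}
    (hF : ∀ x, F (proj x) = f x) (k : Fin n → ℤ) (a : Fin n → ℝ) :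
    UnitAddTorus.mFourierCoeff F k = ∫ x in box a, char (-(toReal k ⬝ᵥ x)) * f x := by
  rw [UnitAddTorus.mFourierCoeff_eq_integral F k a]
  change ∫ x in box a, UnitAddTorus.mFourier (-k) (proj x) • F (proj x) = _
  simp_rw [hF, mFourier_proj, smul_eq_mul]
  congr! 4 with x
  rw [← neg_dotProduct]
  congr 1
  funext i
  simp [toReal]

/-- A Fourier coefficient can be computed by integration over any unit box. -/
theorem coeff_eq {f : (Fin n → ℝ) → ℂ} (hc : Continuous f) (hf : IsPeriodic f) (k : Fin n → ℤ)
    (a : Fin n → ℝ) : coeff f k = ∫ x in box a, char (-(toReal k ⬝ᵥ x)) * f x := by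
  obtain ⟨F, hF⟩ := exists_lift hc hf
  rw [coeff, ← mFourierCoeff_eq hF k a, ← mFourierCoeff_eq hF k 0]

theorem hasSum_of_summable_coeff {f : (Fin n → ℝ) → ℂ} (hc : Continuous f) (hf : IsPeriodic f)
    (hs : Summable (coeff f)) (x : Fin n → ℝ) :
    HasSum (fun k => coeff f k * char (toReal k ⬝ᵥ x)) (f x) := by
  obtain ⟨F, hF⟩ := exists_lift hc hf
  have h : UnitAddTorus.mFourierCoeff F = coeff f := by
    funext k
    rw [coeff, ← mFourierCoeff_eq hF k 0]
  have := UnitAddTorus.hasSum_mFourier_series_apply_of_summable (f := F) (h ▸ hs) (proj x)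
  rw [h, hF] at this
  simpa only [mFourier_proj, smul_eq_mul] using this

theorem exists_bound {f : (Fin n → ℝ) → ℂ} (hc : Continuous f) (hf : IsPeriodic f) :
    ∃ C, ∀ x, ‖f x‖ ≤ C := by
  obtain ⟨F, hF⟩ := exists_lift hc hf
  exact ⟨‖F‖, fun x => hF x ▸ F.norm_coe_le_norm _⟩

theorem measurableSet_box (a : Fin n → ℝ) : MeasurableSet (box a) :=
  MeasurableSet.univ_pi' fun _ => measurableSet_Ioc

theorem volume_box_lt_top (a : Fin n → ℝ) : volume (box a) < ⊤ := by
  have : box a ⊆ Set.Icc a (a + 1) := fun x hx => ⟨fun i => (hx i).1.le, fun i => (hx i).2⟩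
  exact (measure_mono this).trans_lt (isCompact_Icc.measure_lt_top)

theorem setIntegral_box_add (h : (Fin n → ℝ) → ℂ) (a v : Fin n → ℝ) :
    ∫ x in box (a + v), h x = ∫ x in box a, h (x + v) := by
  have hmp := measurePreserving_add_right (volume : Measure (Fin n → ℝ)) v
  rw [← hmp.setIntegral_preimage_emb (measurableEmbedding_addRight v)]
  congr 2
  ext x
  simp only [box, Set.mem_preimage, Set.mem_ofPred_eq, Pi.add_apply, Set.mem_Ioc]
  refine forall_congr' fun i => ?_
  constructor <;> rintro ⟨h1, h2⟩ <;> constructor <;> linarith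

theorem coeff_translate {f : (Fin n → ℝ) → ℂ} (hc : Continuous f) (hf : IsPeriodic f)
    (k : Fin n → ℤ) (v : Fin n → ℝ) :
    coeff (fun x => f (x + v)) k = char (toReal k ⬝ᵥ v) * coeff f k := by
  rw [coeff_eq hc hf k (0 + v), setIntegral_box_add, coeff, ← integral_const_mul]
  refine integral_congr_ae (Eventually.of_forall fun x => ?_)
  have : char (-(toReal k ⬝ᵥ x)) = char (toReal k ⬝ᵥ v) * char (-(toReal k ⬝ᵥ (x + v))) := by
    rw [← char_add, dotProduct_add]
    congr 1
    ring
  simp only [this, mul_assoc]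

/-- The Fourier coefficients of a directional derivative: differentiate `coeff_translate`. -/
theorem coeff_deriv {f f' : (Fin n → ℝ) → ℂ} (hc : Continuous f) (hf : IsPeriodic f)
    (hc' : Continuous f') (hf' : IsPeriodic f') (v : Fin n → ℝ)
    (hd : ∀ x, HasDerivAt (fun t : ℝ => f (x + t • v)) (f' x) 0) (k : Fin n → ℤ) :
    coeff f' k = 2 * Real.pi * Complex.I * (toReal k ⬝ᵥ v : ℝ) * coeff f k := by
  obtain ⟨C, hC⟩ := exists_bound hc' hf'
  have hd' (x : Fin n → ℝ) (t : ℝ) : HasDerivAt (fun t : ℝ => f (x + t • v)) (f' (x + t • v)) t := by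
    have h := hd (x + t • v)
    have h2 := (HasDerivAt.comp_sub_const t t (by simpa using h) :
      HasDerivAt (fun s : ℝ => f (x + t • v + (s - t) • v)) (f' (x + t • v)) t)
    refine h2.congr_of_eventuallyEq (Eventually.of_forall fun s => ?_)
    simp only
    rw [add_assoc, ← add_smul, add_sub_cancel]
  have h1 : HasDerivAt (fun t : ℝ => ∫ x in box 0, char (-(toReal k ⬝ᵥ x)) * f (x + t • v))
      (∫ x in box 0, char (-(toReal k ⬝ᵥ x)) * f' (x + (0 : ℝ) • v)) 0 := by
    have hfin : IsFiniteMeasure (volume.restrict (box (0 : Fin n → ℝ))) :=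
      ⟨by simpa using volume_box_lt_top 0⟩
    have hcd : Continuous fun x : Fin n → ℝ => char (-(toReal k ⬝ᵥ x)) :=
      continuous_char.comp (by unfold dotProduct; fun_prop)
    refine (hasDerivAt_integral_of_dominated_loc_of_deriv_le (μ := volume.restrict (box 0))
      (s := Set.univ) (bound := fun _ => C)
      (F' := fun t x => char (-(toReal k ⬝ᵥ x)) * f' (x + t • v)) univ_mem ?_ ?_ ?_ ?_ ?_ ?_).2
    · exact Eventually.of_forall fun t =>
        (hcd.mul (hc.comp (by fun_prop))).aestronglyMeasurable
    · obtain ⟨D, hD⟩ := exists_bound hc hf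
      refine Integrable.of_bound (hcd.mul (hc.comp (by fun_prop))).aestronglyMeasurable D
        (Eventually.of_forall fun x => ?_)
      rw [norm_mul, norm_char, one_mul]
      exact hD _
    · exact (hcd.mul (hc'.comp (by fun_prop))).aestronglyMeasurable
    · refine Eventually.of_forall fun x t _ => ?_
      rw [norm_mul, norm_char, one_mul]
      exact hC _
    · exact integrable_const _
    · exact Eventually.of_forall fun x t _ => (hd' x t).const_mul _
  have h2 : (fun t : ℝ => ∫ x in box 0, char (-(toReal k ⬝ᵥ x)) * f (x + t • v)) =
      fun t : ℝ => char (t * (toReal k ⬝ᵥ v)) * coeff f k := by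
    funext t
    have := coeff_translate hc hf k (t • v)
    rw [dotProduct_smul, smul_eq_mul] at this
    exact this
  have h3 : HasDerivAt (fun t : ℝ => char (t * (toReal k ⬝ᵥ v)) * coeff f k)
      (2 * Real.pi * Complex.I * (toReal k ⬝ᵥ v : ℝ) * coeff f k) 0 := by
    have h4 : HasDerivAt (fun t : ℝ => char (t * (toReal k ⬝ᵥ v)))
        (2 * Real.pi * Complex.I * (toReal k ⬝ᵥ v : ℝ)) 0 := by
      unfold char
      have h5 : HasDerivAt (fun t : ℝ => 2 * Real.pi * Complex.I * ((t * (toReal k ⬝ᵥ v) : ℝ) : ℂ))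
          (2 * Real.pi * Complex.I * (toReal k ⬝ᵥ v : ℝ)) 0 := by
        have := ((hasDerivAt_id (0 : ℝ)).mul_const (toReal k ⬝ᵥ v)).ofReal_comp
        simpa using this.const_mul (2 * Real.pi * Complex.I)
      simpa using h5.cexp
    exact h4.mul_const _
  rw [h2] at h1
  simpa [coeff] using h1.unique h3

/-! ### Poisson summation -/

theorem iUnion_box : ⋃ m : Fin n → ℤ, box (toReal m) = Set.univ := by
  refine Set.eq_univ_of_forall fun x => Set.mem_iUnion.2 ⟨fun i => ⌈x i⌉ - 1, fun i => ?_⟩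
  simp only [toReal]
  push_cast
  constructor
  · linarith [Int.ceil_lt_add_one (x i)]
  · linarith [Int.le_ceil (x i)]

theorem pairwise_disjoint_box : Pairwise (Function.onFun Disjoint fun m : Fin n → ℤ =>
    box (toReal m)) := by
  intro m m' hne
  refine Set.disjoint_left.2 fun x hx hx' => hne ?_
  funext i
  obtain ⟨h1, h2⟩ := hx i
  obtain ⟨h3, h4⟩ := hx' i
  simp only [toReal] at h1 h2 h3 h4
  have a1 : m i < m' i + 1 := by exact_mod_cast h1.trans_le h4
  have a2 : m' i < m i + 1 := by exact_mod_cast h3.trans_le h2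
  omega

/-- The Poisson summation formula for `ℤⁿ`, for functions whose translates are summable uniformly on
bounded sets and whose Fourier transform is summable on `ℤⁿ`. -/
theorem hasSum_poisson {g : (Fin n → ℝ) → ℂ} (hg : Continuous g) (hi : Integrable g)
    (hb : ∀ R : ℝ, ∃ u : (Fin n → ℤ) → ℝ, Summable u ∧
      ∀ m x, ‖x‖ ≤ R → ‖g (x + toReal m)‖ ≤ u m)
    (hs : Summable fun k : Fin n → ℤ => ∫ x, char (-(toReal k ⬝ᵥ x)) * g x) :
    HasSum (fun k : Fin n → ℤ => ∫ x, char (-(toReal k ⬝ᵥ x)) * g x)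
      (∑' m : Fin n → ℤ, g (toReal m)) := by
  -- the formula is the Fourier expansion at `0` of the periodization of `g`
  let G : (Fin n → ℝ) → ℂ := fun x => ∑' m : Fin n → ℤ, g (x + toReal m)
  have hGc : Continuous G := by
    rw [continuous_iff_continuousAt]
    intro x
    obtain ⟨u, hu, hub⟩ := hb (‖x‖ + 1)
    have : ContinuousOn G (Metric.ball 0 (‖x‖ + 1)) := by
      refine continuousOn_tsum (fun m => (hg.comp (by fun_prop)).continuousOn) hu fun m y hy => ?_
      exact hub m y (by simpa using (mem_ball_zero_iff.1 hy).le)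
    exact this.continuousAt (Metric.isOpen_ball.mem_nhds (by simp))
  have hGp : IsPeriodic G := by
    intro x m
    have : ∀ m', g (x + toReal m + toReal m') = g (x + toReal (Equiv.addLeft m m')) := by
      intro m'
      congr 1
      funext i
      simp [toReal, add_assoc]
    simp only [G]
    simp_rw [this]
    exact (Equiv.addLeft m).tsum_eq fun m' => g (x + toReal m')
  have hcd (k : Fin n → ℤ) : Continuous fun x : Fin n → ℝ => char (-(toReal k ⬝ᵥ x)) :=
    continuous_char.comp (by unfold dotProduct; fun_prop)
  have hchar (k m : Fin n → ℤ) (x : Fin n → ℝ) :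
      char (-(toReal k ⬝ᵥ (x + toReal m))) = char (-(toReal k ⬝ᵥ x)) := by
    have : toReal k ⬝ᵥ toReal m = ((k ⬝ᵥ m : ℤ) : ℝ) := by simp [toReal, dotProduct]
    rw [dotProduct_add, neg_add, char_add, this, ← Int.cast_neg, char_int, mul_one]
  have hcoeff (k) : coeff G k = ∫ x, char (-(toReal k ⬝ᵥ x)) * g x := by
    have hint : Integrable fun x => char (-(toReal k ⬝ᵥ x)) * g x := by
      refine hi.mono ((hcd k).mul hg).aestronglyMeasurable (Eventually.of_forall fun x => ?_)
      rw [norm_mul, norm_char, one_mul]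
    have h1 : HasSum (fun m => ∫ x in box (toReal m), char (-(toReal k ⬝ᵥ x)) * g x)
        (∫ x, char (-(toReal k ⬝ᵥ x)) * g x) := by
      have := hasSum_integral_iUnion (fun m => measurableSet_box (toReal m))
        pairwise_disjoint_box (hint.integrableOn (s := ⋃ m : Fin n → ℤ, box (toReal m)))
      rwa [iUnion_box, setIntegral_univ] at this
    have h2 (m : Fin n → ℤ) : ∫ x in box (toReal m), char (-(toReal k ⬝ᵥ x)) * g x =
        ∫ x in box 0, char (-(toReal k ⬝ᵥ x)) * g (x + toReal m) := by
      have := setIntegral_box_add (fun x => char (-(toReal k ⬝ᵥ x)) * g x) 0 (toReal m)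
      simp_rw [hchar, zero_add] at this
      exact this
    obtain ⟨u, hu, hub⟩ := hb 1
    have hfin : IsFiniteMeasure (volume.restrict (box (0 : Fin n → ℝ))) :=
      ⟨by simpa using volume_box_lt_top 0⟩
    have hbox : ∀ᵐ x ∂volume.restrict (box (0 : Fin n → ℝ)), ‖x‖ ≤ 1 := by
      refine (ae_restrict_iff' (measurableSet_box 0)).2 (Eventually.of_forall fun x hx => ?_)
      refine (pi_norm_le_iff_of_nonneg zero_le_one).2 fun i => ?_
      have := hx i
      simp only [Pi.zero_apply, zero_add, Set.mem_Ioc] at this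
      rw [Real.norm_eq_abs, abs_le]
      constructor <;> linarith
    have hbd (m : Fin n → ℤ) : ∀ᵐ x ∂volume.restrict (box (0 : Fin n → ℝ)),
        ‖char (-(toReal k ⬝ᵥ x)) * g (x + toReal m)‖ ≤ u m := by
      filter_upwards [hbox] with x hx
      rw [norm_mul, norm_char, one_mul]
      exact hub m x hx
    have hint' (m : Fin n → ℤ) : Integrable (fun x => char (-(toReal k ⬝ᵥ x)) * g (x + toReal m))
        (volume.restrict (box 0)) :=
      Integrable.of_bound ((hcd k).mul (hg.comp (by fun_prop))).aestronglyMeasurable _ (hbd m)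
    have h3 := hasSum_integral_of_summable_integral_norm hint' (by
      refine Summable.of_nonneg_of_le (fun m => integral_nonneg fun _ => norm_nonneg _)
        (fun m => ?_) (hu.mul_right (volume.real (box (0 : Fin n → ℝ))))
      refine (integral_mono_ae (hint' m).norm (integrable_const (u m)) (hbd m)).trans_eq ?_
      simp [mul_comm, measureReal_def])
    simp_rw [h2] at h1
    rw [h1.unique h3, coeff]
    congr! 3 with x
    exact tsum_mul_left.symm
  have hfun : coeff G = fun k => ∫ x, char (-(toReal k ⬝ᵥ x)) * g x := funext hcoeff
  have := hasSum_of_summable_coeff hGc hGp (by rw [hfun]; exact hs) 0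
  simpa [hfun, G, char_zero] using this

end PeriodicFourier

namespace EuclideanLattice

open PeriodicFourier

variable {n : ℕ}

/-! ### Coordinates on a lattice and on its dual -/

/-- The nonzero vectors of `L`. -/
abbrev Nz (L : EuclideanLattice n) : Type :=
  {x : EuclideanSpace ℝ (Fin n) // x ∈ L.carrier ∧ x ≠ 0}

theorem Nz.normSq_pos {L : EuclideanLattice n} (x : L.Nz) : 0 < ‖x.1‖ ^ 2 :=
  pow_pos (norm_pos_iff.2 x.2.2) 2

section Coordinates

variable (b : Module.Basis (Fin n) ℝ (EuclideanSpace ℝ (Fin n)))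

/-- The vector with coordinates `v` in the basis `b`. -/
noncomputable def coordVec (v : Fin n → ℝ) : EuclideanSpace ℝ (Fin n) := ∑ i, v i • b i

theorem coordVec_add (v w : Fin n → ℝ) : coordVec b (v + w) = coordVec b v + coordVec b w := by
  simp [coordVec, add_smul, Finset.sum_add_distrib]

theorem coordVec_smul (t : ℝ) (w : Fin n → ℝ) : coordVec b (t • w) = t • coordVec b w := by
  simp [coordVec, mul_smul, Finset.smul_sum]

@[fun_prop]
theorem continuous_coordVec : Continuous (coordVec b) := by
  unfold coordVec; fun_prop

theorem coordVec_eq (v : Fin n → ℝ) : coordVec b v = b.equivFun.symm v :=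
  (b.equivFun_symm_apply v).symm

theorem coordVec_surjective : Function.Surjective (coordVec b) := fun x =>
  ⟨b.equivFun x, by rw [coordVec_eq, LinearEquiv.symm_apply_apply]⟩

theorem coordVec_injective : Function.Injective (coordVec b) := by
  intro v w h
  rw [coordVec_eq, coordVec_eq] at h
  exact b.equivFun.symm.injective h

/-- The vector whose inner products with the vectors of the basis `b` are the given numbers. -/
noncomputable def dualVec (k : Fin n → ℝ) : EuclideanSpace ℝ (Fin n) :=
  (InnerProductSpace.toDual ℝ (EuclideanSpace ℝ (Fin n))).symm
    (LinearMap.toContinuousLinearMap (b.constr ℝ k))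

theorem inner_dualVec_coordVec (k v : Fin n → ℝ) :
    inner ℝ (dualVec b k) (coordVec b v) = k ⬝ᵥ v := by
  rw [dualVec, InnerProductSpace.toDual_symm_apply, coordVec]
  simp [dotProduct, mul_comm]

variable {L : EuclideanLattice n} {b}

theorem mem_carrier_iff (hb : L.carrier = Submodule.span ℤ (Set.range b))
    {x : EuclideanSpace ℝ (Fin n)} :
    x ∈ L.carrier ↔ ∃ m : Fin n → ℤ, coordVec b (toReal m) = x := by
  rw [hb, Submodule.mem_span_range_iff_exists_fun]
  simp only [coordVec, toReal, Int.cast_smul_eq_zsmul]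

/-- A basis of `L` identifies `L` with `ℤⁿ`. -/
noncomputable def latticeEquiv (hb : L.carrier = Submodule.span ℤ (Set.range b)) :
    (Fin n → ℤ) ≃ L.carrier :=
  Equiv.ofBijective (fun m => ⟨coordVec b (toReal m), (mem_carrier_iff hb).2 ⟨m, rfl⟩⟩) <| by
    constructor
    · intro m m' h
      have := coordVec_injective b (congrArg Subtype.val h)
      funext i
      simpa [toReal] using congrFun this i
    · rintro ⟨x, hx⟩
      obtain ⟨m, rfl⟩ := (mem_carrier_iff hb).1 hx
      exact ⟨m, rfl⟩

/-- A basis of `L` identifies `L*` with `ℤⁿ`, through the dual basis. -/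
noncomputable def dualEquiv (hb : L.carrier = Submodule.span ℤ (Set.range b)) :
    (Fin n → ℤ) ≃ L.dual.carrier :=
  Equiv.ofBijective (fun k => ⟨dualVec b (toReal k), mem_dual.2 fun x hx => by
    obtain ⟨m, rfl⟩ := (mem_carrier_iff hb).1 hx
    exact ⟨k ⬝ᵥ m, by rw [inner_dualVec_coordVec]; simp [toReal, dotProduct]⟩⟩) <| by
    constructor
    · intro k k' h
      have h' : dualVec b (toReal k) = dualVec b (toReal k') := congrArg Subtype.val h
      funext i
      have h1 := inner_dualVec_coordVec b (toReal k) (Pi.single i 1)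
      rw [h', inner_dualVec_coordVec] at h1
      simpa [toReal] using h1.symm
    · rintro ⟨y, hy⟩
      rw [mem_dual] at hy
      have (i : Fin n) : ∃ k : ℤ, (k : ℝ) = inner ℝ y (b i) :=
        hy _ (by rw [hb]; exact Submodule.subset_span ⟨i, rfl⟩)
      choose k hk using this
      refine ⟨k, Subtype.ext (ext_inner_right ℝ fun x => ?_)⟩
      obtain ⟨v, rfl⟩ := coordVec_surjective b x
      rw [inner_dualVec_coordVec]
      simp only [coordVec, inner_sum, inner_smul_right, dotProduct, toReal, hk, mul_comm]

theorem integral_comp_coordVec (hb : L.carrier = Submodule.span ℤ (Set.range b))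
    (F : EuclideanSpace ℝ (Fin n) → ℂ) :
    ∫ v, F (coordVec b v) = (L.covol⁻¹ : ℝ) • ∫ x, F x := by
  classical
  let b₀ := (EuclideanSpace.basisFun (Fin n) ℝ).toBasis
  let A : (Fin n → ℝ) →ₗ[ℝ] (Fin n → ℝ) :=
    (b.equivFun.symm.trans b₀.equivFun).toLinearMap
  have hdet : LinearMap.det A = b₀.det b := by
    rw [← LinearMap.det_toMatrix', Module.Basis.det_apply]
    congr 1
    ext i j
    simp [A, Module.Basis.toMatrix_apply, LinearMap.toMatrix'_apply]
  have hne : LinearMap.det A ≠ 0 := (LinearEquiv.isUnit_det' _).ne_zero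
  have hA (v) : A v = (coordVec b v).ofLp := by
    funext i
    simp [A, b₀, coordVec_eq]
  have hmap := Real.map_linearMap_volume_pi_eq_smul_volume_pi hne
  have hAe : MeasurableEmbedding A :=
    (b.equivFun.symm.trans b₀.equivFun).toContinuousLinearEquiv.toHomeomorph.measurableEmbedding
  have h1 : ∫ v, F (coordVec b v) = ∫ v, F (WithLp.toLp 2 v) ∂(Measure.map A volume) := by
    rw [hAe.integral_map]
    simp_rw [hA]
  rw [h1, hmap, integral_smul_measure, ← (PiLp.volume_preserving_toLp (Fin n)).integral_comp
    (MeasurableEquiv.toLp 2 (Fin n → ℝ)).measurableEmbedding, covol_eq_det b hb, hdet]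
  congr 1
  rw [ENNReal.toReal_ofReal (abs_nonneg _), abs_inv]

end Coordinates

/-! ### Sums over lattices -/

theorem hasSum_carrier_iff {L : EuclideanLattice n} {𝕜 : Type*} [AddCommGroup 𝕜]
    [TopologicalSpace 𝕜] [IsTopologicalAddGroup 𝕜] {f : EuclideanSpace ℝ (Fin n) → 𝕜} {S : 𝕜} :
    HasSum (fun x : L.carrier => f x) (f 0 + S) ↔ HasSum (fun x : L.Nz => f x) S := by
  let e : L.Nz ≃ {x : L.carrier // x ∉ ({0} : Finset L.carrier)} :=
    { toFun := fun x => ⟨⟨x.1, x.2.1⟩, fun h =>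
        x.2.2 (congrArg Subtype.val (Finset.mem_singleton.1 h))⟩
      invFun := fun x => ⟨x.1.1, x.1.2, fun h =>
        x.2 (Finset.mem_singleton.2 (Subtype.ext h))⟩
      left_inv := fun _ => rfl
      right_inv := fun _ => rfl }
  have := Finset.hasSum_compl_iff ({0} : Finset L.carrier) (f := fun x : L.carrier => f x) (a := S)
  rw [Finset.sum_singleton] at this
  rw [add_comm, show f 0 = f ((0 : L.carrier) : EuclideanSpace ℝ (Fin n)) from rfl, ← this,
    ← e.hasSum_iff]
  rfl

theorem hasSum_coord_iff {L : EuclideanLattice n}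
    {b : Module.Basis (Fin n) ℝ (EuclideanSpace ℝ (Fin n))}
    (hb : L.carrier = Submodule.span ℤ (Set.range b)) {f : EuclideanSpace ℝ (Fin n) → ℝ} {S : ℝ} :
    HasSum (fun m : Fin n → ℤ => f (coordVec b (toReal m))) (f 0 + S) ↔
      HasSum (fun x : L.Nz => f x) S := by
  rw [← hasSum_carrier_iff, ← (latticeEquiv hb).hasSum_iff]
  rfl

theorem hasSum_dualCoord_iff {L : EuclideanLattice n}
    {b : Module.Basis (Fin n) ℝ (EuclideanSpace ℝ (Fin n))}
    (hb : L.carrier = Submodule.span ℤ (Set.range b)) {f : EuclideanSpace ℝ (Fin n) → ℝ} {S : ℝ} :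
    HasSum (fun k : Fin n → ℤ => f (dualVec b (toReal k))) (f 0 + S) ↔
      HasSum (fun y : L.dual.Nz => f y) S := by
  rw [← hasSum_carrier_iff, ← (dualEquiv hb).hasSum_iff]
  rfl

theorem exp_neg_le_rpow {N c r : ℝ} (hN : 0 < N) (hc : 0 < c) (hr : 0 < r) :
    Real.exp (-c * r) ≤ (N / c) ^ N * r ^ (-N) := by
  have h1 : c * r / N ≤ Real.exp (c * r / N) := by linarith [Real.add_one_le_exp (c * r / N)]
  have h2 : (c * r / N) ^ N ≤ Real.exp (c * r) := by
    calc (c * r / N) ^ N ≤ Real.exp (c * r / N) ^ N :=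
          Real.rpow_le_rpow (by positivity) h1 hN.le
      _ = Real.exp (c * r) := by rw [← Real.exp_mul, div_mul_cancel₀ _ hN.ne']
  rw [neg_mul, Real.exp_neg, Real.rpow_neg hr.le]
  have h3 : (c * r / N) ^ N = ((N / c) ^ N)⁻¹ * r ^ N := by
    rw [← Real.inv_rpow (by positivity), ← Real.mul_rpow (by positivity) hr.le]
    congr 1
    field_simp
  rw [h3] at h2
  have h4 : 0 < (N / c) ^ N := by positivity
  have h5 : 0 < r ^ N := by positivity
  rw [← inv_inv ((N / c) ^ N), ← mul_inv]
  exact inv_anti₀ (by positivity) h2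

theorem summable_normSq_rpow (L : EuclideanLattice n) {N : ℝ} (hN : (n : ℝ) / 2 < N) :
    Summable fun x : L.Nz => (‖x.1‖ ^ 2) ^ (-N) := by
  refine (L.summable_epsteinZeta hN).congr fun x => ?_
  rw [← Real.rpow_natCast, ← Real.rpow_mul (norm_nonneg _)]
  congr 1
  push_cast
  ring

theorem summable_exp (L : EuclideanLattice n) {c : ℝ} (hc : 0 < c) :
    Summable fun x : L.Nz => Real.exp (-c * ‖x.1‖ ^ 2) := by
  have hN : (n : ℝ) / 2 < n / 2 + 1 := by linarith
  refine Summable.of_nonneg_of_le (fun _ => (Real.exp_pos _).le)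
    (fun x => exp_neg_le_rpow (N := n / 2 + 1) (by positivity) hc x.normSq_pos)
    ((L.summable_normSq_rpow hN).mul_left _)

/-! ### The theta function and its functional equation -/

/-- The theta function of `L` without its constant term: the sum of `exp (-π t ‖x‖²)` over the
nonzero vectors `x` of `L`. -/
noncomputable def theta₀ (L : EuclideanLattice n) (t : ℝ) : ℝ :=
  ∑' x : L.Nz, Real.exp (-Real.pi * ‖x.1‖ ^ 2 * t)

theorem hasSum_theta₀ (L : EuclideanLattice n) {t : ℝ} (ht : 0 < t) :
    HasSum (fun x : L.Nz => Real.exp (-Real.pi * ‖x.1‖ ^ 2 * t)) (L.theta₀ t) := by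
  refine Summable.hasSum ((L.summable_exp (mul_pos Real.pi_pos ht)).congr fun x => ?_)
  ring_nf

theorem integral_gaussian_coord {L : EuclideanLattice n}
    {b : Module.Basis (Fin n) ℝ (EuclideanSpace ℝ (Fin n))}
    (hb : L.carrier = Submodule.span ℤ (Set.range b)) {t : ℝ} (ht : 0 < t) (k : Fin n → ℤ) :
    ∫ v, char (-(toReal k ⬝ᵥ v)) * ((Real.exp (-Real.pi * ‖coordVec b v‖ ^ 2 * t) : ℝ) : ℂ) =
      ((L.covol⁻¹ * t ^ (-(n : ℝ) / 2) *
        Real.exp (-Real.pi * ‖dualVec b (toReal k)‖ ^ 2 * t⁻¹) : ℝ) : ℂ) := by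
  have h1 := integral_comp_coordVec hb (fun x => char (-(inner ℝ (dualVec b (toReal k)) x)) *
    ((Real.exp (-Real.pi * ‖x‖ ^ 2 * t) : ℝ) : ℂ))
  simp_rw [inner_dualVec_coordVec] at h1
  rw [h1]
  have h2 := fourier_gaussian_innerProductSpace (V := EuclideanSpace ℝ (Fin n))
    (b := ((Real.pi * t : ℝ) : ℂ)) (by simpa using mul_pos Real.pi_pos ht) (dualVec b (toReal k))
  rw [Real.fourier_eq'] at h2
  have h3 : ∫ x, char (-(inner ℝ (dualVec b (toReal k)) x)) *
      ((Real.exp (-Real.pi * ‖x‖ ^ 2 * t) : ℝ) : ℂ) =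
      ∫ v : EuclideanSpace ℝ (Fin n),
        Complex.exp (((-2 * Real.pi * inner ℝ v (dualVec b (toReal k)) : ℝ) : ℂ) * Complex.I) •
        Complex.exp (-((Real.pi * t : ℝ) : ℂ) * (‖v‖ : ℂ) ^ 2) := by
    congr 1
    funext x
    rw [smul_eq_mul, char, real_inner_comm, Complex.ofReal_exp]
    congr 2
    · push_cast; ring
    · push_cast; ring
  rw [h3, h2, finrank_euclideanSpace_fin]
  have h4 : ((Real.pi : ℂ) / ((Real.pi * t : ℝ) : ℂ)) ^ ((n : ℂ) / 2) =
      ((t ^ (-(n : ℝ) / 2) : ℝ) : ℂ) := by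
    rw [show ((Real.pi : ℂ) / ((Real.pi * t : ℝ) : ℂ)) = ((t⁻¹ : ℝ) : ℂ) by
      rw [← Complex.ofReal_div]
      congr 1
      field_simp]
    rw [show ((n : ℂ) / 2) = (((n : ℝ) / 2 : ℝ) : ℂ) by push_cast; ring,
      ← Complex.ofReal_cpow (by positivity), Real.inv_rpow ht.le, neg_div, Real.rpow_neg ht.le]
  rw [h4, Complex.real_smul]
  push_cast
  rw [mul_assoc]
  congr 3
  have : (Real.pi : ℂ) ≠ 0 := by exact_mod_cast Real.pi_ne_zero
  have : (t : ℂ) ≠ 0 := by exact_mod_cast ht.ne'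
  field_simp

theorem hasSum_coord_theta {L : EuclideanLattice n}
    {b : Module.Basis (Fin n) ℝ (EuclideanSpace ℝ (Fin n))}
    (hb : L.carrier = Submodule.span ℤ (Set.range b)) {t : ℝ} (ht : 0 < t) :
    HasSum (fun m : Fin n → ℤ => Real.exp (-Real.pi * ‖coordVec b (toReal m)‖ ^ 2 * t))
      (1 + L.theta₀ t) := by
  have h := (hasSum_coord_iff hb (f := fun x => Real.exp (-Real.pi * ‖x‖ ^ 2 * t))).2
    (L.hasSum_theta₀ ht)
  simpa using h

/-- On bounded sets, the translates of a Gaussian by the vectors of `L` are uniformly summable. -/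
theorem exists_gaussian_bound {L : EuclideanLattice n}
    {b : Module.Basis (Fin n) ℝ (EuclideanSpace ℝ (Fin n))}
    (hb : L.carrier = Submodule.span ℤ (Set.range b)) {t : ℝ} (ht : 0 < t) (R : ℝ) :
    ∃ u : (Fin n → ℤ) → ℝ, Summable u ∧ ∀ m x, ‖x‖ ≤ R →
      Real.exp (-Real.pi * ‖coordVec b (x + toReal m)‖ ^ 2 * t) ≤ u m := by
  obtain ⟨C, hC⟩ := (isCompact_closedBall (0 : Fin n → ℝ) R).exists_bound_of_continuousOn
    (f := coordVec b) (by fun_prop)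
  have hs := (hasSum_coord_theta hb (half_pos ht)).summable
  refine ⟨fun m => Real.exp (Real.pi * C ^ 2 * t) *
    Real.exp (-Real.pi * ‖coordVec b (toReal m)‖ ^ 2 * (t / 2)), hs.mul_left _, fun m x hx => ?_⟩
  have hxC := hC x (by simpa using hx)
  beta_reduce
  rw [← Real.exp_add, Real.exp_le_exp, coordVec_add]
  have h1 : ‖coordVec b (toReal m)‖ ≤ ‖coordVec b x + coordVec b (toReal m)‖ + C := by
    calc _ = ‖(coordVec b x + coordVec b (toReal m)) - coordVec b x‖ := by rw [add_sub_cancel_left]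
      _ ≤ _ := (norm_sub_le _ _).trans (by linarith)
  have h2 : ‖coordVec b (toReal m)‖ ^ 2 ≤
      2 * ‖coordVec b x + coordVec b (toReal m)‖ ^ 2 + 2 * C ^ 2 := by
    refine (pow_le_pow_left₀ (norm_nonneg _) h1 2).trans ?_
    nlinarith [sq_nonneg (‖coordVec b x + coordVec b (toReal m)‖ - C)]
  have h3 : 0 < Real.pi * t := mul_pos Real.pi_pos ht
  nlinarith

/-- The functional equation of the theta function: Poisson summation for a Gaussian. -/
theorem theta_functional_equation (L : EuclideanLattice n) {t : ℝ} (ht : 0 < t) :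
    1 + L.theta₀ t = L.covol⁻¹ * t ^ (-(n : ℝ) / 2) * (1 + L.dual.theta₀ t⁻¹) := by
  obtain ⟨b, hb⟩ := L.exists_basis
  let g : (Fin n → ℝ) → ℂ := fun v => ((Real.exp (-Real.pi * ‖coordVec b v‖ ^ 2 * t) : ℝ) : ℂ)
  have hgc : Continuous g := by
    refine Complex.continuous_ofReal.comp (Real.continuous_exp.comp ?_)
    fun_prop
  have hL := hasSum_coord_theta hb ht
  have hD : HasSum (fun k : Fin n → ℤ =>
      Real.exp (-Real.pi * ‖dualVec b (toReal k)‖ ^ 2 * t⁻¹)) (1 + L.dual.theta₀ t⁻¹) := by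
    have h := (hasSum_dualCoord_iff hb (f := fun x => Real.exp (-Real.pi * ‖x‖ ^ 2 * t⁻¹))).2
      (L.dual.hasSum_theta₀ (inv_pos.2 ht))
    simpa using h
  have hcoef : HasSum (fun k : Fin n → ℤ => ∫ v, char (-(toReal k ⬝ᵥ v)) * g v)
      ((L.covol⁻¹ * t ^ (-(n : ℝ) / 2) * (1 + L.dual.theta₀ t⁻¹) : ℝ) : ℂ) := by
    simp only [g, integral_gaussian_coord hb ht]
    exact Complex.hasSum_ofReal.2 (hD.mul_left _)
  -- otherwise the integral that defines the Fourier coefficient at `0` would be zero by convention,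
  -- whereas its value is positive
  have hgi : Integrable g := by
    by_contra hni
    have h0 := integral_gaussian_coord hb ht 0
    have : ∫ v, char (-(toReal (0 : Fin n → ℤ) ⬝ᵥ v)) *
        ((Real.exp (-Real.pi * ‖coordVec b v‖ ^ 2 * t) : ℝ) : ℂ) = 0 := by
      rw [← integral_undef hni]
      congr 1
      funext v
      have hz : toReal (0 : Fin n → ℤ) ⬝ᵥ v = 0 := by simp [toReal, dotProduct]
      rw [hz, neg_zero, char_zero, one_mul]
    rw [this] at h0
    have hpos : 0 < L.covol⁻¹ * t ^ (-(n : ℝ) / 2) *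
        Real.exp (-Real.pi * ‖dualVec b (toReal 0)‖ ^ 2 * t⁻¹) := by
      have := L.covol_pos
      positivity
    exact hpos.ne' (by exact_mod_cast h0.symm)
  have hbound : ∀ R : ℝ, ∃ u : (Fin n → ℤ) → ℝ, Summable u ∧
      ∀ m x, ‖x‖ ≤ R → ‖g (x + toReal m)‖ ≤ u m := by
    intro R
    obtain ⟨u, hu, hub⟩ := exists_gaussian_bound hb ht R
    refine ⟨u, hu, fun m x hx => ?_⟩
    rw [Complex.norm_real, Real.norm_of_nonneg (Real.exp_pos _).le]
    exact hub m x hx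
  have hP := hasSum_poisson hgc hgi hbound hcoef.summable
  have hsum : ∑' m : Fin n → ℤ, g (toReal m) = ((1 + L.theta₀ t : ℝ) : ℂ) :=
    (Complex.hasSum_ofReal.2 hL).tsum_eq
  rw [hsum] at hP
  exact_mod_cast hP.unique hcoef

/-- The functional equation, solved for the theta function of the dual lattice. -/
theorem theta_dual (L : EuclideanLattice n) {t : ℝ} (ht : 0 < t) :
    1 + L.dual.theta₀ t⁻¹ = L.covol * t ^ ((n : ℝ) / 2) * (1 + L.theta₀ t) := by
  rw [L.theta_functional_equation ht, neg_div, Real.rpow_neg ht.le]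
  have := L.covol_pos
  field_simp

end EuclideanLattice

namespace EuclideanLattice

open PeriodicFourier

variable {n : ℕ}

/-! ### The spectrum of a flat torus -/

/-- The character `x ↦ exp (2 π i ⟨y, x⟩)` of `ℝⁿ`. -/
noncomputable def planeWave (y x : EuclideanSpace ℝ (Fin n)) : ℂ := char (inner ℝ y x)

theorem laplacian_eq_sum_fderiv {f : EuclideanSpace ℝ (Fin n) → ℂ} (hf : ContDiff ℝ 2 f)
    (x : EuclideanSpace ℝ (Fin n)) :
    (Laplacian.laplacian f : EuclideanSpace ℝ (Fin n) → ℂ) x =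
      ∑ i, fderiv ℝ (fun z => fderiv ℝ f z (EuclideanSpace.basisFun (Fin n) ℝ i)) x
        (EuclideanSpace.basisFun (Fin n) ℝ i) := by
  rw [InnerProductSpace.laplacian_eq_iteratedFDeriv_orthonormalBasis f
    (EuclideanSpace.basisFun (Fin n) ℝ)]
  refine Finset.sum_congr rfl fun i _ => ?_
  rw [iteratedFDeriv_two_apply]
  have hd : DifferentiableAt ℝ (fderiv ℝ f) x :=
    (hf.fderiv_right (m := 1) (by norm_num)).differentiable (by norm_num) x
  rw [fderiv_clm_apply hd (differentiableAt_const _)]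
  simp

theorem hasFDerivAt_planeWave (y x : EuclideanSpace ℝ (Fin n)) :
    HasFDerivAt (planeWave y)
      ((2 * Real.pi * Complex.I * planeWave y x) •
        (Complex.ofRealCLM.comp (innerSL ℝ y))) x := by
  have h1 : HasFDerivAt (fun x => ((inner ℝ y x : ℝ) : ℂ)) (Complex.ofRealCLM.comp (innerSL ℝ y)) x :=
    (Complex.ofRealCLM.comp (innerSL ℝ y)).hasFDerivAt
  have h2 := (h1.const_mul (2 * Real.pi * Complex.I)).cexp
  refine h2.congr_fderiv ?_
  rw [smul_smul, mul_comm]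
  rfl

theorem contDiff_planeWave (y : EuclideanSpace ℝ (Fin n)) : ContDiff ℝ ∞ (planeWave y) := by
  unfold planeWave char
  refine ContDiff.cexp (contDiff_const.mul ?_)
  exact (Complex.ofRealCLM.comp (innerSL ℝ y)).contDiff

theorem fderiv_planeWave_apply (y x v : EuclideanSpace ℝ (Fin n)) :
    fderiv ℝ (planeWave y) x v =
      2 * Real.pi * Complex.I * (inner ℝ y v : ℝ) * planeWave y x := by
  rw [(hasFDerivAt_planeWave y x).fderiv]
  simp only [smul_apply, ContinuousLinearMap.comp_apply, smul_eq_mul,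
    Complex.ofRealCLM_apply, innerSL_apply_apply]
  ring

/-- The sum of the squares of the factors `2 π i ⟨y, eᵢ⟩` by which the partial derivatives act on a
plane wave. -/
theorem sum_sq_inner_basisFun (y : EuclideanSpace ℝ (Fin n)) :
    ∑ i, (2 * Real.pi * Complex.I * (inner ℝ y (EuclideanSpace.basisFun (Fin n) ℝ i) : ℝ)) ^ 2 =
      -((4 * Real.pi ^ 2 * ‖y‖ ^ 2 : ℝ) : ℂ) := by
  have h := (EuclideanSpace.basisFun (Fin n) ℝ).sum_sq_norm_inner_left y
  simp only [Real.norm_eq_abs, sq_abs] at h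
  simp_rw [mul_pow, Complex.I_sq]
  rw [← Finset.mul_sum, ← h]
  push_cast
  ring

theorem planeWave_mem_torusEigenspace {L : EuclideanLattice n} {y : EuclideanSpace ℝ (Fin n)}
    (hy : y ∈ L.dual.carrier) : planeWave y ∈ L.torusEigenspace (4 * Real.pi ^ 2 * ‖y‖ ^ 2) := by
  refine ⟨contDiff_planeWave y, fun x l hl => ?_, fun x => ?_⟩
  · obtain ⟨k, hk⟩ := mem_dual.1 hy l hl
    rw [planeWave, inner_add_right, ← hk, char_add, char_int, mul_one, planeWave]
  · rw [laplacian_eq_sum_fderiv ((contDiff_planeWave y).of_le two_le_infty)]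
    have (i : Fin n) : fderiv ℝ (fun z => fderiv ℝ (planeWave y) z
        (EuclideanSpace.basisFun (Fin n) ℝ i)) x (EuclideanSpace.basisFun (Fin n) ℝ i) =
        (2 * Real.pi * Complex.I * (inner ℝ y (EuclideanSpace.basisFun (Fin n) ℝ i) : ℝ)) ^ 2 *
          planeWave y x := by
      simp_rw [fderiv_planeWave_apply]
      rw [fderiv_const_mul (hasFDerivAt_planeWave y x).differentiableAt]
      simp only [smul_apply, fderiv_planeWave_apply, smul_eq_mul]
      ring
    simp_rw [this]
    rw [← Finset.sum_mul, sum_sq_inner_basisFun, neg_mul, neg_neg]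

section Coefficients

variable {L : EuclideanLattice n} {b : Module.Basis (Fin n) ℝ (EuclideanSpace ℝ (Fin n))}

theorem isPeriodic_comp_coordVec (hb : L.carrier = Submodule.span ℤ (Set.range b))
    {f : EuclideanSpace ℝ (Fin n) → ℂ}
    (hf : ∀ x, ∀ l ∈ L.carrier, f (x + l) = f x) : IsPeriodic (f ∘ coordVec b) := by
  intro x m
  simp only [Function.comp_apply, coordVec_add]
  exact hf _ _ ((mem_carrier_iff hb).2 ⟨m, rfl⟩)

theorem fderiv_periodic {f : EuclideanSpace ℝ (Fin n) → ℂ}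
    (hf : ∀ x, ∀ l ∈ L.carrier, f (x + l) = f x) (v x l : EuclideanSpace ℝ (Fin n))
    (hl : l ∈ L.carrier) : fderiv ℝ f (x + l) v = fderiv ℝ f x v := by
  have : (fun z => f (z + l)) = f := funext fun z => hf z l hl
  rw [← fderiv_comp_add_right, this]

theorem coeff_fderiv (hb : L.carrier = Submodule.span ℤ (Set.range b))
    {f : EuclideanSpace ℝ (Fin n) → ℂ} (hc : ContDiff ℝ 1 f)
    (hf : ∀ x, ∀ l ∈ L.carrier, f (x + l) = f x) (w : EuclideanSpace ℝ (Fin n))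
    (k : Fin n → ℤ) :
    coeff ((fun x => fderiv ℝ f x w) ∘ coordVec b) k =
      2 * Real.pi * Complex.I * (inner ℝ (dualVec b (toReal k)) w : ℝ) *
        coeff (f ∘ coordVec b) k := by
  obtain ⟨v, rfl⟩ := coordVec_surjective b w
  rw [inner_dualVec_coordVec]
  have hcf : Continuous fun x => fderiv ℝ f x (coordVec b v) :=
    (hc.continuous_fderiv (by norm_num)).clm_apply continuous_const
  refine coeff_deriv (hc.continuous.comp (continuous_coordVec b)) (isPeriodic_comp_coordVec hb hf)
    (hcf.comp (continuous_coordVec b))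
    (isPeriodic_comp_coordVec hb fun x l hl => fderiv_periodic hf _ x l hl) v (fun x => ?_) k
  have h1 : HasFDerivAt f (fderiv ℝ f (coordVec b x)) (coordVec b x + (0 : ℝ) • coordVec b v) := by
    simpa using (hc.differentiable (by norm_num) (coordVec b x)).hasFDerivAt
  have h2 : HasDerivAt (fun t : ℝ => coordVec b x + t • coordVec b v) (coordVec b v) 0 := by
    simpa using ((hasDerivAt_id (0 : ℝ)).smul_const (coordVec b v)).const_add (coordVec b x)
  have h3 := h1.comp_hasDerivAt (0 : ℝ) h2
  refine h3.congr_of_eventuallyEq (Eventually.of_forall fun t => ?_)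
  simp [coordVec_add, coordVec_smul]

/-- An eigenfunction has Fourier coefficients only at the vectors of `L*` whose plane waves have the
same eigenvalue: compare the coefficients of `-Δ f` and of `μ f`. -/
theorem coeff_eq_zero_of_eigen (hb : L.carrier = Submodule.span ℤ (Set.range b))
    {f : EuclideanSpace ℝ (Fin n) → ℂ} {μ : ℝ}
    (hf : f ∈ L.torusEigenspace μ) {k : Fin n → ℤ}
    (hk : 4 * Real.pi ^ 2 * ‖dualVec b (toReal k)‖ ^ 2 ≠ μ) : coeff (f ∘ coordVec b) k = 0 := by
  obtain ⟨hs, hp, hl⟩ := hf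
  let e := EuclideanSpace.basisFun (Fin n) ℝ
  have hs1 : ContDiff ℝ 1 f := hs.of_le (by exact_mod_cast le_top)
  have hs1' (i : Fin n) : ContDiff ℝ 1 fun z => fderiv ℝ f z (e i) :=
    ((hs.fderiv_right (m := 1) two_le_infty).clm_apply contDiff_const)
  have hcont (i : Fin n) : Continuous fun x => fderiv ℝ (fun z => fderiv ℝ f z (e i)) x (e i) :=
    ((hs1' i).continuous_fderiv (by norm_num)).clm_apply continuous_const
  have h2 (i : Fin n) := (coeff_fderiv hb (hs1' i) (fun x l hl => fderiv_periodic hp _ x l hl)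
    (e i) k).trans (congrArg _ (coeff_fderiv hb hs1 hp (e i) k))
  have hchar : Continuous fun x : Fin n → ℝ => char (-(toReal k ⬝ᵥ x)) :=
    continuous_char.comp (by unfold dotProduct; fun_prop)
  have hfin : IsFiniteMeasure (volume.restrict (box (0 : Fin n → ℝ))) :=
    ⟨by simpa using volume_box_lt_top 0⟩
  have hsum : ∑ i, coeff ((fun x => fderiv ℝ (fun z => fderiv ℝ f z (e i)) x (e i)) ∘ coordVec b) k =
      -(μ : ℂ) * coeff (f ∘ coordVec b) k := by
    simp only [coeff]
    rw [← integral_finsetSum, ← integral_const_mul]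
    · refine integral_congr_ae (Eventually.of_forall fun x => ?_)
      simp only [Function.comp_apply]
      rw [← Finset.mul_sum, ← laplacian_eq_sum_fderiv (hs.of_le two_le_infty)]
      have := hl (coordVec b x)
      rw [neg_eq_iff_eq_neg.1 this]
      ring
    · intro i _
      obtain ⟨C, hC⟩ := exists_bound ((hcont i).comp (continuous_coordVec b))
        (isPeriodic_comp_coordVec hb fun x l hl => fderiv_periodic
          (fun x l hl => fderiv_periodic hp _ x l hl) _ x l hl)
      refine Integrable.of_bound
        (hchar.mul ((hcont i).comp (continuous_coordVec b))).aestronglyMeasurable C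
        (Eventually.of_forall fun x => ?_)
      rw [norm_mul, norm_char, one_mul]
      exact hC x
  have h3 : -((4 * Real.pi ^ 2 * ‖dualVec b (toReal k)‖ ^ 2 : ℝ) : ℂ) *
      coeff (f ∘ coordVec b) k = -(μ : ℂ) * coeff (f ∘ coordVec b) k := by
    rw [← hsum, ← sum_sq_inner_basisFun, Finset.sum_mul]
    refine Finset.sum_congr rfl fun i _ => ?_
    rw [h2 i]
    ring
  by_contra hne
  have := mul_right_cancel₀ hne h3
  rw [neg_inj] at this
  exact hk (by exact_mod_cast this)

end Coefficients

theorem finite_dual_sphere (L : EuclideanLattice n) (μ : ℝ) :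
    Finite {y : L.dual.carrier // 4 * Real.pi ^ 2 * ‖y.1‖ ^ 2 = μ} := by
  have hcl : IsClosed (L.dual.carrier : Set (EuclideanSpace ℝ (Fin n))) := by
    have : DiscreteTopology L.dual.carrier.toAddSubgroup := L.dual.discrete
    exact AddSubgroup.isClosed_of_discrete (H := L.dual.carrier.toAddSubgroup)
  have hfin := Metric.finite_isBounded_inter_isClosed
    ⟨L.dual.discrete⟩
    (Metric.isBounded_closedBall (x := (0 : EuclideanSpace ℝ (Fin n))) (r := √(μ / (4 * Real.pi ^ 2))))
    hcl
  have := hfin.to_subtype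
  refine Finite.of_injective (β := ↥(Metric.closedBall (0 : EuclideanSpace ℝ (Fin n))
    (√(μ / (4 * Real.pi ^ 2))) ∩ (L.dual.carrier : Set (EuclideanSpace ℝ (Fin n)))))
    (fun y => ⟨y.1.1, ?_, y.1.2⟩) ?_
  · rw [mem_closedBall_zero_iff]
    apply Real.le_sqrt_of_sq_le
    rw [le_div_iff₀' (by positivity)]
    exact y.2.le
  · intro y z h
    exact Subtype.ext (Subtype.ext (congrArg (fun u => u.1) h))

/-- The plane waves are linearly independent, since they are distinct characters. -/
theorem linearIndependent_planeWave :
    LinearIndependent ℂ (planeWave (n := n)) := by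
  let φ : EuclideanSpace ℝ (Fin n) → (Multiplicative (EuclideanSpace ℝ (Fin n)) →* ℂ) := fun y =>
    { toFun := fun x => planeWave y x.toAdd
      map_one' := by simp [planeWave, char_zero]
      map_mul' := fun x z => by simp [planeWave, inner_add_right, char_add] }
  have hφ : Function.Injective φ := by
    intro y z h
    by_contra hne
    have hsub : y - z ≠ 0 := sub_ne_zero.2 hne
    -- the characters of `y` and `z` differ by the factor `-1` at this point
    let x : EuclideanSpace ℝ (Fin n) := (1 / (2 * ‖y - z‖ ^ 2)) • (y - z)
    have h1 : planeWave y x = planeWave z x := DFunLike.congr_fun h (Multiplicative.ofAdd x)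
    have h2 : inner ℝ y x = 1 / 2 + inner ℝ z x := by
      rw [← sub_eq_iff_eq_add, ← inner_sub_left, inner_smul_right, real_inner_self_eq_norm_sq]
      have := norm_ne_zero_iff.2 hsub
      field_simp
    rw [planeWave, planeWave, h2, char_add] at h1
    have h3 : char (1 / 2) = -1 := by
      rw [char, show (2 * Real.pi * Complex.I * ((1 / 2 : ℝ) : ℂ)) = Real.pi * Complex.I by
        push_cast; ring, Complex.exp_pi_mul_I]
    have h4 : char (inner ℝ z x) ≠ 0 := Complex.exp_ne_zero _
    rw [h3] at h1
    exact h4 (by linear_combination (-1 / 2 : ℂ) * h1)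
  exact (linearIndependent_monoidHom (Multiplicative (EuclideanSpace ℝ (Fin n))) ℂ).comp φ hφ

/-- The multiplicity of the eigenvalue `μ` of the flat torus `ℝⁿ / L` is the number of vectors `y`
of `L*` with `4 π² ‖y‖² = μ`: the corresponding plane waves are a basis of the eigenspace. -/
theorem finrank_torusEigenspace (L : EuclideanLattice n) (μ : ℝ) :
    Module.finrank ℂ (L.torusEigenspace μ) =
      Nat.card {y : L.dual.carrier // 4 * Real.pi ^ 2 * ‖y.1‖ ^ 2 = μ} := by
  classical
  obtain ⟨b, hb⟩ := L.exists_basis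
  have hfin := L.finite_dual_sphere μ
  have := Fintype.ofFinite {y : L.dual.carrier // 4 * Real.pi ^ 2 * ‖y.1‖ ^ 2 = μ}
  let w : {y : L.dual.carrier // 4 * Real.pi ^ 2 * ‖y.1‖ ^ 2 = μ} → L.torusEigenspace μ :=
    fun y => ⟨planeWave y.1.1, by
      have := planeWave_mem_torusEigenspace y.1.2
      rwa [y.2] at this⟩
  have hinj : Function.Injective
      fun y : {y : L.dual.carrier // 4 * Real.pi ^ 2 * ‖y.1‖ ^ 2 = μ} => y.1.1 :=
    fun y z h => Subtype.ext (Subtype.ext h)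
  have hcomp := (linearIndependent_planeWave (n := n)).comp _ hinj
  have hli : LinearIndependent ℂ w := LinearIndependent.of_comp (L.torusEigenspace μ).subtype hcomp
  have hspan : ⊤ ≤ Submodule.span ℂ (Set.range w) := by
    rintro ⟨f, hf⟩ -
    let S : Set (Fin n → ℤ) := {k | 4 * Real.pi ^ 2 * ‖dualVec b (toReal k)‖ ^ 2 = μ}
    have hmem (k : Fin n → ℤ) : dualVec b (toReal k) ∈ L.dual.carrier := (dualEquiv hb k).2
    have hSfin : S.Finite := by
      have hfinS : Finite S := Finite.of_injective
        (fun k : S => (⟨dualEquiv hb k.1, k.2⟩ :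
          {y : L.dual.carrier // 4 * Real.pi ^ 2 * ‖y.1‖ ^ 2 = μ}))
        fun k k' h => Subtype.ext ((dualEquiv hb).injective (congrArg Subtype.val h))
      exact S.toFinite
    have hzero : ∀ k ∉ hSfin.toFinset, coeff (f ∘ coordVec b) k = 0 := by
      intro k hk
      rw [Set.Finite.mem_toFinset] at hk
      exact coeff_eq_zero_of_eigen hb hf hk
    have hsum : f = ∑ k ∈ hSfin.toFinset,
        coeff (f ∘ coordVec b) k • planeWave (dualVec b (toReal k)) := by
      funext x
      obtain ⟨v, rfl⟩ := coordVec_surjective b x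
      have h := hasSum_of_summable_coeff (hf.1.continuous.comp (continuous_coordVec b))
        (isPeriodic_comp_coordVec hb hf.2.1) (summable_of_ne_finset_zero hzero) v
      have h' := h.unique (hasSum_sum_of_ne_finset_zero (s := hSfin.toFinset) fun k hk => by
        rw [hzero k hk, zero_mul])
      simp only [Function.comp_apply] at h'
      rw [h', Finset.sum_apply]
      refine Finset.sum_congr rfl fun k _ => ?_
      rw [Pi.smul_apply, planeWave, inner_dualVec_coordVec, smul_eq_mul]
    have hf' : f ∈ (Submodule.span ℂ (Set.range w)).map (L.torusEigenspace μ).subtype := by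
      rw [hsum]
      refine Submodule.sum_mem _ fun k hk => Submodule.smul_mem _ _ ?_
      exact ⟨w ⟨⟨_, hmem k⟩, hSfin.mem_toFinset.1 hk⟩, Submodule.subset_span ⟨_, rfl⟩, rfl⟩
    obtain ⟨g, hg, hgf⟩ := hf'
    have : (⟨f, hf⟩ : L.torusEigenspace μ) = g := Subtype.ext hgf.symm
    rw [this]
    exact hg
  rw [Module.finrank_eq_card_basis (Module.Basis.mk hli hspan), Nat.card_eq_fintype_card]

/-! ### Incomplete gamma integrals -/

/-- The incomplete gamma integral `∫ t ^ (a - 1) exp (-π r t) dt` over `t > 1`. -/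
noncomputable def incGamma (a r : ℝ) : ℝ :=
  ∫ t in Set.Ioi (1 : ℝ), t ^ (a - 1) * Real.exp (-Real.pi * r * t)

theorem rpow_mul_exp_le {a N r t : ℝ} (hN : 0 < N) (hr : 0 < r) (ht : 0 < t) :
    t ^ (a - 1) * Real.exp (-Real.pi * r * t) ≤
      (N / Real.pi) ^ N * r ^ (-N) * t ^ (a - 1 - N) := by
  have h := exp_neg_le_rpow hN Real.pi_pos (mul_pos hr ht)
  rw [Real.mul_rpow hr.le ht.le, ← mul_assoc (-Real.pi)] at h
  calc t ^ (a - 1) * Real.exp (-Real.pi * r * t)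
      ≤ t ^ (a - 1) * ((N / Real.pi) ^ N * (r ^ (-N) * t ^ (-N))) := by gcongr
    _ = (N / Real.pi) ^ N * r ^ (-N) * (t ^ (a - 1) * t ^ (-N)) := by ring
    _ = _ := by rw [← Real.rpow_add ht, ← sub_eq_add_neg]

theorem integrableOn_incGamma (a : ℝ) {r : ℝ} (hr : 0 < r) :
    IntegrableOn (fun t : ℝ => t ^ (a - 1) * Real.exp (-Real.pi * r * t)) (Set.Ioi 1) := by
  have hN : 0 < |a| + 1 := by positivity
  have hlt : a - 1 - (|a| + 1) < -1 := by linarith [le_abs_self a]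
  refine Integrable.mono' (((integrableOn_Ioi_rpow_of_lt hlt one_pos).const_mul
    (((|a| + 1) / Real.pi) ^ (|a| + 1) * r ^ (-(|a| + 1))))) ?_ ?_
  · refine ContinuousOn.aestronglyMeasurable (fun t ht => ContinuousAt.continuousWithinAt ?_)
      measurableSet_Ioi
    have ht0 : t ≠ 0 := (zero_lt_one.trans ht).ne'
    exact (Real.continuousAt_rpow_const _ _ (Or.inl ht0)).mul (by fun_prop)
  · refine (ae_restrict_iff' measurableSet_Ioi).2 (Eventually.of_forall fun t ht => ?_)
    have ht0 : 0 < t := zero_lt_one.trans ht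
    rw [Real.norm_of_nonneg (by positivity)]
    exact rpow_mul_exp_le hN hr ht0

theorem incGamma_nonneg (a r : ℝ) : 0 ≤ incGamma a r :=
  setIntegral_nonneg measurableSet_Ioi fun t ht => by
    have ht0 : 0 < t := zero_lt_one.trans ht
    positivity

theorem exists_incGamma_le {a N : ℝ} (hN : 0 < N) (ha : a < N) :
    ∃ C, 0 ≤ C ∧ ∀ r, 0 < r → incGamma a r ≤ C * r ^ (-N) := by
  have hlt : a - 1 - N < -1 := by linarith
  refine ⟨(N / Real.pi) ^ N * ∫ t in Set.Ioi (1 : ℝ), t ^ (a - 1 - N),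
    mul_nonneg (by positivity) (setIntegral_nonneg measurableSet_Ioi fun t ht => ?_),
    fun r hr => ?_⟩
  · have ht0 : 0 < t := zero_lt_one.trans ht
    positivity
  · calc incGamma a r
        ≤ ∫ t in Set.Ioi (1 : ℝ), (N / Real.pi) ^ N * r ^ (-N) * t ^ (a - 1 - N) :=
          setIntegral_mono_on (integrableOn_incGamma a hr)
            ((integrableOn_Ioi_rpow_of_lt hlt one_pos).const_mul _) measurableSet_Ioi
            fun t ht => rpow_mul_exp_le hN hr (zero_lt_one.trans ht)
      _ = _ := by rw [integral_const_mul]; ring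

theorem hasDerivAt_incGamma (a : ℝ) {r : ℝ} (hr : 0 < r) :
    HasDerivAt (incGamma a) (-Real.pi * incGamma (a + 1) r) r := by
  have hr2 : 0 < r / 2 := by positivity
  have hmeas (s : ℝ) (c : ℝ) : AEStronglyMeasurable
      (fun t : ℝ => t ^ c * Real.exp (-Real.pi * s * t)) (volume.restrict (Set.Ioi 1)) := by
    refine ContinuousOn.aestronglyMeasurable (fun t ht => ContinuousAt.continuousWithinAt ?_)
      measurableSet_Ioi
    have ht0 : t ≠ 0 := (zero_lt_one.trans ht).ne'
    exact (Real.continuousAt_rpow_const _ _ (Or.inl ht0)).mul (by fun_prop)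
  have key := (hasDerivAt_integral_of_dominated_loc_of_deriv_le
    (μ := volume.restrict (Set.Ioi (1 : ℝ))) (x₀ := r) (s := Set.Ioi (r / 2))
    (F := fun s t => t ^ (a - 1) * Real.exp (-Real.pi * s * t))
    (F' := fun s t => -Real.pi * (t ^ (a + 1 - 1) * Real.exp (-Real.pi * s * t)))
    (bound := fun t => Real.pi * (t ^ (a + 1 - 1) * Real.exp (-Real.pi * (r / 2) * t)))
    (Ioi_mem_nhds (by linarith)) (Eventually.of_forall fun s => hmeas s _)
    (integrableOn_incGamma a hr) ((hmeas r _).const_mul _) ?_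
    ((integrableOn_incGamma (a + 1) hr2).const_mul _) ?_).2
  · rwa [integral_const_mul] at key
  · refine (ae_restrict_iff' measurableSet_Ioi).2 (Eventually.of_forall fun t ht s hs => ?_)
    have ht0 : 0 < t := zero_lt_one.trans ht
    have hs' : r / 2 < s := hs
    rw [norm_mul, norm_neg, Real.norm_of_nonneg Real.pi_pos.le, Real.norm_of_nonneg (by positivity)]
    have : Real.exp (-Real.pi * s * t) ≤ Real.exp (-Real.pi * (r / 2) * t) := by
      rw [Real.exp_le_exp]
      have := mul_le_mul_of_nonneg_right hs'.le (mul_pos Real.pi_pos ht0).le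
      nlinarith
    gcongr
  · refine (ae_restrict_iff' measurableSet_Ioi).2 (Eventually.of_forall fun t ht s _ => ?_)
    have ht0 : 0 < t := zero_lt_one.trans ht
    have h1 : HasDerivAt (fun s : ℝ => -Real.pi * s * t) (-Real.pi * t) s := by
      simpa using ((hasDerivAt_id s).const_mul (-Real.pi)).mul_const t
    refine (h1.exp.const_mul (t ^ (a - 1))).congr_deriv ?_
    rw [show a + 1 - 1 = (a - 1) + 1 by ring, Real.rpow_add_one ht0.ne']
    ring

/-- Integration by parts. -/
theorem pi_mul_incGamma_add_one (a : ℝ) {r : ℝ} (hr : 0 < r) :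
    Real.pi * r * incGamma (a + 1) r = Real.exp (-Real.pi * r) + a * incGamma a r := by
  have h1 : ∀ t ∈ Set.Ioi (1 : ℝ), HasDerivAt (fun t : ℝ => t ^ a * Real.exp (-Real.pi * r * t))
      (a * (t ^ (a - 1) * Real.exp (-Real.pi * r * t)) -
        Real.pi * r * (t ^ (a + 1 - 1) * Real.exp (-Real.pi * r * t))) t := by
    intro t ht
    have ht0 : 0 < t := zero_lt_one.trans ht
    have h2 : HasDerivAt (fun t : ℝ => -Real.pi * r * t) (-Real.pi * r) t := by
      simpa using (hasDerivAt_id t).const_mul (-Real.pi * r)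
    refine ((Real.hasDerivAt_rpow_const (Or.inl ht0.ne')).mul h2.exp).congr_deriv ?_
    rw [show a + 1 - 1 = a by ring]
    ring
  have hint := ((integrableOn_incGamma a hr).const_mul a).sub
    ((integrableOn_incGamma (a + 1) hr).const_mul (Real.pi * r))
  have hlim : Tendsto (fun t : ℝ => t ^ a * Real.exp (-Real.pi * r * t)) atTop (𝓝 0) := by
    have := tendsto_rpow_mul_exp_neg_mul_atTop_nhds_zero a (Real.pi * r) (mul_pos Real.pi_pos hr)
    simpa only [neg_mul] using this
  have hcont : ContinuousWithinAt (fun t : ℝ => t ^ a * Real.exp (-Real.pi * r * t))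
      (Set.Ici 1) 1 := by
    refine ContinuousAt.continuousWithinAt ?_
    exact (Real.continuousAt_rpow_const _ _ (Or.inl one_ne_zero)).mul (by fun_prop)
  have := integral_Ioi_of_hasDerivAt_of_tendsto hcont h1 hint hlim
  rw [integral_sub ((integrableOn_incGamma a hr).const_mul a)
    ((integrableOn_incGamma (a + 1) hr).const_mul (Real.pi * r)), integral_const_mul,
    integral_const_mul] at this
  simp only [Real.one_rpow, mul_one, one_mul, zero_sub] at this
  change a * incGamma a r - Real.pi * r * incGamma (a + 1) r = _ at this
  linarith

/-! ### Analytic properties of the theta function -/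

instance (L : EuclideanLattice n) : Countable L.Nz := by
  obtain ⟨b, hb⟩ := L.exists_basis
  have : Countable L.carrier := (latticeEquiv hb).countable_iff.1 inferInstance
  refine Function.Injective.countable (β := L.carrier) (f := fun x => ⟨x.1, x.2.1⟩) ?_
  intro x y h
  exact Subtype.ext (congrArg (fun u : L.carrier => u.1) h)

theorem theta₀_nonneg (L : EuclideanLattice n) (t : ℝ) : 0 ≤ L.theta₀ t :=
  tsum_nonneg fun _ => (Real.exp_pos _).le

theorem summable_normSq_mul_exp (L : EuclideanLattice n) {c : ℝ} (hc : 0 < c) :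
    Summable fun x : L.Nz => ‖x.1‖ ^ 2 * Real.exp (-c * ‖x.1‖ ^ 2) := by
  have hN : (n : ℝ) / 2 < n / 2 + 1 := by linarith
  have hN1 : 0 < (n : ℝ) / 2 + 1 + 1 := by positivity
  refine Summable.of_nonneg_of_le (fun _ => by positivity) (fun x => ?_)
    ((L.summable_normSq_rpow hN).mul_left (((n / 2 + 1 + 1) / c) ^ ((n : ℝ) / 2 + 1 + 1)))
  have hx := x.normSq_pos
  refine (mul_le_mul_of_nonneg_left (exp_neg_le_rpow hN1 hc hx) hx.le).trans_eq ?_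
  have hx0 := norm_ne_zero_iff.2 x.2.2
  rw [neg_add (_ + _), Real.rpow_add hx, Real.rpow_neg_one]
  field_simp

theorem hasDerivAt_theta₀ (L : EuclideanLattice n) {t : ℝ} (ht : 0 < t) :
    HasDerivAt L.theta₀
      (∑' x : L.Nz, -Real.pi * ‖x.1‖ ^ 2 * Real.exp (-Real.pi * ‖x.1‖ ^ 2 * t)) t := by
  have ht2 : 0 < Real.pi * (t / 2) := by positivity
  refine hasDerivAt_tsum_of_isPreconnected
    (g := fun (x : L.Nz) (s : ℝ) => Real.exp (-Real.pi * ‖x.1‖ ^ 2 * s))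
    (g' := fun (x : L.Nz) (s : ℝ) => -Real.pi * ‖x.1‖ ^ 2 * Real.exp (-Real.pi * ‖x.1‖ ^ 2 * s))
    (u := fun x : L.Nz => Real.pi * (‖x.1‖ ^ 2 * Real.exp (-(Real.pi * (t / 2)) * ‖x.1‖ ^ 2)))
    (t := Set.Ioi (t / 2)) (y₀ := t) ((L.summable_normSq_mul_exp ht2).mul_left _)
    isOpen_Ioi isPreconnected_Ioi (fun x s _ => ?_) (fun x s hs => ?_) (by simpa using ht)
    (L.hasSum_theta₀ ht).summable (by simpa using ht)
  · have h1 : HasDerivAt (fun s : ℝ => -Real.pi * ‖x.1‖ ^ 2 * s) (-Real.pi * ‖x.1‖ ^ 2) s :=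
      ((hasDerivAt_id s).const_mul (-Real.pi * ‖x.1‖ ^ 2)).congr_deriv (mul_one _)
    exact h1.exp.congr_deriv (mul_comm _ _)
  · have hs' : t / 2 < s := hs
    rw [norm_mul, norm_mul, norm_neg, Real.norm_of_nonneg Real.pi_pos.le,
      Real.norm_of_nonneg (by positivity), Real.norm_of_nonneg (Real.exp_pos _).le, mul_assoc]
    have : Real.exp (-Real.pi * ‖x.1‖ ^ 2 * s) ≤
        Real.exp (-(Real.pi * (t / 2)) * ‖x.1‖ ^ 2) := by
      rw [Real.exp_le_exp]
      have := mul_le_mul_of_nonneg_right hs'.le (mul_pos Real.pi_pos x.normSq_pos).le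
      nlinarith
    gcongr

theorem continuousOn_theta₀ (L : EuclideanLattice n) : ContinuousOn L.theta₀ (Set.Ioi 0) :=
  fun _ ht => (L.hasDerivAt_theta₀ ht).continuousAt.continuousWithinAt

theorem theta₀_isBigO (L : EuclideanLattice n) (r : ℝ) :
    (fun t => (L.theta₀ t : ℂ)) =O[atTop] (fun t : ℝ => t ^ r) := by
  let N : ℝ := n / 2 + 1 + |r|
  have hN : 0 < N := by positivity
  have hN' : (n : ℝ) / 2 < N := by
    have := abs_nonneg r
    simp only [N]; linarith
  have hs := L.summable_normSq_rpow hN'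
  refine Asymptotics.IsBigO.of_bound
    ((N / Real.pi) ^ N * ∑' x : L.Nz, (‖x.1‖ ^ 2) ^ (-N)) ?_
  filter_upwards [eventually_ge_atTop 1] with t ht
  have ht0 : 0 < t := by linarith
  rw [Complex.norm_real, Real.norm_of_nonneg (L.theta₀_nonneg t),
    Real.norm_of_nonneg (by positivity)]
  have h1 : L.theta₀ t ≤ ∑' x : L.Nz, (N / Real.pi) ^ N * (‖x.1‖ ^ 2) ^ (-N) * t ^ (-N) := by
    refine (L.hasSum_theta₀ ht0).summable.tsum_le_tsum (fun x => ?_) ((hs.mul_left _).mul_right _)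
    have := exp_neg_le_rpow hN Real.pi_pos (mul_pos x.normSq_pos ht0)
    rw [Real.mul_rpow x.normSq_pos.le ht0.le] at this
    rw [mul_assoc, mul_assoc]
    exact this
  rw [tsum_mul_right, tsum_mul_left] at h1
  refine h1.trans (mul_le_mul_of_nonneg_left (Real.rpow_le_rpow_of_exponent_le ht ?_) ?_)
  · have := neg_abs_le r
    have : (0 : ℝ) ≤ n := Nat.cast_nonneg n
    simp only [N]; linarith
  · exact mul_nonneg (by positivity) (tsum_nonneg fun x => by positivity)

theorem integral_theta₀ (L : EuclideanLattice n) {a : ℝ} (ha : a ≤ n / 2) :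
    HasSum (fun x : L.Nz => incGamma a (‖x.1‖ ^ 2))
      (∫ t in Set.Ioi (1 : ℝ), t ^ (a - 1) * L.theta₀ t) := by
  have hN : (n : ℝ) / 2 < n / 2 + 1 := by linarith
  obtain ⟨C, _, hC⟩ := exists_incGamma_le (a := a) (N := n / 2 + 1) (by positivity) (by linarith)
  have h := hasSum_integral_of_summable_integral_norm (μ := volume.restrict (Set.Ioi (1 : ℝ)))
    (F := fun (x : L.Nz) (t : ℝ) => t ^ (a - 1) * Real.exp (-Real.pi * ‖x.1‖ ^ 2 * t))
    (fun x => integrableOn_incGamma a x.normSq_pos) (by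
      refine Summable.of_nonneg_of_le (fun x => integral_nonneg fun _ => norm_nonneg _)
        (fun x => ?_) ((L.summable_normSq_rpow hN).mul_left C)
      refine le_trans (le_of_eq ?_) (hC _ x.normSq_pos)
      refine setIntegral_congr_fun measurableSet_Ioi fun t ht => ?_
      have ht0 : 0 < t := zero_lt_one.trans ht
      exact Real.norm_of_nonneg (by positivity))
  have h2 : ∫ t in Set.Ioi (1 : ℝ), t ^ (a - 1) * L.theta₀ t =
      ∫ t in Set.Ioi (1 : ℝ), ∑' x : L.Nz, t ^ (a - 1) * Real.exp (-Real.pi * ‖x.1‖ ^ 2 * t) := by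
    refine setIntegral_congr_fun measurableSet_Ioi fun t _ => ?_
    exact tsum_mul_left.symm
  rw [h2]
  exact h

/-! ### The zeta function and the height of a flat torus -/

/-- The theta functions of `L*` and `L`, related by the functional equation, as a pair of functions
to which the Mellin transform can be applied. -/
noncomputable def thetaPair (hn : 1 ≤ n) (L : EuclideanLattice n) : WeakFEPair ℂ where
  f t := 1 + L.dual.theta₀ t
  g t := 1 + L.theta₀ t
  k := n / 2
  ε := L.covol
  f₀ := 1
  g₀ := 1
  hf_int := (continuousOn_const.add (Complex.continuous_ofReal.comp_continuousOn
    L.dual.continuousOn_theta₀)).locallyIntegrableOn measurableSet_Ioi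
  hg_int := (continuousOn_const.add (Complex.continuous_ofReal.comp_continuousOn
    L.continuousOn_theta₀)).locallyIntegrableOn measurableSet_Ioi
  hk := by positivity
  hε := by exact_mod_cast L.covol_pos.ne'
  h_feq x hx := by
    rw [one_div, smul_eq_mul]
    exact_mod_cast L.theta_dual hx
  hf_top r := by simpa using L.dual.theta₀_isBigO r
  hg_top r := by simpa using L.theta₀_isBigO r

/-- The explicit form of the zeta function of `ℝⁿ / L`, obtained from the Mellin transform of the
theta function of `L*`. It uses `1 / (s Γ(s)) = 1 / Γ(s + 1)`, so as to be holomorphic at `0`. -/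
noncomputable def zetaContinuation (hn : 1 ≤ n) (L : EuclideanLattice n) (s : ℂ) : ℂ :=
  (4 * Real.pi : ℂ) ^ (-s) *
    (((L.thetaPair hn).Λ₀ s - L.covol / (n / 2 - s)) * (Complex.Gamma s)⁻¹ -
      (Complex.Gamma (s + 1))⁻¹)

theorem hasSum_zetaContinuation (hn : 1 ≤ n) (L : EuclideanLattice n) {s : ℂ}
    (hs : (n : ℝ) / 2 < s.re) :
    HasSum (fun y : L.dual.Nz => ((4 * Real.pi ^ 2 * ‖y.1‖ ^ 2 : ℝ) : ℂ) ^ (-s))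
      (L.zetaContinuation hn s) := by
  have hn0 : (0 : ℝ) ≤ n := Nat.cast_nonneg n
  have hs0 : 0 < s.re := by linarith
  have hsne : s ≠ 0 := fun h => by simp [h] at hs0
  have hΓ : Complex.Gamma s ≠ 0 := Complex.Gamma_ne_zero_of_re_pos hs0
  have h1 := hasSum_mellin_pi_mul (ι := L.dual.Nz) (a := fun _ => 1) (q := fun y => ‖y.1‖ ^ 2)
    (F := fun t => (L.dual.theta₀ t : ℂ)) (s := s) (fun y => Or.inr y.normSq_pos) hs0
    (fun t ht => by
      simp only [one_mul]
      exact Complex.hasSum_ofReal.2 (L.dual.hasSum_theta₀ ht))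
    ((L.dual.summable_normSq_rpow hs).congr fun y => by
      rw [norm_one, Real.rpow_neg y.normSq_pos.le, one_div])
  have h2 := ((L.thetaPair hn).hasMellin (s := s) hs).2
  have h3 : (fun t => (L.thetaPair hn).f t - (L.thetaPair hn).f₀) =
      fun t => (L.dual.theta₀ t : ℂ) := by
    funext t
    simp [thetaPair]
  rw [h3] at h2
  rw [h2] at h1
  have h4 : L.zetaContinuation hn s =
      (4 * Real.pi : ℂ) ^ (-s) * (Complex.Gamma s)⁻¹ * (L.thetaPair hn).Λ s := by
    rw [zetaContinuation, WeakFEPair.Λ, Complex.Gamma_add_one s hsne]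
    simp only [thetaPair, smul_eq_mul, mul_one]
    push_cast
    field_simp
    ring
  rw [h4]
  have hterm (y : L.dual.Nz) : ((4 * Real.pi ^ 2 * ‖y.1‖ ^ 2 : ℝ) : ℂ) ^ (-s) =
      (4 * Real.pi : ℂ) ^ (-s) * (Complex.Gamma s)⁻¹ *
        (Real.pi ^ (-s) * Complex.Gamma s * 1 / ((‖y.1‖ ^ 2 : ℝ) : ℂ) ^ s) := by
    have hy := y.normSq_pos
    have hsplit : ((4 * Real.pi ^ 2 * ‖y.1‖ ^ 2 : ℝ) : ℂ) =
        ((4 * Real.pi : ℝ) : ℂ) * (((Real.pi : ℝ) : ℂ) * ((‖y.1‖ ^ 2 : ℝ) : ℂ)) := by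
      push_cast; ring
    rw [hsplit, ← Complex.ofReal_mul Real.pi, Complex.mul_cpow_ofReal_nonneg (by positivity)
      (by positivity), Complex.ofReal_mul Real.pi,
      Complex.mul_cpow_ofReal_nonneg Real.pi_pos.le hy.le,
      Complex.cpow_neg ((‖y.1‖ ^ 2 : ℝ) : ℂ), Complex.ofReal_mul 4, Complex.ofReal_ofNat]
    field_simp
  rw [funext hterm]
  exact h1.mul_left _

/-- Counting the nonzero vectors of `L*` by their eigenvalues. -/
theorem hasSum_torusEigenspace (L : EuclideanLattice n) {s S : ℂ}
    (h : HasSum (fun y : L.dual.Nz => ((4 * Real.pi ^ 2 * ‖y.1‖ ^ 2 : ℝ) : ℂ) ^ (-s)) S) :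
    HasSum (fun μ : {μ : ℝ // μ ≠ 0} =>
      (Module.finrank ℂ (L.torusEigenspace μ.1) : ℂ) * ((μ.1 : ℂ) ^ (-s))) S := by
  let φ : L.dual.Nz → {μ : ℝ // μ ≠ 0} := fun y =>
    ⟨4 * Real.pi ^ 2 * ‖y.1‖ ^ 2, by have := y.normSq_pos; positivity⟩
  rw [← (Equiv.sigmaFiberEquiv φ).hasSum_iff] at h
  refine h.sigma fun μ => ?_
  have e : {y : L.dual.Nz // φ y = μ} ≃
      {y : L.dual.carrier // 4 * Real.pi ^ 2 * ‖y.1‖ ^ 2 = μ.1} :=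
    { toFun := fun y => ⟨⟨y.1.1, y.1.2.1⟩, congrArg Subtype.val y.2⟩
      invFun := fun y => ⟨⟨y.1.1, y.1.2, fun h0 => μ.2 (by rw [← y.2, h0]; simp)⟩,
        Subtype.ext y.2⟩
      left_inv := fun _ => rfl
      right_inv := fun _ => rfl }
  have hfin := L.finite_dual_sphere μ.1
  have := Fintype.ofFinite {y : L.dual.carrier // 4 * Real.pi ^ 2 * ‖y.1‖ ^ 2 = μ.1}
  have := Fintype.ofEquiv _ e.symm
  rw [finrank_torusEigenspace, ← Nat.card_congr e, Nat.card_eq_fintype_card]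
  have hconst (y : {y : L.dual.Nz // φ y = μ}) :
      ((fun y : L.dual.Nz => ((4 * Real.pi ^ 2 * ‖y.1‖ ^ 2 : ℝ) : ℂ) ^ (-s)) ∘
        Equiv.sigmaFiberEquiv φ) ⟨μ, y⟩ = ((μ.1 : ℂ) ^ (-s)) := by
    have : 4 * Real.pi ^ 2 * ‖y.1.1‖ ^ 2 = μ.1 := congrArg Subtype.val y.2
    change ((4 * Real.pi ^ 2 * ‖y.1.1‖ ^ 2 : ℝ) : ℂ) ^ (-s) = _
    rw [this]
  simp_rw [hconst]
  have := hasSum_fintype fun _ : {y : L.dual.Nz // φ y = μ} => ((μ.1 : ℂ) ^ (-s))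
  simpa using this

theorem isTorusZeta_zetaContinuation (hn : 1 ≤ n) (L : EuclideanLattice n) :
    L.IsTorusZeta (L.zetaContinuation hn) := by
  have h4π : (4 * Real.pi : ℂ) ≠ 0 := by exact_mod_cast (by positivity : (4 * Real.pi : ℝ) ≠ 0)
  have hpow : Differentiable ℂ fun s : ℂ => (4 * Real.pi : ℂ) ^ (-s) :=
    fun s => (differentiableAt_id.neg).const_cpow (Or.inl h4π)
  have hΓ := Complex.differentiable_one_div_Gamma
  have hΓ1 : Differentiable ℂ fun s : ℂ => (Complex.Gamma (s + 1))⁻¹ :=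
    hΓ.comp (differentiable_id.add_const 1)
  have hΛ := (L.thetaPair hn).differentiable_Λ₀
  refine ⟨fun s hs => L.hasSum_torusEigenspace (L.hasSum_zetaContinuation hn hs), ?_, ?_⟩
  · intro s hs
    have hs' : (n / 2 - s : ℂ) ≠ 0 := sub_ne_zero.2 (Ne.symm hs)
    refine DifferentiableAt.differentiableWithinAt ?_
    exact (hpow s).mul ((((hΛ s).sub ((differentiableAt_const _).div
      ((differentiableAt_const _).sub differentiableAt_id) hs')).mul (hΓ s)).sub (hΓ1 s))
  · have hm {f : ℂ → ℂ} (hf : Differentiable ℂ f) : MeromorphicAt f (n / 2) :=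
      (hf.analyticAt _).meromorphicAt
    exact (hm hpow).mul ((((hm hΛ).sub ((MeromorphicAt.const _ _).div
      (hm (differentiable_id.const_sub _)))).mul (hm hΓ)).sub (hm hΓ1))

/-- The zeta function of a flat torus is unique, by the identity theorem. -/
theorem IsTorusZeta.eqOn {L : EuclideanLattice n} {F G : ℂ → ℂ} (hF : L.IsTorusZeta F)
    (hG : L.IsTorusZeta G) : Set.EqOn F G {(n : ℂ) / 2}ᶜ := by
  have hopen : IsOpen ({(n : ℂ) / 2}ᶜ : Set ℂ) := isOpen_compl_singleton
  have hconn : IsPreconnected ({(n : ℂ) / 2}ᶜ : Set ℂ) :=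
    (isConnected_compl_singleton_of_one_lt_rank (by
      rw [Complex.rank_real_complex]; norm_num) _).isPreconnected
  have hre : (n : ℝ) / 2 < ((n : ℂ) / 2 + 1).re := by simp
  refine (hF.2.1.analyticOnNhd hopen).eqOn_of_preconnected_of_eventuallyEq
    (hG.2.1.analyticOnNhd hopen) hconn (z₀ := (n : ℂ) / 2 + 1) (by simp) ?_
  filter_upwards [(isOpen_lt continuous_const Complex.continuous_re).mem_nhds hre] with s hs
  exact (hF.1 s hs).unique (hG.1 s hs)

theorem torusHeight_eq_deriv (hn : 1 ≤ n) (L : EuclideanLattice n) :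
    L.torusHeight = (deriv (L.zetaContinuation hn) 0).re := by
  have hex : ∃ F, L.IsTorusZeta F := ⟨_, L.isTorusZeta_zetaContinuation hn⟩
  have hspec : L.IsTorusZeta L.torusZeta := by
    rw [torusZeta, dif_pos hex]
    exact hex.choose_spec
  have h0 : (0 : ℂ) ∈ ({(n : ℂ) / 2}ᶜ : Set ℂ) := by
    have : (n : ℂ) ≠ 0 := by exact_mod_cast (by omega : n ≠ 0)
    exact fun h => div_ne_zero this two_ne_zero (Eq.symm h)
  rw [torusHeight, Filter.EventuallyEq.deriv_eq ((hspec.eqOn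
    (L.isTorusZeta_zetaContinuation hn)).eventuallyEq_of_mem (isOpen_compl_singleton.mem_nhds h0))]

/-- Up to a constant that depends only on `n`, the height is the value at `0` of the regularized
Mellin transform, minus `2 covol(L) / n`. -/
theorem exists_torusHeight_eq (hn : 1 ≤ n) : ∃ c : ℝ, ∀ L : EuclideanLattice n,
    L.torusHeight = ((L.thetaPair hn).Λ₀ 0).re - L.covol / (n / 2) + c := by
  have h4π : (4 * Real.pi : ℂ) ≠ 0 := by exact_mod_cast (by positivity : (4 * Real.pi : ℝ) ≠ 0)
  have hpow : Differentiable ℂ fun s : ℂ => (4 * Real.pi : ℂ) ^ (-s) :=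
    fun s => (differentiableAt_id.neg).const_cpow (Or.inl h4π)
  have hΓ1 : Differentiable ℂ fun s : ℂ => (Complex.Gamma (s + 1))⁻¹ :=
    Complex.differentiable_one_div_Gamma.comp (differentiable_id.add_const 1)
  refine ⟨-(deriv (fun s : ℂ => (4 * Real.pi : ℂ) ^ (-s) * (Complex.Gamma (s + 1))⁻¹) 0).re,
    fun L => ?_⟩
  have hn0 : (n / 2 - 0 : ℂ) ≠ 0 := by
    have : (n : ℂ) ≠ 0 := by exact_mod_cast (by omega : n ≠ 0)
    simpa using this
  let A : ℂ → ℂ := fun s => (4 * Real.pi : ℂ) ^ (-s) *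
    ((L.thetaPair hn).Λ₀ s - L.covol / (n / 2 - s)) * (Complex.Gamma (s + 1))⁻¹
  have hA : DifferentiableAt ℂ A 0 :=
    ((hpow 0).mul (((L.thetaPair hn).differentiable_Λ₀ 0).sub ((differentiableAt_const _).div
      ((differentiableAt_const _).sub differentiableAt_id) hn0))).mul (hΓ1 0)
  have hfun : L.zetaContinuation hn = fun s => s * A s -
      (4 * Real.pi : ℂ) ^ (-s) * (Complex.Gamma (s + 1))⁻¹ := by
    funext s
    rw [zetaContinuation, Complex.one_div_Gamma_eq_self_mul_one_div_Gamma_add_one]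
    simp only [A]
    ring
  have hd := ((hasDerivAt_id (0 : ℂ)).mul hA.hasDerivAt).sub
    ((hpow 0).mul (hΓ1 0)).hasDerivAt
  have hd' := hd.congr_of_eventuallyEq (f₁ := L.zetaContinuation hn)
    (Eventually.of_forall fun s => by rw [hfun]; rfl)
  rw [torusHeight_eq_deriv hn, hd'.deriv]
  have hA0 : A 0 = ((L.thetaPair hn).Λ₀ 0) - ((L.covol / (n / 2) : ℝ) : ℂ) := by
    simp [A]
  simp only [id, one_mul, zero_mul, add_zero, hA0, Complex.sub_re, Complex.ofReal_re]
  rfl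

/-- The regularized Mellin transform at `0`, as a sum over `L*` and `L`: the part of the integral
over `t < 1` is transported to `t > 1` by the functional equation. -/
theorem Λ₀_zero_eq (hn : 1 ≤ n) (L : EuclideanLattice n) :
    (L.thetaPair hn).Λ₀ 0 = ((∑' x : L.dual.Nz, incGamma 0 (‖x.1‖ ^ 2) +
      L.covol * ∑' y : L.Nz, incGamma (n / 2) (‖y.1‖ ^ 2) : ℝ) : ℂ) := by
  set P := L.thetaPair hn with hP
  have hconv : MellinConvergent P.f_modif 0 :=
    (P.isStrongFEPair_toStrongFEPair.hasMellin 0).1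
  have hval : P.Λ₀ 0 = ∫ t in Set.Ioi (0 : ℝ), (t : ℂ) ^ ((0 : ℂ) - 1) • P.f_modif t := rfl
  have hsplit : ∫ t in Set.Ioi (0 : ℝ), (t : ℂ) ^ ((0 : ℂ) - 1) • P.f_modif t =
      (∫ t in Set.Ioc (0 : ℝ) 1, (t : ℂ) ^ ((0 : ℂ) - 1) • P.f_modif t) +
      ∫ t in Set.Ioi (1 : ℝ), (t : ℂ) ^ ((0 : ℂ) - 1) • P.f_modif t := by
    rw [← setIntegral_union (s := Set.Ioc (0 : ℝ) 1) (t := Set.Ioi 1)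
      (Set.Ioc_disjoint_Ioi le_rfl) measurableSet_Ioi
      (IntegrableOn.mono_set hconv Set.Ioc_subset_Ioi_self)
      (IntegrableOn.mono_set hconv (Set.Ioi_subset_Ioi zero_le_one)),
      Set.Ioc_union_Ioi_eq_Ioi zero_le_one]
  have h1 : ∫ t in Set.Ioi (1 : ℝ), (t : ℂ) ^ ((0 : ℂ) - 1) • P.f_modif t =
      ((∑' x : L.dual.Nz, incGamma 0 (‖x.1‖ ^ 2) : ℝ) : ℂ) := by
    rw [(L.dual.integral_theta₀ (a := 0) (by positivity)).tsum_eq, ← integral_complex_ofReal]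
    refine setIntegral_congr_fun measurableSet_Ioi fun t ht => ?_
    have ht0 : 0 < t := zero_lt_one.trans ht
    have ht1 : ¬ t < 1 := not_lt.2 (le_of_lt ht)
    have hf : P.f_modif t = (L.dual.theta₀ t : ℂ) := by
      simp [WeakFEPair.f_modif, Set.mem_Ioi.1 ht, ht1, hP, thetaPair]
    simp only [hf, smul_eq_mul, Complex.ofReal_mul]
    rw [Complex.ofReal_cpow ht0.le]
    push_cast
    rfl
  have h2 : ∫ t in Set.Ioc (0 : ℝ) 1, (t : ℂ) ^ ((0 : ℂ) - 1) • P.f_modif t =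
      ((L.covol * ∑' y : L.Nz, incGamma (n / 2) (‖y.1‖ ^ 2) : ℝ) : ℂ) := by
    rw [(L.integral_theta₀ (a := n / 2) le_rfl).tsum_eq, Complex.ofReal_mul,
      ← integral_complex_ofReal, ← integral_const_mul]
    let q : ℝ → ℂ := (Set.Ioi (1 : ℝ)).indicator
      fun u => ((L.covol * u ^ ((n : ℝ) / 2) * L.theta₀ u : ℝ) : ℂ)
    have hq1 : mellin q 0 = ∫ a in Set.Ioi (1 : ℝ),
        (L.covol : ℂ) * ((a ^ ((n : ℝ) / 2 - 1) * L.theta₀ a : ℝ) : ℂ) := by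
      have e1 : mellin q 0 = ∫ a in Set.Ioi (0 : ℝ), (Set.Ioi (1 : ℝ)).indicator
          (fun u => (u : ℂ) ^ ((0 : ℂ) - 1) *
            ((L.covol * u ^ ((n : ℝ) / 2) * L.theta₀ u : ℝ) : ℂ)) a := by
        rw [mellin]
        congr 1
        funext u
        by_cases hu : u ∈ Set.Ioi (1 : ℝ) <;> simp [q, hu]
      rw [e1, setIntegral_indicator measurableSet_Ioi,
        Set.inter_eq_right.2 (Set.Ioi_subset_Ioi zero_le_one)]
      refine setIntegral_congr_fun measurableSet_Ioi fun u hu => ?_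
      have hu0 : 0 < u := zero_lt_one.trans hu
      rw [Real.rpow_sub_one hu0.ne', zero_sub, Complex.cpow_neg_one]
      push_cast
      field_simp
    rw [← hq1]
    have hq2 : mellin q 0 = mellin (fun t => q t⁻¹) 0 := by
      rw [mellin_comp_inv, neg_zero]
    rw [hq2, mellin, ← integral_indicator measurableSet_Ioc, ← integral_indicator measurableSet_Ioi]
    refine integral_congr_ae ?_
    filter_upwards [(measure_eq_zero_iff_ae_notMem (μ := volume)).1
      (measure_singleton (1 : ℝ))] with t ht
    have htne : t ≠ 1 := ht
    rcases le_or_gt t 0 with ht0 | ht0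
    · rw [Set.indicator_of_notMem (s := Set.Ioc (0 : ℝ) 1) (fun h => not_lt.2 ht0 h.1),
        Set.indicator_of_notMem (s := Set.Ioi (0 : ℝ)) (not_lt.2 ht0)]
    rw [Set.indicator_of_mem (s := Set.Ioi (0 : ℝ)) ht0]
    rcases lt_or_gt_of_ne htne with h | h
    · rw [Set.indicator_of_mem (s := Set.Ioc (0 : ℝ) 1) ⟨ht0, h.le⟩]
      have hmem : t⁻¹ ∈ Set.Ioi (1 : ℝ) := (one_lt_inv₀ ht0).2 h
      have hth := L.theta_dual (inv_pos.2 ht0)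
      rw [inv_inv] at hth
      have hpow : t ^ (-((n : ℝ) / 2)) = t⁻¹ ^ ((n : ℝ) / 2) := by
        rw [Real.inv_rpow ht0.le, Real.rpow_neg ht0.le]
      have hf : P.f_modif t = q t⁻¹ := by
        simp only [q, Set.indicator_of_mem hmem]
        simp only [WeakFEPair.f_modif, Pi.add_apply, Set.indicator_of_mem (s := Set.Ioo (0 : ℝ) 1)
          ⟨ht0, h⟩, Set.indicator_of_notMem (s := Set.Ioi (1 : ℝ)) (not_lt.2 h.le), zero_add, hP,
          thetaPair, smul_eq_mul, mul_one, hpow]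
        rw [← Complex.ofReal_one, ← Complex.ofReal_add, hth]
        push_cast
        ring
      rw [hf]
    · have hmem : t⁻¹ ∉ Set.Ioi (1 : ℝ) := not_lt.2 (inv_le_one_of_one_le₀ h.le)
      rw [Set.indicator_of_notMem (s := Set.Ioc (0 : ℝ) 1) (fun h' => not_lt.2 h'.2 h)]
      simp [q, Set.indicator_of_notMem hmem]
  rw [hval, hsplit, h1, h2, ← Complex.ofReal_add, add_comm]

/-- The height of `ℝⁿ / L` as a rapidly convergent sum over `L*` and `L`. -/
theorem exists_torusHeight_eq_tsum (hn : 1 ≤ n) : ∃ c : ℝ, ∀ L : EuclideanLattice n,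
    L.torusHeight = ∑' x : L.dual.Nz, incGamma 0 (‖x.1‖ ^ 2) +
      L.covol * ∑' y : L.Nz, incGamma (n / 2) (‖y.1‖ ^ 2) - L.covol / (n / 2) + c := by
  obtain ⟨c, hc⟩ := exists_torusHeight_eq hn
  refine ⟨c, fun L => ?_⟩
  rw [hc, Λ₀_zero_eq, Complex.ofReal_re]

/-! ### Weighted fourth moments of a lattice -/

/-- The weighted fourth moment of the nonzero vectors of `L` in the direction `y`. -/
noncomputable def fourthMoment (L : EuclideanLattice n) (w : ℝ → ℝ)
    (y : EuclideanSpace ℝ (Fin n)) : ℝ :=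
  ∑' x : L.Nz, w (‖x.1‖ ^ 2) * inner ℝ x.1 y ^ 4

theorem summable_weight_mul {L : EuclideanLattice n} {w : ℝ → ℝ}
    (hw : Summable fun x : L.Nz => w (‖x.1‖ ^ 2) * (‖x.1‖ ^ 2) ^ 2) {h : L.Nz → ℝ} {C : ℝ}
    (hh : ∀ x, |h x| ≤ C * (‖x.1‖ ^ 2) ^ 2) : Summable fun x : L.Nz => w (‖x.1‖ ^ 2) * h x := by
  refine Summable.of_norm_bounded (hw.norm.mul_left C) fun x => ?_
  rw [norm_mul, norm_mul, Real.norm_of_nonneg (by positivity : 0 ≤ (‖x.1‖ ^ 2) ^ 2)]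
  calc ‖w (‖x.1‖ ^ 2)‖ * ‖h x‖ ≤ ‖w (‖x.1‖ ^ 2)‖ * (C * (‖x.1‖ ^ 2) ^ 2) := by
        gcongr; exact hh x
    _ = _ := by ring

/-- The fourth moment, as a polynomial in the direction. -/
noncomputable def fourthMomentPoly (L : EuclideanLattice n) (w : ℝ → ℝ) :
    MvPolynomial (Fin n) ℝ :=
  ∑ I : Fin 4 → Fin n, MvPolynomial.C (∑' x : L.Nz, w (‖x.1‖ ^ 2) * ∏ t, x.1 (I t)) *
    ∏ t, MvPolynomial.X (I t)

theorem eval_fourthMomentPoly {L : EuclideanLattice n} {w : ℝ → ℝ}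
    (hw : Summable fun x : L.Nz => w (‖x.1‖ ^ 2) * (‖x.1‖ ^ 2) ^ 2)
    (y : EuclideanSpace ℝ (Fin n)) :
    MvPolynomial.eval y.ofLp (L.fourthMomentPoly w) = L.fourthMoment w y := by
  have hs (I : Fin 4 → Fin n) : Summable fun x : L.Nz => w (‖x.1‖ ^ 2) * ∏ t, x.1 (I t) := by
    refine summable_weight_mul hw (C := 1) fun x => ?_
    rw [Finset.abs_prod, one_mul, ← pow_mul]
    refine (Finset.prod_le_prod (fun t _ => abs_nonneg _)
      (fun t _ => PiLp.norm_apply_le x.1 (I t))).trans_eq ?_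
    simp
  have h1 (x : L.Nz) : w (‖x.1‖ ^ 2) * inner ℝ x.1 y ^ 4 =
      ∑ I : Fin 4 → Fin n, (w (‖x.1‖ ^ 2) * ∏ t, x.1 (I t)) * ∏ t, y (I t) := by
    have : inner ℝ x.1 y = ∑ i, x.1 i * y i := by
      rw [PiLp.inner_apply]
      exact Finset.sum_congr rfl fun i _ => by simp [mul_comm]
    rw [this, Fintype.sum_pow, Finset.mul_sum]
    refine Finset.sum_congr rfl fun I _ => ?_
    rw [Finset.prod_mul_distrib, mul_assoc]
  rw [fourthMoment, tsum_congr h1, Summable.tsum_finsetSum fun I _ => (hs I).mul_right _,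
    fourthMomentPoly, map_sum]
  refine Finset.sum_congr rfl fun I _ => ?_
  rw [tsum_mul_right]
  simp

theorem fourthMomentPoly_mem {L : EuclideanLattice n} {w : ℝ → ℝ}
    (hw : Summable fun x : L.Nz => w (‖x.1‖ ^ 2) * (‖x.1‖ ^ 2) ^ 2) :
    L.fourthMomentPoly w ∈ invariantForms L.aut 4 := by
  refine ⟨MvPolynomial.IsHomogeneous.sum _ _ _ fun I _ => ?_, fun g hg y => ?_⟩
  · have h := (MvPolynomial.isHomogeneous_C (Fin n)
      (∑' x : L.Nz, w (‖x.1‖ ^ 2) * ∏ t, x.1 (I t))).mul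
      (MvPolynomial.IsHomogeneous.prod Finset.univ (fun t : Fin 4 => MvPolynomial.X (R := ℝ) (I t))
        (fun _ => 1) fun t _ => MvPolynomial.isHomogeneous_X ℝ (I t))
    simpa using h
  · rw [eval_fourthMomentPoly hw, eval_fourthMomentPoly hw, fourthMoment, fourthMoment]
    let e : L.Nz ≃ L.Nz :=
      { toFun := fun x => ⟨g x.1, (hg _).2 x.2.1, by simpa using x.2.2⟩
        invFun := fun x => ⟨g.symm x.1, by rw [← hg]; simpa using x.2.1, by simpa using x.2.2⟩
        left_inv := fun x => by simp
        right_inv := fun x => by simp }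
    rw [← e.tsum_eq]
    refine tsum_congr fun x => ?_
    simp [e]

/-- If the invariants of degree `4` of `Aut(L)` are those of `O(n)`, then the fourth moments
depend only on the norm of the direction. -/
theorem fourthMoment_eq {L : EuclideanLattice n}
    (hL : invariantForms L.aut 4 ≤ invariantForms ⊤ 4) {w : ℝ → ℝ}
    (hw : Summable fun x : L.Nz => w (‖x.1‖ ^ 2) * (‖x.1‖ ^ 2) ^ 2)
    {y z : EuclideanSpace ℝ (Fin n)} (h : ‖y‖ = ‖z‖) :
    L.fourthMoment w y = L.fourthMoment w z := by
  rw [← eval_fourthMomentPoly hw, ← eval_fourthMomentPoly hw]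
  -- the reflection in the hyperplane orthogonal to `y - z` exchanges `y` and `z`
  have := (hL (fourthMomentPoly_mem hw)).2 ((ℝ ∙ (y - z))ᗮ.reflection) trivial y
  rw [← this, Submodule.reflection_sub h]

theorem fourthMoment_smul (L : EuclideanLattice n) (w : ℝ → ℝ) (c : ℝ)
    (y : EuclideanSpace ℝ (Fin n)) : L.fourthMoment w (c • y) = c ^ 4 * L.fourthMoment w y := by
  rw [fourthMoment, fourthMoment, ← tsum_mul_left]
  refine tsum_congr fun x => ?_
  rw [inner_smul_right]
  ring

theorem sum_sq_coord (b : OrthonormalBasis (Fin n) ℝ (EuclideanSpace ℝ (Fin n)))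
    (x : EuclideanSpace ℝ (Fin n)) : ∑ i, inner ℝ x (b i) ^ 2 = ‖x‖ ^ 2 := by
  have := b.sum_sq_norm_inner_left x
  simpa [Real.norm_eq_abs, sq_abs] using this

theorem sq_coord_le (b : OrthonormalBasis (Fin n) ℝ (EuclideanSpace ℝ (Fin n)))
    (x : EuclideanSpace ℝ (Fin n)) (i : Fin n) : inner ℝ x (b i) ^ 2 ≤ ‖x‖ ^ 2 := by
  rw [← sum_sq_coord b x]
  exact Finset.single_le_sum (f := fun i => inner ℝ x (b i) ^ 2) (fun _ _ => sq_nonneg _)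
    (Finset.mem_univ i)

/-- The mixed fourth moments, computed from `fourthMoment` at `bᵢ ± bⱼ`. -/
theorem exists_mixedMoment {L : EuclideanLattice n}
    (hL : invariantForms L.aut 4 ≤ invariantForms ⊤ 4) {w : ℝ → ℝ}
    (hw : Summable fun x : L.Nz => w (‖x.1‖ ^ 2) * (‖x.1‖ ^ 2) ^ 2)
    (b : OrthonormalBasis (Fin n) ℝ (EuclideanSpace ℝ (Fin n))) :
    ∃ c : ℝ, ∀ i j, HasSum (fun x : L.Nz => w (‖x.1‖ ^ 2) *
      (inner ℝ x.1 (b i) ^ 2 * inner ℝ x.1 (b j) ^ 2)) (c + if i = j then 2 * c else 0) := by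
  have hs (i j : Fin n) : Summable fun x : L.Nz => w (‖x.1‖ ^ 2) *
      (inner ℝ x.1 (b i) ^ 2 * inner ℝ x.1 (b j) ^ 2) := by
    refine summable_weight_mul hw (C := 1) fun x => ?_
    rw [abs_of_nonneg (by positivity), one_mul, sq (‖x.1‖ ^ 2)]
    exact mul_le_mul (sq_coord_le b _ _) (sq_coord_le b _ _) (sq_nonneg _) (by positivity)
  have hdiag (i : Fin n) : L.fourthMoment w (b i) = ∑' x : L.Nz, w (‖x.1‖ ^ 2) *
      (inner ℝ x.1 (b i) ^ 2 * inner ℝ x.1 (b i) ^ 2) := by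
    rw [fourthMoment]
    refine tsum_congr fun x => ?_
    ring
  rcases isEmpty_or_nonempty (Fin n) with hn | ⟨⟨i₀⟩⟩
  · exact ⟨0, fun i => hn.elim i⟩
  have hc (i : Fin n) : L.fourthMoment w (b i) = L.fourthMoment w (b i₀) :=
    fourthMoment_eq hL hw (by simp)
  refine ⟨L.fourthMoment w (b i₀) / 3, fun i j => ?_⟩
  rw [(hs i j).hasSum_iff]
  split_ifs with hij
  · subst hij
    rw [← hdiag, hc]
    ring
  · have hnorm (ε : ℝ) (hε : ε ^ 2 = 1) : ‖b i + ε • b j‖ = ‖√2 • b i‖ := by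
      have h0 : inner ℝ (b i) (b j) = 0 := b.orthonormal.2 hij
      have h1 : ‖b i + ε • b j‖ ^ 2 = 2 := by
        rw [norm_add_sq_real, inner_smul_right, h0, norm_smul, mul_pow, Real.norm_eq_abs, sq_abs, hε]
        simp
        norm_num
      rw [norm_smul, b.norm_eq_one, mul_one, Real.norm_of_nonneg (by positivity), ← h1,
        Real.sqrt_sq (norm_nonneg _)]
    have hval (ε : ℝ) (hε : ε ^ 2 = 1) :
        L.fourthMoment w (b i + ε • b j) = 4 * L.fourthMoment w (b i₀) := by
      rw [fourthMoment_eq hL hw (hnorm ε hε), fourthMoment_smul, hc,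
        show √2 ^ 4 = (√2 ^ 2) ^ 2 by ring, Real.sq_sqrt (by norm_num)]
      norm_num
    have hm (y : EuclideanSpace ℝ (Fin n)) :
        Summable fun x : L.Nz => w (‖x.1‖ ^ 2) * inner ℝ x.1 y ^ 4 := by
      refine summable_weight_mul hw (C := ‖y‖ ^ 4) fun x => ?_
      rw [abs_pow]
      calc |inner ℝ x.1 y| ^ 4 ≤ (‖x.1‖ * ‖y‖) ^ 4 := by
            gcongr; exact abs_real_inner_le_norm _ _
        _ = _ := by ring
    have h1 : L.fourthMoment w (b i + (1 : ℝ) • b j) + L.fourthMoment w (b i + (-1 : ℝ) • b j) =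
        2 * L.fourthMoment w (b i) + 12 * ∑' x : L.Nz, w (‖x.1‖ ^ 2) *
          (inner ℝ x.1 (b i) ^ 2 * inner ℝ x.1 (b j) ^ 2) + 2 * L.fourthMoment w (b j) := by
      simp only [fourthMoment]
      rw [← (hm _).tsum_add (hm _), ← tsum_mul_left, ← tsum_mul_left, ← tsum_mul_left,
        ← ((hm _).mul_left _).tsum_add ((hs i j).mul_left _),
        ← (((hm _).mul_left _).add ((hs i j).mul_left _)).tsum_add ((hm _).mul_left _)]
      refine tsum_congr fun x => ?_
      rw [inner_add_right, inner_add_right, inner_smul_right, inner_smul_right]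
      ring
    rw [hval 1 (by norm_num), hval (-1) (by norm_num), hc i, hc j] at h1
    linarith

/-- The fourth moment identity of spherical `4`-designs, for all shells of `L` at once. -/
theorem moment_identity {L : EuclideanLattice n}
    (hL : invariantForms L.aut 4 ≤ invariantForms ⊤ 4) {w : ℝ → ℝ}
    (hw : Summable fun x : L.Nz => w (‖x.1‖ ^ 2) * (‖x.1‖ ^ 2) ^ 2)
    (b : OrthonormalBasis (Fin n) ℝ (EuclideanSpace ℝ (Fin n))) (u v : Fin n → ℝ) :
    (n * (n + 2) : ℝ) * ∑' x : L.Nz, w (‖x.1‖ ^ 2) *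
      ((∑ i, u i * inner ℝ x.1 (b i) ^ 2) * ∑ i, v i * inner ℝ x.1 (b i) ^ 2) =
    (2 * ∑ i, u i * v i + (∑ i, u i) * ∑ i, v i) *
      ∑' x : L.Nz, w (‖x.1‖ ^ 2) * (‖x.1‖ ^ 2) ^ 2 := by
  obtain ⟨c, hc⟩ := exists_mixedMoment hL hw b
  have key (u v : Fin n → ℝ) : ∑' x : L.Nz, w (‖x.1‖ ^ 2) *
      ((∑ i, u i * inner ℝ x.1 (b i) ^ 2) * ∑ i, v i * inner ℝ x.1 (b i) ^ 2) =
      c * (2 * ∑ i, u i * v i + (∑ i, u i) * ∑ i, v i) := by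
    have h1 : HasSum (fun x : L.Nz => ∑ i, ∑ j, u i * v j * (w (‖x.1‖ ^ 2) *
        (inner ℝ x.1 (b i) ^ 2 * inner ℝ x.1 (b j) ^ 2)))
        (∑ i, ∑ j, u i * v j * (c + if i = j then 2 * c else 0)) :=
      hasSum_sum fun i _ => hasSum_sum fun j _ => (hc i j).mul_left _
    have h2 : ∑ i, ∑ j, u i * v j * (c + if i = j then 2 * c else 0) =
        c * (2 * ∑ i, u i * v i + (∑ i, u i) * ∑ i, v i) := by
      have (i : Fin n) : ∑ j, u i * v j * (c + if i = j then 2 * c else 0) =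
          c * (∑ j, v j) * u i + 2 * c * (u i * v i) := by
        simp only [mul_add, Finset.sum_add_distrib, mul_ite, mul_zero, Finset.sum_ite_eq,
          Finset.mem_univ, if_true, ← Finset.sum_mul, ← Finset.mul_sum]
        ring
      simp_rw [this]
      rw [Finset.sum_add_distrib, ← Finset.mul_sum, ← Finset.mul_sum]
      ring
    rw [← h2, ← h1.tsum_eq]
    refine tsum_congr fun x => ?_
    rw [Finset.sum_mul_sum, Finset.mul_sum]
    refine Finset.sum_congr rfl fun i _ => ?_
    rw [Finset.mul_sum]
    exact Finset.sum_congr rfl fun j _ => by ring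
  have h1 := key (fun _ => 1) (fun _ => 1)
  simp only [one_mul, sum_sq_coord, mul_one, Finset.sum_const, Finset.card_univ, Fintype.card_fin,
    nsmul_eq_mul] at h1
  have h2 : ∑' x : L.Nz, w (‖x.1‖ ^ 2) * (‖x.1‖ ^ 2) ^ 2 = c * (2 * n + n * n) := by
    rw [← h1]
    exact tsum_congr fun x => by ring
  rw [key, h2]
  ring

/-! ### The second variation of a sum over a lattice -/

/-- The functions `f₁`, `f₂`, `f₃` are the first three derivatives of `f` on `(0, ∞)`, and
`r ^ j fⱼ(r)` is bounded by `C r ^ (-N)`. -/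
structure PowerDecay (C N : ℝ) (f f₁ f₂ f₃ : ℝ → ℝ) : Prop where
  hasDerivAt : ∀ r, 0 < r → HasDerivAt f (f₁ r) r
  hasDerivAt₁ : ∀ r, 0 < r → HasDerivAt f₁ (f₂ r) r
  hasDerivAt₂ : ∀ r, 0 < r → HasDerivAt f₂ (f₃ r) r
  bound : ∀ r, 0 < r → |f r| ≤ C * r ^ (-N)
  bound₁ : ∀ r, 0 < r → |f₁ r| * r ≤ C * r ^ (-N)
  bound₂ : ∀ r, 0 < r → |f₂ r| * r ^ 2 ≤ C * r ^ (-N)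
  bound₃ : ∀ r, 0 < r → |f₃ r| * r ^ 3 ≤ C * r ^ (-N)

theorem taylor_two_bound {F F₁ F₂ F₃ : ℝ → ℝ} {B : ℝ}
    (h0 : ∀ t, HasDerivAt F (F₁ t) t) (h1 : ∀ t, HasDerivAt F₁ (F₂ t) t)
    (h2 : ∀ t, HasDerivAt F₂ (F₃ t) t) (hB : ∀ t ∈ Set.Icc (0 : ℝ) 1, |F₃ t| ≤ B) :
    |F 1 - F 0 - F₁ 0 - F₂ 0 / 2| ≤ B := by
  have h0mem : (0 : ℝ) ∈ Set.Icc (0 : ℝ) 1 := ⟨le_rfl, zero_le_one⟩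
  have hB0 : 0 ≤ B := (abs_nonneg _).trans (hB 0 h0mem)
  -- a function that vanishes at `0` and whose derivative is at most `B` is at most `B` on `[0, 1]`
  have mv {G G' : ℝ → ℝ} (hG : ∀ t, HasDerivAt G (G' t) t) (hz : G 0 = 0)
      (hb : ∀ t ∈ Set.Icc (0 : ℝ) 1, |G' t| ≤ B) : ∀ t ∈ Set.Icc (0 : ℝ) 1, |G t| ≤ B := by
    intro t ht
    have := (convex_Icc (0 : ℝ) 1).norm_image_sub_le_of_norm_hasDerivWithin_le
      (fun s _ => (hG s).hasDerivWithinAt) hb h0mem ht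
    rw [hz, sub_zero, sub_zero, Real.norm_eq_abs, Real.norm_eq_abs, abs_of_nonneg ht.1] at this
    exact this.trans (mul_le_of_le_one_right hB0 ht.2)
  have e2 := mv (G := fun t => F₂ t - F₂ 0) (G' := F₃) (fun t => (h2 t).sub_const _) (sub_self _) hB
  have e1 := mv (G := fun t => F₁ t - F₁ 0 - t * F₂ 0) (G' := fun t => F₂ t - F₂ 0)
    (fun t => (((h1 t).sub_const (F₁ 0)).sub ((hasDerivAt_id t).mul_const (F₂ 0))).congr_deriv
      (by ring))
    (by simp) e2
  have e0 := mv (G := fun t => F t - F 0 - t * F₁ 0 - t ^ 2 * (F₂ 0 / 2))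
    (G' := fun t => F₁ t - F₁ 0 - t * F₂ 0)
    (fun t => by
      refine ((((h0 t).sub_const (F 0)).sub ((hasDerivAt_id t).mul_const (F₁ 0))).sub
        ((hasDerivAt_pow 2 t).mul_const (F₂ 0 / 2))).congr_deriv ?_
      push_cast
      ring)
    (by simp) e1
  simpa using e0 1 ⟨zero_le_one, le_rfl⟩

/-- The third order Taylor estimate for `f (∑ exp (λᵢ) aᵢ)` in `λ`, uniformly in `a`. -/
theorem PowerDecay.taylor {C N : ℝ} {f f₁ f₂ f₃ : ℝ → ℝ} (hf : PowerDecay C N f f₁ f₂ f₃)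
    (hN : 0 ≤ N) {δ : ℝ} (hδ : δ ≤ 1) {l : Fin n → ℝ} (hl : ∀ i, |l i| ≤ δ)
    {a : Fin n → ℝ} (ha : ∀ i, 0 ≤ a i) (hr : 0 < ∑ i, a i) :
    |f (∑ i, Real.exp (l i) * a i) - f (∑ i, a i) - f₁ (∑ i, a i) * (∑ i, l i * a i) -
      (f₂ (∑ i, a i) * (∑ i, l i * a i) ^ 2 + f₁ (∑ i, a i) * (∑ i, l i ^ 2 * a i)) / 2| ≤
      5 * C * Real.exp N * δ ^ 3 * (∑ i, a i) ^ (-N) := by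
  set r := ∑ i, a i with hrdef
  have hne : Nonempty (Fin n) := by
    by_contra h
    rw [not_nonempty_iff] at h
    simp [hrdef] at hr
  have hδ0 : 0 ≤ δ := (abs_nonneg _).trans (hl hne.some)
  have hC : 0 ≤ C := by
    have := (abs_nonneg _).trans (hf.bound 1 one_pos)
    simpa using this
  -- the `j`-th derivative of `t ↦ ∑ exp (t λᵢ) aᵢ`
  let q : ℕ → ℝ → ℝ := fun j t => ∑ i, l i ^ j * (Real.exp (t * l i) * a i)
  have hq (j : ℕ) (t : ℝ) : HasDerivAt (q j) (q (j + 1) t) t := by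
    refine HasDerivAt.fun_sum fun i _ => ?_
    have h1 : HasDerivAt (fun t : ℝ => t * l i) (l i) t := by
      simpa using (hasDerivAt_id t).mul_const (l i)
    exact ((h1.exp.mul_const (a i)).const_mul (l i ^ j)).congr_deriv (by ring)
  have hqb (j : ℕ) (t : ℝ) : |q j t| ≤ δ ^ j * q 0 t := by
    simp only [q, pow_zero, one_mul]
    rw [Finset.mul_sum]
    refine (Finset.abs_sum_le_sum_abs _ _).trans (Finset.sum_le_sum fun i _ => ?_)
    have h0 : 0 ≤ Real.exp (t * l i) * a i := mul_nonneg (Real.exp_pos _).le (ha i)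
    rw [abs_mul, abs_pow, abs_of_nonneg h0]
    gcongr
    exact hl i
  have hlow (t : ℝ) (ht : t ∈ Set.Icc (0 : ℝ) 1) : Real.exp (-1) * r ≤ q 0 t := by
    simp only [q, pow_zero, one_mul]
    rw [hrdef, Finset.mul_sum]
    refine Finset.sum_le_sum fun i _ => mul_le_mul_of_nonneg_right (Real.exp_le_exp.2 ?_) (ha i)
    have h1 := (hl i).trans hδ
    have h2 := neg_abs_le (l i)
    nlinarith [ht.1, ht.2, abs_nonneg (l i)]
  have hpos (t : ℝ) : 0 < q 0 t := by
    obtain ⟨i, _, hi⟩ := (Finset.sum_pos_iff_of_nonneg fun i _ => ha i).1 hr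
    simp only [q, pow_zero, one_mul]
    exact Finset.sum_pos' (fun i _ => mul_nonneg (Real.exp_pos _).le (ha i))
      ⟨i, Finset.mem_univ _, mul_pos (Real.exp_pos _) hi⟩
  have hrpow (t : ℝ) (ht : t ∈ Set.Icc (0 : ℝ) 1) : q 0 t ^ (-N) ≤ Real.exp N * r ^ (-N) := by
    calc q 0 t ^ (-N) ≤ (Real.exp (-1) * r) ^ (-N) :=
          Real.rpow_le_rpow_of_nonpos (by positivity) (hlow t ht) (by linarith)
      _ = _ := by
          rw [Real.mul_rpow (Real.exp_pos _).le hr.le, ← Real.exp_mul]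
          simp
  -- the constant `5 = 1 + 3 + 1` is the sum of the coefficients in the third derivative
  have main := taylor_two_bound (F := fun t => f (q 0 t)) (F₁ := fun t => f₁ (q 0 t) * q 1 t)
    (F₂ := fun t => f₂ (q 0 t) * q 1 t ^ 2 + f₁ (q 0 t) * q 2 t)
    (F₃ := fun t => f₃ (q 0 t) * q 1 t ^ 3 + 3 * (f₂ (q 0 t) * (q 1 t * q 2 t)) +
      f₁ (q 0 t) * q 3 t)
    (B := 5 * C * Real.exp N * δ ^ 3 * r ^ (-N))
    (fun t => (hf.hasDerivAt _ (hpos t)).comp t (hq 0 t))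
    (fun t => by
      refine (((hf.hasDerivAt₁ _ (hpos t)).comp t (hq 0 t)).mul (hq 1 t)).congr_deriv ?_
      simp only [Function.comp_apply]
      ring)
    (fun t => by
      refine ((((hf.hasDerivAt₂ _ (hpos t)).comp t (hq 0 t)).mul ((hq 1 t).pow 2)).add
        (((hf.hasDerivAt₁ _ (hpos t)).comp t (hq 0 t)).mul (hq 2 t))).congr_deriv ?_
      simp only [Function.comp_apply, Pi.pow_apply]
      push_cast
      ring)
    (fun t ht => by
      have hp := hpos t
      have hδ3 : 0 ≤ δ ^ 3 := by positivity
      have b1 := hqb 1 t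
      have b2 := hqb 2 t
      have b3 := hqb 3 t
      have a3 : |f₃ (q 0 t) * q 1 t ^ 3| ≤ δ ^ 3 * (C * q 0 t ^ (-N)) := by
        rw [abs_mul, abs_pow]
        calc |f₃ (q 0 t)| * |q 1 t| ^ 3 ≤ |f₃ (q 0 t)| * (δ ^ 1 * q 0 t) ^ 3 := by gcongr
          _ = δ ^ 3 * (|f₃ (q 0 t)| * q 0 t ^ 3) := by ring
          _ ≤ _ := mul_le_mul_of_nonneg_left (hf.bound₃ _ hp) hδ3
      have a2 : |3 * (f₂ (q 0 t) * (q 1 t * q 2 t))| ≤ 3 * (δ ^ 3 * (C * q 0 t ^ (-N))) := by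
        rw [abs_mul, abs_mul, abs_mul, abs_of_pos (by norm_num : (0 : ℝ) < 3)]
        calc 3 * (|f₂ (q 0 t)| * (|q 1 t| * |q 2 t|))
            ≤ 3 * (|f₂ (q 0 t)| * ((δ ^ 1 * q 0 t) * (δ ^ 2 * q 0 t))) := by gcongr
          _ = 3 * (δ ^ 3 * (|f₂ (q 0 t)| * q 0 t ^ 2)) := by ring
          _ ≤ _ := mul_le_mul_of_nonneg_left (mul_le_mul_of_nonneg_left (hf.bound₂ _ hp) hδ3)
              (by norm_num)
      have a1 : |f₁ (q 0 t) * q 3 t| ≤ δ ^ 3 * (C * q 0 t ^ (-N)) := by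
        rw [abs_mul]
        calc |f₁ (q 0 t)| * |q 3 t| ≤ |f₁ (q 0 t)| * (δ ^ 3 * q 0 t) := by gcongr
          _ = δ ^ 3 * (|f₁ (q 0 t)| * q 0 t) := by ring
          _ ≤ _ := mul_le_mul_of_nonneg_left (hf.bound₁ _ hp) hδ3
      have hsum : δ ^ 3 * (C * q 0 t ^ (-N)) ≤ δ ^ 3 * (C * (Real.exp N * r ^ (-N))) := by
        gcongr
        exact hrpow t ht
      refine (abs_add_le _ _).trans ?_
      have := abs_add_le (f₃ (q 0 t) * q 1 t ^ 3) (3 * (f₂ (q 0 t) * (q 1 t * q 2 t)))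
      linarith)
  simpa [q, ← hrdef] using main

/-- The sum of `f` over the nonzero vectors of the lattice obtained from `L` by scaling the
squares of the coordinates in the orthonormal basis `b` by `exp (λᵢ)`. -/
noncomputable def deformedSum (L : EuclideanLattice n) (f : ℝ → ℝ)
    (b : OrthonormalBasis (Fin n) ℝ (EuclideanSpace ℝ (Fin n))) (l : Fin n → ℝ) : ℝ :=
  ∑' x : L.Nz, f (∑ i, Real.exp (l i) * inner ℝ x.1 (b i) ^ 2)

/-- The second variation of a sum over a lattice whose fourth moments are those of a design: the
first order term vanishes for deformations of trace zero, and the second order term is isotropic. -/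
theorem PowerDecay.exists_second_variation (hn : 1 ≤ n) {L : EuclideanLattice n}
    (hL : invariantForms L.aut 4 ≤ invariantForms ⊤ 4) {C N : ℝ} (hN : (n : ℝ) / 2 < N)
    {f f₁ f₂ f₃ : ℝ → ℝ} (hf : PowerDecay C N f f₁ f₂ f₃) :
    ∃ K : ℝ, ∀ (b : OrthonormalBasis (Fin n) ℝ (EuclideanSpace ℝ (Fin n))) (l : Fin n → ℝ) (δ : ℝ),
      δ ≤ 1 → (∀ i, |l i| ≤ δ) → ∑ i, l i = 0 →
      |L.deformedSum f b l - ∑' x : L.Nz, f (‖x.1‖ ^ 2) - (∑ i, l i ^ 2) / (2 * n * (n + 2)) *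
        ∑' x : L.Nz, ((n + 2) * (f₁ (‖x.1‖ ^ 2) * ‖x.1‖ ^ 2) +
          2 * (f₂ (‖x.1‖ ^ 2) * (‖x.1‖ ^ 2) ^ 2))| ≤ K * δ ^ 3 := by
  have hn0 : (0 : ℝ) < n := by exact_mod_cast hn
  have hN0 : 0 ≤ N := by linarith
  have hsN := L.summable_normSq_rpow hN
  refine ⟨5 * C * Real.exp N * ∑' x : L.Nz, (‖x.1‖ ^ 2) ^ (-N), fun b l δ hδ hl hl0 => ?_⟩
  have hC : 0 ≤ C := by
    have := (abs_nonneg _).trans (hf.bound 1 one_pos)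
    simpa using this
  let r : L.Nz → ℝ := fun x => ‖x.1‖ ^ 2
  have hr : ∀ x, 0 < r x := fun x => x.normSq_pos
  let A : L.Nz → ℝ := fun x => ∑ i, l i * inner ℝ x.1 (b i) ^ 2
  let B : L.Nz → ℝ := fun x => ∑ i, l i ^ 2 * inner ℝ x.1 (b i) ^ 2
  have hrsum (x : L.Nz) : ∑ i, inner ℝ x.1 (b i) ^ 2 = r x := sum_sq_coord b x.1
  -- summability of the terms of the Taylor expansion
  have hw1 : Summable fun x : L.Nz => f₁ (r x) * r x := by
    refine Summable.of_norm_bounded (hsN.mul_left C) fun x => ?_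
    rw [norm_mul, Real.norm_of_nonneg (hr x).le]
    exact hf.bound₁ _ (hr x)
  have hw2 : Summable fun x : L.Nz => f₂ (r x) * r x ^ 2 := by
    refine Summable.of_norm_bounded (hsN.mul_left C) fun x => ?_
    rw [norm_mul, Real.norm_of_nonneg (sq_nonneg (r x))]
    exact hf.bound₂ _ (hr x)
  have hw1' : Summable fun x : L.Nz => (fun s => f₁ s / s) (‖x.1‖ ^ 2) * (‖x.1‖ ^ 2) ^ 2 := by
    refine hw1.congr fun x => ?_
    have := (hr x).ne'
    simp only [r] at this ⊢
    field_simp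
  have habs (u : Fin n → ℝ) (x : L.Nz) :
      |∑ i, u i * inner ℝ x.1 (b i) ^ 2| ≤ (∑ i, |u i|) * r x := by
    rw [Finset.sum_mul]
    refine (Finset.abs_sum_le_sum_abs _ _).trans (Finset.sum_le_sum fun i _ => ?_)
    rw [abs_mul, abs_of_nonneg (sq_nonneg (inner ℝ x.1 (b i)))]
    exact mul_le_mul_of_nonneg_left (sq_coord_le b _ _) (abs_nonneg _)
  have hs0 : Summable fun x : L.Nz => f (r x) :=
    Summable.of_norm_bounded (hsN.mul_left C) fun x => hf.bound _ (hr x)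
  have hmul {g : ℝ → ℝ} (hg : Summable fun x : L.Nz => g (r x) * r x) (u : Fin n → ℝ) :
      Summable fun x : L.Nz => g (r x) * ∑ i, u i * inner ℝ x.1 (b i) ^ 2 := by
    refine Summable.of_norm_bounded (hg.norm.mul_left (∑ i, |u i|)) fun x => ?_
    rw [norm_mul, norm_mul, Real.norm_of_nonneg (hr x).le]
    calc ‖g (r x)‖ * ‖∑ i, u i * inner ℝ x.1 (b i) ^ 2‖
        ≤ ‖g (r x)‖ * ((∑ i, |u i|) * r x) := by gcongr; exact habs u x
      _ = _ := by ring
  have hsA : Summable fun x => f₁ (r x) * A x := hmul hw1 l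
  have hsB : Summable fun x => f₁ (r x) * B x := hmul hw1 fun i => l i ^ 2
  have hsAA : Summable fun x => f₂ (r x) * A x ^ 2 := by
    refine summable_weight_mul (w := f₂) hw2 (C := (∑ i, |l i|) ^ 2) fun x => ?_
    rw [abs_pow, ← mul_pow]
    gcongr
    exact habs l x
  -- the moment identity for the weights `f₁(s) / s` and `f₂(s)`; a single diagonal form is made
  -- into a product of two by the factor `‖x‖²`, the form with all coefficients `1`
  have hnn : (n * (n + 2) : ℝ) ≠ 0 := by positivity
  have eA : ∑' x, f₁ (r x) * A x = 0 := by
    have h := moment_identity hL (w := fun s => f₁ s / s) hw1' b l (fun _ => 1)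
    simp only [mul_one, hl0, zero_mul, mul_zero, add_zero] at h
    have h' := (mul_eq_zero.1 h).resolve_left hnn
    rw [← h']
    refine tsum_congr fun x => ?_
    have := norm_ne_zero_iff.2 x.2.2
    simp only [one_mul, hrsum]
    simp only [r, A]
    field_simp
  have eB : (n * (n + 2) : ℝ) * ∑' x, f₁ (r x) * B x =
      (n + 2) * (∑ i, l i ^ 2) * ∑' x, f₁ (r x) * r x := by
    have h := moment_identity hL (w := fun s => f₁ s / s) hw1' b (fun i => l i ^ 2) (fun _ => 1)
    simp only [mul_one, Finset.sum_const, Finset.card_univ, Fintype.card_fin, nsmul_eq_mul] at h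
    have e1 : ∑' x, f₁ (r x) * B x = ∑' x : L.Nz, (fun s => f₁ s / s) (‖x.1‖ ^ 2) *
        ((∑ i, l i ^ 2 * inner ℝ x.1 (b i) ^ 2) * ∑ i, 1 * inner ℝ x.1 (b i) ^ 2) := by
      refine tsum_congr fun x => ?_
      have := norm_ne_zero_iff.2 x.2.2
      simp only [one_mul, hrsum]
      simp only [r, B]
      field_simp
    have e2 : ∑' x, f₁ (r x) * r x =
        ∑' x : L.Nz, (fun s => f₁ s / s) (‖x.1‖ ^ 2) * (‖x.1‖ ^ 2) ^ 2 := by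
      refine tsum_congr fun x => ?_
      have := (hr x).ne'
      simp only [r] at this ⊢
      field_simp
    rw [e1, e2, h]
    ring
  have eAA : (n * (n + 2) : ℝ) * ∑' x, f₂ (r x) * A x ^ 2 =
      2 * (∑ i, l i ^ 2) * ∑' x, f₂ (r x) * r x ^ 2 := by
    have h := moment_identity hL (w := f₂) hw2 b l l
    rw [hl0, mul_zero, add_zero] at h
    simp only [← sq] at h
    exact h
  -- the Taylor estimate, term by term
  have hT (x : L.Nz) : ‖f (∑ i, Real.exp (l i) * inner ℝ x.1 (b i) ^ 2) - f (r x) -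
      f₁ (r x) * A x - (f₂ (r x) * A x ^ 2 + f₁ (r x) * B x) / 2‖ ≤
      5 * C * Real.exp N * δ ^ 3 * r x ^ (-N) := by
    have h := hf.taylor hN0 hδ hl (a := fun i => inner ℝ x.1 (b i) ^ 2)
      (fun i => sq_nonneg _) (by rw [hrsum]; exact hr x)
    rwa [hrsum] at h
  have hsT := Summable.of_norm_bounded (hsN.mul_left (5 * C * Real.exp N * δ ^ 3)) hT
  have hsAB := (hsAA.add hsB).div_const 2
  have hsf : Summable fun x : L.Nz => f (∑ i, Real.exp (l i) * inner ℝ x.1 (b i) ^ 2) :=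
    (((hsT.add hsAB).add hsA).add hs0).congr fun x => by ring
  have hfin : L.deformedSum f b l - ∑' x : L.Nz, f (‖x.1‖ ^ 2) -
      (∑ i, l i ^ 2) / (2 * n * (n + 2)) * ∑' x : L.Nz, ((n + 2) * (f₁ (‖x.1‖ ^ 2) * ‖x.1‖ ^ 2) +
          2 * (f₂ (‖x.1‖ ^ 2) * (‖x.1‖ ^ 2) ^ 2)) =
      ∑' x : L.Nz, (f (∑ i, Real.exp (l i) * inner ℝ x.1 (b i) ^ 2) - f (r x) -
        f₁ (r x) * A x - (f₂ (r x) * A x ^ 2 + f₁ (r x) * B x) / 2) := by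
    rw [((hsf.sub hs0).sub hsA).tsum_sub hsAB, (hsf.sub hs0).tsum_sub hsA, hsf.tsum_sub hs0,
      tsum_div_const, hsAA.tsum_add hsB, eA, (hw1.mul_left _).tsum_add (hw2.mul_left _),
      tsum_mul_left, tsum_mul_left, deformedSum, sub_zero]
    congr 1
    rw [(eq_div_iff hnn).2 ((mul_comm _ _).trans eB), (eq_div_iff hnn).2 ((mul_comm _ _).trans eAA)]
    field_simp
    ring
  rw [hfin]
  calc |∑' x : L.Nz, (f (∑ i, Real.exp (l i) * inner ℝ x.1 (b i) ^ 2) - f (r x) -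
        f₁ (r x) * A x - (f₂ (r x) * A x ^ 2 + f₁ (r x) * B x) / 2)|
      ≤ ∑' x : L.Nz, 5 * C * Real.exp N * δ ^ 3 * r x ^ (-N) :=
        tsum_of_norm_bounded (hsN.mul_left _).hasSum hT
    _ = _ := by rw [tsum_mul_left]; ring

/-! ### Deformations of a lattice -/

/-- The singular value decomposition of a linear map `A` of determinant `±1`: in a suitable
orthonormal basis, `‖A x‖²` is obtained by scaling the squares of the coordinates of `x` by positive
numbers `exp (λᵢ)` of product `1`; the inverse transpose scales them by `exp (-λᵢ)`. -/
theorem exists_diagonalization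
    (A A' : EuclideanSpace ℝ (Fin n) ≃ₗ[ℝ] EuclideanSpace ℝ (Fin n))
    (hA : ∀ x y, inner ℝ (A' y) (A x) = inner ℝ y x)
    (hdet : |LinearMap.det (A : EuclideanSpace ℝ (Fin n) →ₗ[ℝ] EuclideanSpace ℝ (Fin n))| = 1) :
    ∃ (b : OrthonormalBasis (Fin n) ℝ (EuclideanSpace ℝ (Fin n))) (l : Fin n → ℝ),
      ∑ i, l i = 0 ∧ (∀ i, l i = 2 * Real.log ‖A (b i)‖) ∧
      (∀ x, ‖A x‖ ^ 2 = ∑ i, Real.exp (l i) * inner ℝ x (b i) ^ 2) ∧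
      ∀ y, ‖A' y‖ ^ 2 = ∑ i, Real.exp (-l i) * inner ℝ y (b i) ^ 2 := by
  -- `b` is an eigenbasis of `Aᵀ A`, and `exp (lᵢ)` are the eigenvalues
  let T := A.toLinearMap
  have hS := LinearMap.isSymmetric_adjoint_mul_self T
  have hfr : Module.finrank ℝ (EuclideanSpace ℝ (Fin n)) = n := finrank_euclideanSpace_fin
  let b := hS.eigenvectorBasis hfr
  let μ := hS.eigenvalues hfr
  have hb (x : EuclideanSpace ℝ (Fin n)) (i : Fin n) :
      inner ℝ (A x) (A (b i)) = μ i * inner ℝ x (b i) := by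
    have h := hS.apply_eigenvectorBasis hfr i
    have h1 : inner ℝ x ((LinearMap.adjoint T * T) (b i)) = inner ℝ (A x) (A (b i)) :=
      LinearMap.adjoint_inner_right T x (T (b i))
    rw [← h1, h, inner_smul_right]
    rfl
  have hμ (i : Fin n) : ‖A (b i)‖ ^ 2 = μ i := by
    rw [← real_inner_self_eq_norm_sq, hb, real_inner_self_eq_norm_sq, b.norm_eq_one]
    ring
  have hAb (i : Fin n) : 0 < ‖A (b i)‖ := by
    rw [norm_pos_iff]
    intro h
    have := A.map_eq_zero_iff.1 h
    have h1 := b.norm_eq_one i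
    rw [this, norm_zero] at h1
    exact zero_ne_one h1
  let l : Fin n → ℝ := fun i => 2 * Real.log ‖A (b i)‖
  have hl (i : Fin n) : Real.exp (l i) = μ i := by
    rw [← hμ, show l i = Real.log (‖A (b i)‖ ^ 2) by rw [Real.log_pow]; norm_num [l],
      Real.exp_log (pow_pos (hAb i) 2)]
  have hx (x : EuclideanSpace ℝ (Fin n)) :
      ‖A x‖ ^ 2 = ∑ i, Real.exp (l i) * inner ℝ x (b i) ^ 2 := by
    have h1 : ‖A x‖ ^ 2 = inner ℝ x ((LinearMap.adjoint T * T) x) := by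
      rw [← real_inner_self_eq_norm_sq]
      exact (LinearMap.adjoint_inner_right T x (T x)).symm
    rw [h1, ← b.sum_inner_mul_inner]
    refine Finset.sum_congr rfl fun i _ => ?_
    have h2 : inner ℝ (b i) ((LinearMap.adjoint T * T) x) = inner ℝ (A (b i)) (A x) :=
      LinearMap.adjoint_inner_right T (b i) (T x)
    rw [h2, real_inner_comm (A x) (A (b i)), hb, hl]
    ring
  refine ⟨b, l, ?_, fun i => rfl, hx, fun y => ?_⟩
  · have h1 : LinearMap.det (LinearMap.adjoint T * T) = ∏ i, μ i := by
      rw [hS.det_eq_prod_eigenvalues hfr]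
      rfl
    have h2 : LinearMap.det (LinearMap.adjoint T) = LinearMap.det T := by
      let e := EuclideanSpace.basisFun (Fin n) ℝ
      rw [← LinearMap.det_toMatrix e.toBasis, ← LinearMap.det_toMatrix e.toBasis,
        LinearMap.toMatrix_adjoint, Matrix.det_conjTranspose]
      simp
    rw [map_mul, h2, ← sq, ← sq_abs, hdet, one_pow] at h1
    have h3 : Real.exp (∑ i, l i) = 1 := by
      rw [Real.exp_sum, h1]
      exact Finset.prod_congr rfl fun i _ => hl i
    exact (Real.exp_eq_one_iff _).1 h3
  · -- write `A' y = A z`; then `y = Aᵀ A z`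
    obtain ⟨z, hz⟩ := A.surjective (A' y)
    have hy (i : Fin n) : inner ℝ y (b i) = Real.exp (l i) * inner ℝ z (b i) := by
      rw [← hA, ← hz, hb, hl]
    rw [← hz, hx]
    refine Finset.sum_congr rfl fun i _ => ?_
    rw [hy, Real.exp_neg]
    have := (Real.exp_pos (l i)).ne'
    field_simp

theorem tsum_eq_deformedSum {L M : EuclideanLattice n}
    (A : EuclideanSpace ℝ (Fin n) ≃ₗ[ℝ] EuclideanSpace ℝ (Fin n))
    (h : (M.carrier : Set (EuclideanSpace ℝ (Fin n))) = A '' L.carrier)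
    {b : OrthonormalBasis (Fin n) ℝ (EuclideanSpace ℝ (Fin n))} {l : Fin n → ℝ}
    (hl : ∀ x, ‖A x‖ ^ 2 = ∑ i, Real.exp (l i) * inner ℝ x (b i) ^ 2) (f : ℝ → ℝ) :
    ∑' x : M.Nz, f (‖x.1‖ ^ 2) = L.deformedSum f b l := by
  have hmem (x) : A x ∈ M.carrier ↔ x ∈ L.carrier := by
    rw [← SetLike.mem_coe, h, A.injective.mem_set_image, SetLike.mem_coe]
  let e : L.Nz ≃ M.Nz :=
    { toFun := fun x => ⟨A x.1, (hmem _).2 x.2.1, by simpa using x.2.2⟩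
      invFun := fun y => ⟨A.symm y.1, by rw [← hmem]; simpa using y.2.1, by simpa using y.2.2⟩
      left_inv := fun x => by simp
      right_inv := fun x => by simp }
  rw [deformedSum, ← e.tsum_eq]
  refine tsum_congr fun x => ?_
  rw [← hl]
  rfl

/-- The criterion for a strict local minimum. Up to isometry, the lattices near `L` of the same
covolume are the deformations of `L` along small trace zero vectors `λ` in orthonormal bases, and
their duals are the deformations of `L*` along `-λ`. It is enough to compare `f` at those for which
`λ ≠ 0`. -/
theorem isStrictLocalMin_of_deformation {L : EuclideanLattice n} {f : EuclideanLattice n → ℝ}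
    {δ₀ : ℝ} (hδ₀ : 0 < δ₀)
    (h : ∀ (M : EuclideanLattice n) (b : OrthonormalBasis (Fin n) ℝ (EuclideanSpace ℝ (Fin n)))
      (l : Fin n → ℝ), M.covol = L.covol → ∑ i, l i = 0 → 0 < ∑ i, l i ^ 2 →
      ∑ i, l i ^ 2 ≤ δ₀ ^ 2 →
      (∀ g : ℝ → ℝ, ∑' x : M.Nz, g (‖x.1‖ ^ 2) = L.deformedSum g b l) →
      (∀ g : ℝ → ℝ, ∑' x : M.dual.Nz, g (‖x.1‖ ^ 2) = L.dual.deformedSum g b (fun i => -l i)) →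
      f L < f M) : L.IsStrictLocalMin f := by
  rw [IsStrictLocalMin, eventually_nhdsWithin_iff]
  apply eventually_nhds_of_linear
  have hn1 : (0 : ℝ) < n + 1 := by positivity
  -- `n` numbers smaller than `δ₀ / (n + 1)` have a sum of squares at most `δ₀²`
  have hlog : ∀ᶠ u : ℝ in 𝓝 1, |2 * Real.log u| < δ₀ / (n + 1) := by
    have hc : ContinuousAt (fun u : ℝ => |2 * Real.log u|) 1 :=
      (continuousAt_const.mul (Real.continuousAt_log one_ne_zero)).abs
    exact hc.eventually (Iio_mem_nhds (by simpa using div_pos hδ₀ hn1))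
  obtain ⟨η, hη, hlog⟩ := Metric.eventually_nhds_iff.1 hlog
  filter_upwards [Metric.ball_mem_nhds
    (1 : EuclideanSpace ℝ (Fin n) →L[ℝ] EuclideanSpace ℝ (Fin n)) (lt_min hη one_pos)] with A hAη
  intro M hM hcov
  change M.covol = L.covol at hcov
  rw [mem_ball_iff_norm] at hAη
  have hnear (x : EuclideanSpace ℝ (Fin n)) : |‖A x‖ - ‖x‖| ≤ ‖A - 1‖ * ‖x‖ :=
    (abs_norm_sub_norm_le _ _).trans ((A - 1).le_opNorm x)
  have hinj : Function.Injective A.toLinearMap := by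
    rw [← LinearMap.ker_eq_bot, LinearMap.ker_eq_bot']
    intro x hx
    have hx' : A x = 0 := hx
    by_contra hne
    have h1 := hnear x
    rw [hx', norm_zero, zero_sub, abs_neg, abs_norm] at h1
    have h2 : ‖A - 1‖ < 1 := hAη.trans_le (min_le_right _ _)
    have h3 : 0 < ‖x‖ := norm_pos_iff.2 hne
    nlinarith
  let Ae : EuclideanSpace ℝ (Fin n) ≃ₗ[ℝ] EuclideanSpace ℝ (Fin n) :=
    LinearEquiv.ofInjectiveEndo A.toLinearMap hinj
  have hAe (x) : Ae x = A x := rfl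
  let Ae' : EuclideanSpace ℝ (Fin n) ≃ₗ[ℝ] EuclideanSpace ℝ (Fin n) :=
    LinearEquiv.ofLinearMap (LinearMap.adjoint Ae.symm.toLinearMap) (LinearMap.adjoint Ae.toLinearMap)
      (by rw [← LinearMap.adjoint_comp]; simp) (by rw [← LinearMap.adjoint_comp]; simp)
  have hAA' (x y) : inner ℝ (Ae' y) (Ae x) = inner ℝ y x := by
    have : inner ℝ (Ae' y) (Ae x) = inner ℝ y (Ae.symm (Ae x)) :=
      LinearMap.adjoint_inner_left Ae.symm.toLinearMap (Ae x) y
    rw [this, Ae.symm_apply_apply]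
  have hM' : (M.carrier : Set (EuclideanSpace ℝ (Fin n))) = Ae '' L.carrier := hM
  have hdet := covol_image Ae hM'
  rw [hcov, eq_comm, mul_eq_right₀ L.covol_pos.ne'] at hdet
  obtain ⟨b, l, hl0, hllog, hx, hy⟩ := exists_diagonalization Ae Ae' hAA' hdet
  rcases (Finset.sum_nonneg fun i _ => sq_nonneg (l i)).eq_or_lt' with hzero | hpos
  · left
    have hli (i : Fin n) : l i = 0 := by
      have := (Finset.sum_eq_zero_iff_of_nonneg fun i _ => sq_nonneg (l i)).1 hzero i
        (Finset.mem_univ i)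
      exact pow_eq_zero_iff two_ne_zero |>.1 this
    have hnorm (x) : ‖Ae x‖ = ‖x‖ := by
      have := hx x
      simp only [hli, Real.exp_zero, one_mul, sum_sq_coord] at this
      exact (pow_left_inj₀ (norm_nonneg _) (norm_nonneg _) two_ne_zero).1 this
    refine ⟨⟨Ae, hnorm⟩, fun x => ?_⟩
    change Ae x ∈ M.carrier ↔ _
    rw [← SetLike.mem_coe, hM', Ae.injective.mem_set_image, SetLike.mem_coe]
  · right
    refine h M b l hcov hl0 hpos ?_ (tsum_eq_deformedSum Ae hM' hx)
      (tsum_eq_deformedSum Ae' (dual_image Ae Ae' hAA' hM') hy)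
    have hli (i : Fin n) : l i ^ 2 ≤ (δ₀ / (n + 1)) ^ 2 := by
      rw [← sq_abs, hllog]
      have h1 := hnear (b i)
      rw [b.norm_eq_one, mul_one] at h1
      have h2 : dist ‖A (b i)‖ 1 < η :=
        (Real.dist_eq _ _).trans_lt (h1.trans_lt (hAη.trans_le (min_le_left _ _)))
      exact pow_le_pow_left₀ (abs_nonneg _) (hlog h2).le 2
    calc ∑ i, l i ^ 2 ≤ ∑ _i : Fin n, (δ₀ / (n + 1)) ^ 2 := Finset.sum_le_sum fun i _ => hli i
      _ = n * (δ₀ / (n + 1)) ^ 2 := by simp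
      _ = δ₀ ^ 2 * (n / (n + 1) ^ 2) := by field_simp
      _ ≤ δ₀ ^ 2 * 1 := by
          refine mul_le_mul_of_nonneg_left ((div_le_one (by positivity)).2 ?_) (sq_nonneg _)
          nlinarith [Nat.cast_nonneg (α := ℝ) n]
      _ = δ₀ ^ 2 := mul_one _

/-- The second variation decides: a quantity whose value at small deformations is, up to a cubic
error, a positive multiple of `∑ λᵢ²` has a strict local minimum. -/
theorem isStrictLocalMin_of_second_variation {L : EuclideanLattice n}
    {f : EuclideanLattice n → ℝ} {κ K : ℝ} (hκ : 0 < κ)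
    (h : ∀ (M : EuclideanLattice n) (b : OrthonormalBasis (Fin n) ℝ (EuclideanSpace ℝ (Fin n)))
      (l : Fin n → ℝ) (δ : ℝ), M.covol = L.covol → ∑ i, l i = 0 → δ ≤ 1 → (∀ i, |l i| ≤ δ) →
      (∀ g : ℝ → ℝ, ∑' x : M.Nz, g (‖x.1‖ ^ 2) = L.deformedSum g b l) →
      (∀ g : ℝ → ℝ, ∑' x : M.dual.Nz, g (‖x.1‖ ^ 2) = L.dual.deformedSum g b (fun i => -l i)) →
      |f M - f L - κ * ∑ i, l i ^ 2| ≤ K * δ ^ 3) : L.IsStrictLocalMin f := by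
  have hK : 0 < |K| + 1 := by positivity
  refine isStrictLocalMin_of_deformation (δ₀ := min 1 (κ / (|K| + 1) / 2)) (by positivity)
    fun M b l hM hl0 hpos hle h1 h2 => ?_
  -- apply the hypothesis with `δ` the Euclidean norm of `l`
  set S := ∑ i, l i ^ 2
  have hδ : √S ≤ min 1 (κ / (|K| + 1) / 2) := Real.sqrt_le_iff.2 ⟨by positivity, hle⟩
  have hsq : √S ^ 2 = S := Real.sq_sqrt hpos.le
  have hsp : 0 < √S := Real.sqrt_pos.2 hpos
  have habs := h M b l √S hM hl0 (hδ.trans (min_le_left _ _)) (fun i => Real.abs_le_sqrt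
    (Finset.single_le_sum (f := fun i => l i ^ 2) (fun _ _ => sq_nonneg _) (Finset.mem_univ i))) h1 h2
  have h3 := (abs_le.1 habs).1
  have h4 : K * √S ^ 3 ≤ κ / 2 * S := by
    have h5 : √S * (|K| + 1) ≤ κ / 2 := by
      have := hδ.trans (min_le_right _ _)
      rw [div_div, mul_comm (|K| + 1), ← div_div, le_div_iff₀ hK] at this
      exact this
    calc K * √S ^ 3 ≤ (|K| + 1) * √S ^ 3 := by
          gcongr
          linarith [le_abs_self K]
      _ = (√S * (|K| + 1)) * √S ^ 2 := by ring
      _ ≤ κ / 2 * √S ^ 2 := by gcongr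
      _ = _ := by rw [hsq]
  nlinarith

/-! ### The Epstein zeta function -/

theorem nonempty_Nz (hn : 1 ≤ n) (L : EuclideanLattice n) : Nonempty L.Nz := by
  obtain ⟨b, hb⟩ := L.exists_basis
  exact ⟨⟨b ⟨0, hn⟩, hb ▸ Submodule.subset_span ⟨_, rfl⟩, b.ne_zero _⟩⟩

theorem powerDecay_rpow {s : ℝ} (hs : 0 < s) :
    PowerDecay (1 + s + s * (s + 1) + s * (s + 1) * (s + 2)) s (fun r => r ^ (-s))
      (fun r => -s * r ^ (-s - 1)) (fun r => s * (s + 1) * r ^ (-s - 2))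
      (fun r => -(s * (s + 1) * (s + 2)) * r ^ (-s - 3)) := by
  have hder (c : ℝ) {r : ℝ} (hr : 0 < r) :
      HasDerivAt (fun r : ℝ => r ^ c) (c * r ^ (c - 1)) r :=
    Real.hasDerivAt_rpow_const (Or.inl hr.ne')
  have hpow (j : ℕ) {r : ℝ} (hr : 0 < r) : r ^ (-s - j) * r ^ j = r ^ (-s) := by
    rw [Real.rpow_sub_natCast hr.ne', div_mul_cancel₀ _ (pow_pos hr j).ne']
  have h1 : 0 < s * (s + 1) := by positivity
  have h2 : 0 < s * (s + 1) * (s + 2) := by positivity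
  refine ⟨fun r hr => hder _ hr, fun r hr => ?_, fun r hr => ?_, fun r hr => ?_, fun r hr => ?_,
    fun r hr => ?_, fun r hr => ?_⟩
  · refine ((hder (-s - 1) hr).const_mul (-s)).congr_deriv ?_
    rw [show -s - 1 - 1 = -s - 2 by ring]
    ring
  · refine ((hder (-s - 2) hr).const_mul (s * (s + 1))).congr_deriv ?_
    rw [show -s - 2 - 1 = -s - 3 by ring]
    ring
  · have := Real.rpow_pos_of_pos hr (-s)
    rw [abs_of_pos this]
    exact le_mul_of_one_le_left this.le (by linarith)
  · have := Real.rpow_pos_of_pos hr (-s)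
    rw [abs_mul, abs_neg, abs_of_pos hs, abs_of_pos (Real.rpow_pos_of_pos hr _), mul_assoc]
    have e := hpow 1 hr
    rw [Nat.cast_one, pow_one] at e
    rw [e]
    exact mul_le_mul_of_nonneg_right (by linarith) this.le
  · have := Real.rpow_pos_of_pos hr (-s)
    rw [abs_mul, abs_of_pos h1, abs_of_pos (Real.rpow_pos_of_pos hr _), mul_assoc]
    have e := hpow 2 hr
    rw [Nat.cast_ofNat] at e
    rw [e]
    exact mul_le_mul_of_nonneg_right (by linarith) this.le
  · have := Real.rpow_pos_of_pos hr (-s)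
    rw [abs_mul, abs_neg, abs_of_pos h2, abs_of_pos (Real.rpow_pos_of_pos hr _), mul_assoc]
    have e := hpow 3 hr
    rw [Nat.cast_ofNat] at e
    rw [e]
    exact mul_le_mul_of_nonneg_right (by linarith) this.le

theorem epsteinZeta_eq (L : EuclideanLattice n) (s : ℝ) :
    L.epsteinZeta s = ∑' x : L.Nz, (‖x.1‖ ^ 2) ^ (-s) := by
  refine tsum_congr fun x => ?_
  rw [← Real.rpow_natCast_mul (norm_nonneg _)]
  congr 1
  push_cast
  ring

/-- The second variation of `ζ(·, s)` has the coefficient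
`s (2 s - n) ζ(L, s) / (2 n (n + 2)) > 0`. -/
theorem isStrictLocalMin_epsteinZeta (hn : 1 ≤ n) {L : EuclideanLattice n}
    (hL : invariantForms L.aut 4 ≤ invariantForms ⊤ 4) {s : ℝ} (hs : (n : ℝ) / 2 < s) :
    L.IsStrictLocalMin fun M => M.epsteinZeta s := by
  have hn0 : (0 : ℝ) < n := by exact_mod_cast hn
  have hs0 : 0 < s := by linarith
  obtain ⟨K, hK⟩ := (powerDecay_rpow hs0).exists_second_variation hn hL hs
  have hsum := L.summable_normSq_rpow hs
  have hpos : 0 < ∑' x : L.Nz, (‖x.1‖ ^ 2) ^ (-s) :=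
    hsum.tsum_pos (fun x => by positivity) (L.nonempty_Nz hn).some
      (Real.rpow_pos_of_pos (Nz.normSq_pos _) _)
  have hcoeff : ∑' x : L.Nz, ((n + 2) * (-s * (‖x.1‖ ^ 2) ^ (-s - 1) * ‖x.1‖ ^ 2) +
      2 * (s * (s + 1) * (‖x.1‖ ^ 2) ^ (-s - 2) * (‖x.1‖ ^ 2) ^ 2)) =
      s * (2 * s - n) * ∑' x : L.Nz, (‖x.1‖ ^ 2) ^ (-s) := by
    rw [← tsum_mul_left]
    refine tsum_congr fun x => ?_
    have hx := x.normSq_pos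
    rw [Real.rpow_sub_one hx.ne', Real.rpow_sub hx, Real.rpow_two]
    have := norm_ne_zero_iff.2 x.2.2
    field_simp
    ring
  refine isStrictLocalMin_of_second_variation
    (κ := s * (2 * s - n) * (∑' x : L.Nz, (‖x.1‖ ^ 2) ^ (-s)) / (2 * n * (n + 2))) (K := K) ?_
    fun M b l δ _ hl0 hδ hl hM _ => ?_
  · have : 0 < 2 * s - n := by linarith
    positivity
  · have h := hK b l δ hδ hl hl0
    rw [hcoeff] at h
    rw [epsteinZeta_eq, epsteinZeta_eq, hM fun r => r ^ (-s)]
    convert h using 3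
    ring

/-! ### The height -/

/-- Each derivative of `incGamma a` raises `a` by `1`, which is absorbed by a larger exponent of
decay. -/
theorem exists_powerDecay_incGamma {a N : ℝ} (hN : 0 < N) (ha : a < N) :
    ∃ C, PowerDecay C N (incGamma a) (fun r => -Real.pi * incGamma (a + 1) r)
      (fun r => Real.pi ^ 2 * incGamma (a + 1 + 1) r)
      (fun r => -Real.pi ^ 3 * incGamma (a + 1 + 1 + 1) r) := by
  have hpi := Real.pi_pos
  obtain ⟨C₀, hC₀, h₀⟩ := exists_incGamma_le hN ha
  obtain ⟨C₁, hC₁, h₁⟩ := exists_incGamma_le (a := a + 1) (N := N + (1 : ℕ)) (by positivity)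
    (by push_cast; linarith)
  obtain ⟨C₂, hC₂, h₂⟩ := exists_incGamma_le (a := a + 1 + 1) (N := N + (2 : ℕ)) (by positivity)
    (by push_cast; linarith)
  obtain ⟨C₃, hC₃, h₃⟩ := exists_incGamma_le (a := a + 1 + 1 + 1) (N := N + (3 : ℕ))
    (by positivity) (by push_cast; linarith)
  have key (j : ℕ) {g r C : ℝ} (hr : 0 < r) (h : g ≤ C * r ^ (-(N + j))) :
      Real.pi ^ j * g * r ^ j ≤ Real.pi ^ j * C * r ^ (-N) := by
    calc Real.pi ^ j * g * r ^ j ≤ Real.pi ^ j * (C * r ^ (-(N + j))) * r ^ j := by gcongr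
      _ = _ := by
        rw [neg_add', Real.rpow_sub_natCast hr.ne']
        field_simp
  have p₁ : 0 ≤ Real.pi ^ 1 * C₁ := by positivity
  have p₂ : 0 ≤ Real.pi ^ 2 * C₂ := by positivity
  have p₃ : 0 ≤ Real.pi ^ 3 * C₃ := by positivity
  refine ⟨C₀ + Real.pi ^ 1 * C₁ + Real.pi ^ 2 * C₂ + Real.pi ^ 3 * C₃,
    fun r hr => hasDerivAt_incGamma a hr, fun r hr => ?_, fun r hr => ?_, fun r hr => ?_,
    fun r hr => ?_, fun r hr => ?_, fun r hr => ?_⟩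
  · exact ((hasDerivAt_incGamma (a + 1) hr).const_mul (-Real.pi)).congr_deriv (by ring)
  · exact ((hasDerivAt_incGamma (a + 1 + 1) hr).const_mul (Real.pi ^ 2)).congr_deriv (by ring)
  · rw [abs_of_nonneg (incGamma_nonneg _ _)]
    refine (h₀ r hr).trans (mul_le_mul_of_nonneg_right (by linarith) (by positivity))
  · rw [abs_mul, abs_neg, abs_of_pos hpi, abs_of_nonneg (incGamma_nonneg _ _)]
    have := key 1 hr (h₁ r hr)
    rw [pow_one, pow_one] at this
    rw [pow_one] at p₁ ⊢
    exact this.trans (mul_le_mul_of_nonneg_right (by linarith) (by positivity))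
  · rw [abs_mul, abs_of_pos (pow_pos hpi 2), abs_of_nonneg (incGamma_nonneg _ _)]
    exact (key 2 hr (h₂ r hr)).trans
      (mul_le_mul_of_nonneg_right (by linarith) (by positivity))
  · rw [abs_mul, abs_neg, abs_of_pos (pow_pos hpi 3), abs_of_nonneg (incGamma_nonneg _ _)]
    exact (key 3 hr (h₃ r hr)).trans
      (mul_le_mul_of_nonneg_right (by linarith) (by positivity))

/-- The integrand of the second variation of a sum of incomplete gamma integrals is elementary for
`a = 0` and for `a = n / 2`, the two parameters in the formula for the height. -/
theorem incGamma_second_variation (a : ℝ) {r : ℝ} (hr : 0 < r) :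
    (n + 2) * (-Real.pi * incGamma (a + 1) r * r) +
      2 * (Real.pi ^ 2 * incGamma (a + 1 + 1) r * r ^ 2) =
    2 * Real.pi * r * Real.exp (-Real.pi * r) +
      (2 * a - n) * (Real.exp (-Real.pi * r) + a * incGamma a r) := by
  have h1 := pi_mul_incGamma_add_one a hr
  have h2 := pi_mul_incGamma_add_one (a + 1) hr
  linear_combination (2 * Real.pi * r) * h2 + (2 * a - n) * h1

/-- The derivative at `t = 1` of the functional equation of the theta function. -/
theorem second_variation_height (L : EuclideanLattice n) :
    ∑' x : L.dual.Nz, (2 * Real.pi * ‖x.1‖ ^ 2 - n) * Real.exp (-Real.pi * ‖x.1‖ ^ 2) +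
      L.covol * ∑' y : L.Nz, 2 * Real.pi * ‖y.1‖ ^ 2 * Real.exp (-Real.pi * ‖y.1‖ ^ 2) = n := by
  have hd := L.dual.hasDerivAt_theta₀ one_pos
  have hL := L.hasDerivAt_theta₀ one_pos
  have h1 : HasDerivAt (fun t : ℝ => 1 + L.dual.theta₀ t⁻¹)
      ((∑' x : L.dual.Nz, -Real.pi * ‖x.1‖ ^ 2 * Real.exp (-Real.pi * ‖x.1‖ ^ 2 * 1)) * -1) 1 := by
    have hinv : HasDerivAt (fun t : ℝ => t⁻¹) (-1) 1 := by
      simpa using hasDerivAt_inv (one_ne_zero (α := ℝ))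
    refine HasDerivAt.const_add 1 (HasDerivAt.comp (h₂ := L.dual.theta₀) 1 ?_ hinv)
    rwa [inv_one]
  have h2 := ((Real.hasDerivAt_rpow_const (x := 1) (p := (n : ℝ) / 2)
    (Or.inl one_ne_zero)).const_mul L.covol).mul (hL.const_add 1)
  have h3 := h1.unique (h2.congr_of_eventuallyEq (by
    filter_upwards [lt_mem_nhds one_pos] with t ht
    exact L.theta_dual ht))
  have h4 := L.theta_dual one_pos
  simp only [inv_one, Real.one_rpow, mul_one] at h3 h4
  have s1 : Summable fun x : L.dual.Nz => ‖x.1‖ ^ 2 * Real.exp (-Real.pi * ‖x.1‖ ^ 2) :=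
    L.dual.summable_normSq_mul_exp Real.pi_pos
  have s0 : Summable fun x : L.dual.Nz => Real.exp (-Real.pi * ‖x.1‖ ^ 2) :=
    L.dual.summable_exp Real.pi_pos
  have ht : L.dual.theta₀ 1 = ∑' x : L.dual.Nz, Real.exp (-Real.pi * ‖x.1‖ ^ 2) := by
    simp [theta₀]
  have e1 : ∑' x : L.dual.Nz, (2 * Real.pi * ‖x.1‖ ^ 2 - n) * Real.exp (-Real.pi * ‖x.1‖ ^ 2) =
      2 * Real.pi * ∑' x : L.dual.Nz, ‖x.1‖ ^ 2 * Real.exp (-Real.pi * ‖x.1‖ ^ 2) -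
        n * L.dual.theta₀ 1 := by
    rw [ht, ← tsum_mul_left, ← tsum_mul_left, ← (s1.mul_left _).tsum_sub (s0.mul_left _)]
    exact tsum_congr fun x => by ring
  simp only [mul_assoc, tsum_mul_left] at e1 h3 ⊢
  rw [e1]
  linear_combination 2 * h3 - n * h4

/-- The second variation of the height has the coefficient `n / (2 n (n + 2))`, once those of the sums
over `L*` and over `L` are added up. -/
theorem isStrictLocalMin_torusHeight (hn : 1 ≤ n) {L : EuclideanLattice n}
    (hL : invariantForms L.aut 4 ≤ invariantForms ⊤ 4)
    (hL' : invariantForms L.dual.aut 4 ≤ invariantForms ⊤ 4) :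
    L.IsStrictLocalMin torusHeight := by
  have hn0 : (0 : ℝ) < n := by exact_mod_cast hn
  have hN : (n : ℝ) / 2 < n / 2 + 1 := by linarith
  have hN0 : (0 : ℝ) < n / 2 + 1 := by positivity
  obtain ⟨c, hc⟩ := exists_torusHeight_eq_tsum hn
  obtain ⟨C, hC⟩ := exists_powerDecay_incGamma hN0 hN0
  obtain ⟨C', hC'⟩ := exists_powerDecay_incGamma hN0 hN
  obtain ⟨K, hK⟩ := hC.exists_second_variation hn hL' hN
  obtain ⟨K', hK'⟩ := hC'.exists_second_variation hn hL hN
  have e : ∑' x : L.dual.Nz, ((n + 2) * (-Real.pi * incGamma (0 + 1) (‖x.1‖ ^ 2) * ‖x.1‖ ^ 2) +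
      2 * (Real.pi ^ 2 * incGamma (0 + 1 + 1) (‖x.1‖ ^ 2) * (‖x.1‖ ^ 2) ^ 2)) =
      ∑' x : L.dual.Nz, (2 * Real.pi * ‖x.1‖ ^ 2 - n) * Real.exp (-Real.pi * ‖x.1‖ ^ 2) :=
    tsum_congr fun x => by
      rw [incGamma_second_variation 0 x.normSq_pos]
      ring
  have e' : ∑' y : L.Nz,
      ((n + 2) * (-Real.pi * incGamma ((n : ℝ) / 2 + 1) (‖y.1‖ ^ 2) * ‖y.1‖ ^ 2) +
        2 * (Real.pi ^ 2 * incGamma ((n : ℝ) / 2 + 1 + 1) (‖y.1‖ ^ 2) * (‖y.1‖ ^ 2) ^ 2)) =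
      ∑' y : L.Nz, 2 * Real.pi * ‖y.1‖ ^ 2 * Real.exp (-Real.pi * ‖y.1‖ ^ 2) :=
    tsum_congr fun y => by
      rw [incGamma_second_variation (n / 2) y.normSq_pos]
      ring
  refine isStrictLocalMin_of_second_variation (κ := n / (2 * n * (n + 2))) (K := K + L.covol * K')
    (by positivity) fun M b l δ hM hl0 hδ hl h1 h2 => ?_
  have k := hK b (fun i => -l i) δ hδ (fun i => by rw [abs_neg]; exact hl i) (by simp [hl0])
  have k' := hK' b l δ hδ hl hl0
  simp only [neg_sq] at k
  rw [e] at k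
  rw [e'] at k'
  -- as `M` and `L` have the same covolume, the terms of the height outside the two sums cancel
  rw [hc, hc, hM, h1, h2]
  have hV := L.covol_pos
  have hsv := L.second_variation_height
  set S := ∑ i, l i ^ 2
  set A := ∑' x : L.dual.Nz, (2 * Real.pi * ‖x.1‖ ^ 2 - n) * Real.exp (-Real.pi * ‖x.1‖ ^ 2)
  set A' := ∑' y : L.Nz, 2 * Real.pi * ‖y.1‖ ^ 2 * Real.exp (-Real.pi * ‖y.1‖ ^ 2)
  have k'' := mul_le_mul_of_nonneg_left k' hV.le
  rw [← abs_of_pos hV, ← abs_mul, abs_of_pos hV] at k''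
  have hk : (n : ℝ) / (2 * n * (n + 2)) * S =
      S / (2 * n * (n + 2)) * A + L.covol * (S / (2 * n * (n + 2)) * A') := by
    rw [← hsv]
    ring
  refine le_trans (le_of_eq (congrArg abs ?_)) ((abs_add_le _ _).trans
    ((add_le_add k k'').trans_eq (by ring)))
  rw [hk]
  ring

end EuclideanLattice

theorem mainTheorem3 (n : ℕ) (hn : 1 ≤ n) (L : EuclideanLattice n)
    (hL : 4 ≤ L.invariantStrength) :
    (∀ s : ℝ, (n : ℝ) / 2 < s → L.normalize.IsZetaExtreme s) ∧
    (∀ M : EuclideanLattice n, ∃ F : ℂ → ℂ, M.IsTorusZeta F) ∧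
    L.dual.IsStrictLocalMin EuclideanLattice.torusHeight := by
  have h := EuclideanLattice.invariantForms_aut_le hL
  have hd := (EuclideanLattice.invariantForms_anti L.aut_le_aut_dual 4).trans h
  refine ⟨fun s hs => ⟨EuclideanLattice.covol_normalize hn L,
    EuclideanLattice.isStrictLocalMin_epsteinZeta hn
      ((EuclideanLattice.invariantForms_anti L.aut_le_aut_normalize 4).trans h) hs⟩,
    fun M => ⟨_, M.isTorusZeta_zetaContinuation hn⟩,
    EuclideanLattice.isStrictLocalMin_torusHeight hn hd
      ((EuclideanLattice.invariantForms_anti L.dual.aut_le_aut_dual 4).trans hd)⟩
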